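/- Fix a horizon $T\ge 1$ and a Gauss–Markov source $\mathbf x_{t+1}=A_t\mathbf x_t+\mathbf w_t$, $t=0,\dots,T-1$, where $\mathbf x_t$ is $\mathbb R^{n_t}$-valued and $\mathbf x_0\sim\mathcal N(0,P_0)$, $\mathbf w_t\sim\mathcal N(0,W_t)$ are mutually independent with $P_0\succ0$ and $W_t\succ0$. Let $\Theta_t\succeq0$ and $D_t\in\mathbb R$ for $t=1,\dots,T$, and write $\|v\|_\Theta^2=v^\top\Theta v$. (P-SRD): minimize the directed information $\sum_{t=1}^T I(\mathbf x^t;\mathbf z_t\mid\mathbf z^{t-1})$, with $\mathbf x^t=(\mathbf x_0,\dots,\mathbf x_t)$ and $\mathbf z^t=(\mathbf z_1,\dots,\mathbf z_t)$, over all zero-delay reproduction policies, i.e. all sequences of stochastic kernels $q(dz_t\mid x^t,z^{t-1})$ on $\mathbb R^{n_t}$, $t=1,\dots,T$, subject to $\mathbb E\|\mathbf x_t-\mathbf z_t\|_{\Theta_t}^2\le D_t$ for $t=1,\dots,T$. (P-LGS): minimize $\sum_{t=1}^T I(\mathbf x_t;\mathbf y_t\mid\mathbf y^{t-1})$ over all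 $r_t\in\{0,1,2,\dots\}$, $C_t\in\mathbb R^{r_t\times n_t}$ and positive definite $V_t\in\mathbb R^{r_t\times r_t}$, $t=1,\dots,T$, where $\mathbf y_t=C_t\mathbf x_t+\mathbf v_t$ with $\mathbf v_t\sim\mathcal N(0,V_t)$ mutually independent and independent of the source, subject to $\mathbb E\|\mathbf x_t-\mathbf z_t\|_{\Theta_t}^2\le D_t$ for $t=1,\dots,T$, where $\mathbf z_t=\mathbb E(\mathbf x_t\mid\mathbf y_1,\dots,\mathbf y_t)$. Consider the determinant maximization problem in the matrix variables $\{P_{t|t},\Pi_t\}_{t=1}^T$, with $P_{0|0}=P_0$: $$\begin{aligned}\min\ & -\sum_{t=1}^T\tfrac12\log\det\Pi_t+c\\ \text{s.t. }& \Pi_t\succ0,\quad t=1,\dots,T,\\ & P_{t+1|t+1}\preceq A_tP_{t|t}A_t^\top+W_t,\quad t=0,\dots,T-1,\\ &\begin{bmatrix}P_{t|t}-\Pi_t & P_{t|t}A_t^\top\\ A_tP_{t|t}& W_t+A_tP_{t|t}A_t^\top\end{bmatrix}\succeq0,\quad t=1,\dots,T-1,\\ &\operatorname{Tr}(\Theta_tP_{t|t})\le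 D_t,\quad t=1,\dots,T,\qquad P_{T|T}=\Pi_T,\end{aligned}$$ where $c=\tfrac12\log\det(A_0P_{0|0}A_0^\top+W_0)+\sum_{t=1}^{T-1}\tfrac12\log\det W_t$. Theorem. If $D_t>0$ for all $t=1,\dots,T$, this problem has an optimal solution. Moreover, for every optimal solution $\{P_{t|t},\Pi_t\}$ (whatever the $D_t$) the following hold. (1) For $t=1,\dots,T$, $P_{t|t}\succ0$ and $\mathsf{SNR}_t:=P_{t|t}^{-1}-(A_{t-1}P_{t-1|t-1}A_{t-1}^\top+W_{t-1})^{-1}\succeq0$. (2) Each $\mathsf{SNR}_t$ has a reduced singular value decomposition $\mathsf{SNR}_t=U_t\Sigma_tU_t^\top$ ($U_t^\top U_t=I$, $\Sigma_t$ diagonal with positive diagonal entries, possibly of size $0$), and for every such decomposition $C_t=U_t^\top$, $V_t=\Sigma_t^{-1}$ satisfy $V_t\succ0$ and $C_t^\top V_t^{-1}C_t=\mathsf{SNR}_t$. (3) Every $\{C_t,V_t\}_{t=1}^T$ with $V_t\succ0$ and $C_t^\top V_t^{-1}C_t=\mathsf{SNR}_t$ for $t=1,\dots,T$ is an optimal solution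 of (P-LGS), and its cost equals the optimal value of the determinant maximization problem. (4) For such $\{C_t,V_t\}$, the composition of the sensors $\mathbf y_t=C_t\mathbf x_t+\mathbf v_t$ and the estimator $\mathbf z_t=\mathbb E(\mathbf x_t\mid\mathbf y^t)$ is realized by a zero-delay reproduction policy (one that generates the same joint law of $(\mathbf x^T,\mathbf z^T)$), and every such policy is an optimal solution of (P-SRD), with the same optimal value. -/

import Mathlib

open MeasureTheory ProbabilityTheory InformationTheory Matrix
open scoped ENNReal

namespace GaussSRD

noncomputable section

/-- Column vectors of length `k` with the Euclidean structure. -/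
abbrev Vec (k : ℕ) : Type := EuclideanSpace ℝ (Fin k)

/-- Matrix-vector product on Euclidean vectors. -/
def mulVecE {a b : ℕ} (M : Matrix (Fin b) (Fin a) ℝ) (v : Vec a) : Vec b :=
  WithLp.toLp 2 (M *ᵥ v.ofLp)

/-- The squared seminorm `‖v‖_Θ² = vᵀ Θ v`. -/
def wnormSq {k : ℕ} (Θ : Matrix (Fin k) (Fin k) ℝ) (v : Vec k) : ℝ :=
  v.ofLp ⬝ᵥ (Θ *ᵥ v.ofLp)

/-! ### Conditional mutual information -/

/-- The conditional mutual information
`I(X;Y|Z) = ∫ D_KL(law of (X,Y) given Z = c ‖ law of X given Z = c × law of Y given Z = c)`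
integrated over the law of `Z` (natural logarithms, values in `[0,∞]`). -/
def condMutualInfo {Ω α β γ : Type*} [MeasurableSpace Ω]
    [MeasurableSpace α] [StandardBorelSpace α] [Nonempty α]
    [MeasurableSpace β] [StandardBorelSpace β] [Nonempty β] [MeasurableSpace γ]
    (μ : Measure Ω) [IsFiniteMeasure μ] (X : Ω → α) (Y : Ω → β) (Z : Ω → γ) : ℝ≥0∞ :=
  ∫⁻ c, klDiv (condDistrib (fun ω => (X ω, Y ω)) Z μ c)
    ((condDistrib X Z μ c).prod (condDistrib Y Z μ c)) ∂(μ.map Z)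

/-! ### The Gauss-Markov source -/

/-- The data of a Gauss-Markov source `x_{t+1} = A_t x_t + w_t`, `x_0 ∼ N(0, P0)`,
`w_t ∼ N(0, W_t)`, where `x_t` takes values in `ℝ^{n_t}`. -/
structure Source where
  /-- the dimensions `n_t` -/
  n : ℕ → ℕ
  /-- the system matrices `A_t` -/
  A : (t : ℕ) → Matrix (Fin (n (t + 1))) (Fin (n t)) ℝ
  /-- the noise covariances `W_t` (the noise `w_t` drives `x_{t+1}`) -/
  W : (t : ℕ) → Matrix (Fin (n (t + 1))) (Fin (n (t + 1))) ℝ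
  /-- the covariance of `x_0` -/
  P0 : Matrix (Fin (n 0)) (Fin (n 0)) ℝ

/-- The linear-Gaussian kernel `v ↦ law of M v + g`, where `g ∼ N(0, S)`. -/
def gaussChannel {a b : ℕ} (M : Matrix (Fin b) (Fin a) ℝ) (S : Matrix (Fin b) (Fin b) ℝ) :
    Kernel (Vec a) (Vec b) :=
  (Kernel.id ×ₖ Kernel.const (Vec a) (multivariateGaussian (0 : Vec b) S)).map
    (fun p => mulVecE M p.1 + p.2)

lemma measurable_mulVecE_add {a b : ℕ} (M : Matrix (Fin b) (Fin a) ℝ) :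
    Measurable (fun p : Vec a × Vec b => mulVecE M p.1 + p.2) := by
  have h : Continuous (fun p : Vec a × Vec b => mulVecE M p.1 + p.2) := by
    unfold mulVecE
    fun_prop
  exact h.measurable

instance {a b : ℕ} (M : Matrix (Fin b) (Fin a) ℝ) (S : Matrix (Fin b) (Fin b) ℝ) :
    IsMarkovKernel (gaussChannel M S) := by
  unfold gaussChannel
  exact Kernel.IsMarkovKernel.map _ (measurable_mulVecE_add M)

/-! ### Causal output policies and the joint law of source and outputs -/

/-- A zero-delay policy: for each time `t + 1 ≥ 1`, a stochastic kernel giving the law of the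
output at time `t + 1` (a vector of length `m (t + 1)`), conditionally on
`(x_0, …, x_t)`, `x_{t+1}` and the past outputs at the times `1, …, t`. -/
structure Policy (n m : ℕ → ℕ) where
  /-- the kernel of the output at time `t + 1` -/
  kernel : (t : ℕ) → Kernel
    ((Π i : Finset.Iic t, Vec (n i)) × Vec (n (t + 1)) × (Π i : Finset.Icc 1 t, Vec (m i)))
    (Vec (m (t + 1)))
  markov : ∀ t, IsMarkovKernel (kernel t)

attribute [instance] Policy.markov

/-- The pair `(x_t, output at time t)`. There is no output at time `0`: that slot is filled with
the constant `0` and is never read. -/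
abbrev Stage (n m : ℕ → ℕ) (t : ℕ) : Type := Vec (n t) × Vec (m t)

/-- Trajectories of the source together with the outputs. -/
abbrev SrcTraj (n m : ℕ → ℕ) : Type := (t : ℕ) → Stage n m t

/-- Rearranges the history up to time `t` together with `x_{t+1}` into the input of the policy. -/
def policyInput (n m : ℕ → ℕ) (t : ℕ)
    (p : (Π i : Finset.Iic t, Stage n m i) × Vec (n (t + 1))) :
    (Π i : Finset.Iic t, Vec (n i)) × Vec (n (t + 1)) × (Π i : Finset.Icc 1 t, Vec (m i)) :=
  (fun i => (p.1 i).1, p.2,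
    fun i => (p.1 ⟨i.1, Finset.mem_Iic.2 (Finset.mem_Icc.1 i.2).2⟩).2)

lemma measurable_policyInput (n m : ℕ → ℕ) (t : ℕ) : Measurable (policyInput n m t) := by
  unfold policyInput
  fun_prop

/-- The current source state in a history up to time `t`. -/
def lastState (n m : ℕ → ℕ) (t : ℕ) (h : Π i : Finset.Iic t, Stage n m i) : Vec (n t) :=
  (h ⟨t, Finset.mem_Iic.2 le_rfl⟩).1

lemma measurable_lastState (n m : ℕ → ℕ) (t : ℕ) : Measurable (lastState n m t) := by
  unfold lastState
  fun_prop

/-- One time step: first `x_{t+1} = A_t x_t + w_t` with fresh noise `w_t ∼ N(0, W_t)`, then the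
output at time `t + 1`, drawn from the policy. -/
def stepKernel (S : Source) {m : ℕ → ℕ} (γ : Policy S.n m) (t : ℕ) :
    Kernel (Π i : Finset.Iic t, Stage S.n m i) (Stage S.n m (t + 1)) :=
  ((gaussChannel (S.A t) (S.W t)).comap (lastState S.n m t) (measurable_lastState S.n m t)) ⊗ₖ
    ((γ.kernel t).comap (policyInput S.n m t) (measurable_policyInput S.n m t))

instance (S : Source) {m : ℕ → ℕ} (γ : Policy S.n m) (t : ℕ) :
    IsMarkovKernel (stepKernel S γ t) := by
  unfold stepKernel
  infer_instance

/-- The joint law of the source and of the outputs generated by the policy `γ`. -/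
def jointLaw (S : Source) {m : ℕ → ℕ} (γ : Policy S.n m) : Measure (SrcTraj S.n m) :=
  Kernel.trajMeasure (X := Stage S.n m)
    ((multivariateGaussian (0 : Vec (S.n 0)) S.P0).prod (Measure.dirac (0 : Vec (m 0))))
    (stepKernel S γ)

instance (S : Source) {m : ℕ → ℕ} (γ : Policy S.n m) :
    IsProbabilityMeasure (jointLaw S γ) := by
  unfold jointLaw
  infer_instance

/-- The source at time `t`. -/
def xAt (n m : ℕ → ℕ) (t : ℕ) (ω : SrcTraj n m) : Vec (n t) := (ω t).1

/-- The output at time `t ≥ 1`. -/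
def outAt (n m : ℕ → ℕ) (t : ℕ) (ω : SrcTraj n m) : Vec (m t) := (ω t).2

/-- The source history `(x_0, …, x_t)`. -/
def xHist (n m : ℕ → ℕ) (t : ℕ) (ω : SrcTraj n m) : Π i : Finset.Iic t, Vec (n i) :=
  fun i => (ω i).1

/-- The output history at the times `1, …, t`. -/
def outHist (n m : ℕ → ℕ) (t : ℕ) (ω : SrcTraj n m) : Π i : Finset.Icc 1 t, Vec (m i) :=
  fun i => (ω i).2

/-! ### The Gaussian sequential rate-distortion problem -/

/-- The directed information `∑_{t=1}^T I(x^t ; z_t | z^{t-1})`. -/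
def srdCost (S : Source) (T : ℕ) (γ : Policy S.n S.n) : ℝ≥0∞ :=
  ∑ t ∈ Finset.Icc 1 T,
    condMutualInfo (jointLaw S γ) (xHist S.n S.n t) (outAt S.n S.n t) (outHist S.n S.n (t - 1))

/-- The distortion constraints `E ‖x_t - z_t‖²_{Θ_t} ≤ D_t`, `t = 1, …, T`; the expectation is
required to be finite. -/
def SRDFeasible (S : Source) (T : ℕ) (Θ : (t : ℕ) → Matrix (Fin (S.n t)) (Fin (S.n t)) ℝ)
    (D : ℕ → ℝ) (γ : Policy S.n S.n) : Prop :=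
  ∀ t, 1 ≤ t → t ≤ T →
    Integrable (fun ω => wnormSq (Θ t) (xAt S.n S.n t ω - outAt S.n S.n t ω)) (jointLaw S γ) ∧
    ∫ ω, wnormSq (Θ t) (xAt S.n S.n t ω - outAt S.n S.n t ω) ∂(jointLaw S γ) ≤ D t

/-- `γ` is an optimal solution of the Gaussian sequential rate-distortion problem. -/
def SRDOptimal (S : Source) (T : ℕ) (Θ : (t : ℕ) → Matrix (Fin (S.n t)) (Fin (S.n t)) ℝ)
    (D : ℕ → ℝ) (γ : Policy S.n S.n) : Prop :=
  SRDFeasible S T Θ D γ ∧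
    ∀ γ' : Policy S.n S.n, SRDFeasible S T Θ D γ' → srdCost S T γ ≤ srdCost S T γ'

/-! ### The linear-Gaussian sensor design problem -/

/-- A sequence of linear sensors `y_t = C_t x_t + v_t`, `v_t ∼ N(0, V_t)`, with outputs of
arbitrary lengths `r_t ≥ 0`. -/
structure Sensor (n : ℕ → ℕ) where
  /-- the sensor dimensions -/
  r : ℕ → ℕ
  /-- the sensing gains -/
  C : (t : ℕ) → Matrix (Fin (r t)) (Fin (n t)) ℝ
  /-- the noise covariances -/
  V : (t : ℕ) → Matrix (Fin (r t)) (Fin (r t)) ℝ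

/-- The noise covariances are positive definite at the times `1, …, T`. -/
def Sensor.Admissible {n : ℕ → ℕ} (s : Sensor n) (T : ℕ) : Prop :=
  ∀ t, 1 ≤ t → t ≤ T → (s.V t).PosDef

/-- The matrix signal-to-noise ratio `C_tᵀ V_t⁻¹ C_t`. -/
def Sensor.snr {n : ℕ → ℕ} (s : Sensor n) (t : ℕ) : Matrix (Fin (n t)) (Fin (n t)) ℝ :=
  (s.C t)ᵀ * (s.V t)⁻¹ * s.C t

/-- The sensor outputs `y_t = C_t x_t + v_t` as a (memoryless) output policy. -/
def Sensor.policy {n : ℕ → ℕ} (s : Sensor n) : Policy n s.r where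
  kernel t := (gaussChannel (s.C (t + 1)) (s.V (t + 1))).comap (fun p => p.2.1) (by fun_prop)
  markov _ := inferInstance

/-- The joint law of the source and the sensor outputs. -/
abbrev sensorLaw (S : Source) (s : Sensor S.n) : Measure (SrcTraj S.n s.r) := jointLaw S s.policy

/-- The least mean square error estimate `z_t = E(x_t | y_1, …, y_t)` (the Kalman filter). -/
def estimate (S : Source) (s : Sensor S.n) (t : ℕ) : SrcTraj S.n s.r → Vec (S.n t) :=
  condExp (MeasurableSpace.comap (outHist S.n s.r t) inferInstance) (sensorLaw S s) (xAt S.n s.r t)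

/-- The information cost `∑_{t=1}^T I(x_t ; y_t | y^{t-1})`. -/
def lgsCost (S : Source) (T : ℕ) (s : Sensor S.n) : ℝ≥0∞ :=
  ∑ t ∈ Finset.Icc 1 T,
    condMutualInfo (sensorLaw S s) (xAt S.n s.r t) (outAt S.n s.r t) (outHist S.n s.r (t - 1))

/-- Admissible sensors with `E ‖x_t - z_t‖²_{Θ_t} ≤ D_t`, `t = 1, …, T`. -/
def LGSFeasible (S : Source) (T : ℕ) (Θ : (t : ℕ) → Matrix (Fin (S.n t)) (Fin (S.n t)) ℝ)
    (D : ℕ → ℝ) (s : Sensor S.n) : Prop :=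
  s.Admissible T ∧ ∀ t, 1 ≤ t → t ≤ T →
    Integrable (fun ω => wnormSq (Θ t) (xAt S.n s.r t ω - estimate S s t ω)) (sensorLaw S s) ∧
    ∫ ω, wnormSq (Θ t) (xAt S.n s.r t ω - estimate S s t ω) ∂(sensorLaw S s) ≤ D t

/-- `s` is an optimal solution of the linear-Gaussian sensor design problem. The competitors
may have any sensor dimensions. -/
def LGSOptimal (S : Source) (T : ℕ) (Θ : (t : ℕ) → Matrix (Fin (S.n t)) (Fin (S.n t)) ℝ)
    (D : ℕ → ℝ) (s : Sensor S.n) : Prop :=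
  LGSFeasible S T Θ D s ∧
    ∀ s' : Sensor S.n, LGSFeasible S T Θ D s' → lgsCost S T s ≤ lgsCost S T s'

/-- The reproduction policy `γ` is the composition of the sensors `s` with the least mean square
error estimator: the law of `(x_0, …, x_T, z_1, …, z_T)` under `γ` is the law of
`(x_0, …, x_T, E(x_1 | y^1), …, E(x_T | y^T))`. -/
def IsComposition (S : Source) (T : ℕ) (s : Sensor S.n) (γ : Policy S.n S.n) : Prop :=
  (jointLaw S γ).map (fun ω => (xHist S.n S.n T ω, outHist S.n S.n T ω)) =
    (sensorLaw S s).map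
      (fun ω => (xHist S.n s.r T ω, fun i : Finset.Icc 1 T => estimate S s i ω))

/-! ### The determinant maximization problem -/

/-- The feasible set of the determinant maximization problem in the variables
`P_t` (standing for `P_{t|t}`) and `Π_t` (written `Q t`), `t = 1, …, T`, where `P_0` is given. -/
structure MaxDetFeasible (S : Source) (T : ℕ)
    (Θ : (t : ℕ) → Matrix (Fin (S.n t)) (Fin (S.n t)) ℝ) (D : ℕ → ℝ)
    (P Q : (t : ℕ) → Matrix (Fin (S.n t)) (Fin (S.n t)) ℝ) : Prop where
  init : P 0 = S.P0
  pos : ∀ t, 1 ≤ t → t ≤ T → (Q t).PosDef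
  step : ∀ t, t < T → (S.A t * P t * (S.A t)ᵀ + S.W t - P (t + 1)).PosSemidef
  lmi : ∀ t, 1 ≤ t → t < T →
    (Matrix.fromBlocks (P t - Q t) (P t * (S.A t)ᵀ)
      (S.A t * P t) (S.W t + S.A t * P t * (S.A t)ᵀ)).PosSemidef
  trace_le : ∀ t, 1 ≤ t → t ≤ T → (Θ t * P t).trace ≤ D t
  final : P T = Q T

/-- The constant `c = ½ log det (A_0 P_0 A_0ᵀ + W_0) + ∑_{t=1}^{T-1} ½ log det W_t`. -/
def maxDetConst (S : Source) (T : ℕ) : ℝ :=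
  (1 / 2) * Real.log (S.A 0 * S.P0 * (S.A 0)ᵀ + S.W 0).det +
    ∑ t ∈ Finset.Ico 1 T, (1 / 2) * Real.log (S.W t).det

/-- The objective `-∑_{t=1}^T ½ log det Π_t + c`. -/
def maxDetObj (S : Source) (T : ℕ)
    (Q : (t : ℕ) → Matrix (Fin (S.n t)) (Fin (S.n t)) ℝ) : ℝ :=
  -(∑ t ∈ Finset.Icc 1 T, (1 / 2) * Real.log (Q t).det) + maxDetConst S T

/-- `(P, Π)` is an optimal solution of the determinant maximization problem. -/
def MaxDetOptimal (S : Source) (T : ℕ)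
    (Θ : (t : ℕ) → Matrix (Fin (S.n t)) (Fin (S.n t)) ℝ) (D : ℕ → ℝ)
    (P Q : (t : ℕ) → Matrix (Fin (S.n t)) (Fin (S.n t)) ℝ) : Prop :=
  MaxDetFeasible S T Θ D P Q ∧
    ∀ P' Q', MaxDetFeasible S T Θ D P' Q' → maxDetObj S T Q ≤ maxDetObj S T Q'

/-- The signal-to-noise ratio at time `t + 1` recovered from the sequence `P`:
`P_{t+1}⁻¹ - (A_t P_t A_tᵀ + W_t)⁻¹`. -/
def snrOf (S : Source) (P : (t : ℕ) → Matrix (Fin (S.n t)) (Fin (S.n t)) ℝ) (t : ℕ) :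
    Matrix (Fin (S.n (t + 1))) (Fin (S.n (t + 1))) ℝ :=
  (P (t + 1))⁻¹ - (S.A t * P t * (S.A t)ᵀ + S.W t)⁻¹

/-- `M = U diag(σ) Uᵀ` is a reduced singular value decomposition of the symmetric positive
semidefinite matrix `M`: orthonormal columns, positive singular values. -/
structure IsReducedSVD {k r : ℕ} (M : Matrix (Fin k) (Fin k) ℝ)
    (U : Matrix (Fin k) (Fin r) ℝ) (σ : Fin r → ℝ) : Prop where
  orthonormal : Uᵀ * U = 1
  pos : ∀ i, 0 < σ i
  eq : M = U * Matrix.diagonal σ * Uᵀ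

/-- The sensors read off from a family of singular value decompositions:
`C_t = U_tᵀ`, `V_t = diag(σ_t)⁻¹`. -/
def sensorOfSVD {n : ℕ → ℕ} (r : ℕ → ℕ) (U : (t : ℕ) → Matrix (Fin (n t)) (Fin (r t)) ℝ)
    (σ : (t : ℕ) → Fin (r t) → ℝ) : Sensor n where
  r := r
  C t := (U t)ᵀ
  V t := Matrix.diagonal (fun i => (σ t i)⁻¹)

end

end GaussSRD

open GaussSRD

namespace GaussSRD
noncomputable section

/-! ### Positive definite matrices -/

section PosDef

variable {k l : ℕ}

/-! The determinant maximization problem is a disguised rate minimization. By Schur complements the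
block inequality says that `Π_t` lies below the covariance of `x_t` given `x_{t+1}`, when `x_t` has
covariance `P_t`. Since `log det` is monotone, the best `Π_t` is that bound, and the objective
becomes `rateOf`, the sum of `½ (log det Σ_{t+1} - log det P_{t+1})` with `Σ_{t+1} = A_t P_t A_tᵀ +
W_t`. What remains is to minimize over sequences with `P_{t+1} ⪯ Σ_{t+1}` and the trace constraints
(`MaxDetFeasible.rateOf_le`, `MaxDetOptimal.le_rateOf`).

Converse (`ofReal_maxDetObj_le_histInfo`). The outputs do not feed back into the source, so both
information costs telescope to the mutual information of the whole source history and the whole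
output history. Let `E_t` be the error covariance of the conditional mean of `x_t` given the outputs
up to `t`. If every `E_t` is nonsingular, the Donsker-Varadhan inequality is applied to the sum over
`t` of the log-likelihood ratios between the Gaussian with the estimated mean and covariance
`E_{t+1}` and the Gaussian predicted from time `t`. For fixed outputs its exponential integrates to
one over the source law; under the joint law its mean is exactly `rateOf` of `E`. The outputs need
not be Gaussian. Mean square optimality makes `E` admissible in the reduced problem, so the rate is
at least the optimal value. If some `E_{t+1}` is singular, a linear functional of `x_{t+1}` is
determined by the outputs, and the information is infinite.

Achievability. For sensors with `C_tᵀ V_t⁻¹ C_t = SNR_t`, a linear filter with gain `P_t C_tᵀ V_t⁻¹`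
has error covariance exactly `P_t` (`linFilter_error`). The conditional mean does no worse, and
comparing the output law with the Gaussian prediction of the filter bounds the information by
`rateOf` of `P`. With the converse this forces equality, without identifying the filter with the
conditional mean. Passing from outputs to estimates preserves distortion and cannot increase
information, so the composition attains the same value.

Existence of an optimum follows by maximizing the product of the determinants over the compact
closure of the feasible set. -/

lemma one_le_det_one_add {ι : Type*} [Fintype ι] [DecidableEq ι] {X : Matrix ι ι ℝ}
    (hX : X.PosSemidef) : 1 ≤ (1 + X).det := by
  have h1 : (1 + X).PosSemidef := PosSemidef.one.add hX
  rw [h1.1.det_eq_prod_eigenvalues]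
  have : ∀ i, (1 : ℝ) ≤ h1.1.eigenvalues i := by
    intro i
    have hv := h1.1.mulVec_eigenvectorBasis i
    set v := (h1.1.eigenvectorBasis i).ofLp with hvdef
    have hn : v ⬝ᵥ v = 1 := by
      have := h1.1.eigenvectorBasis.orthonormal.1 i
      have h2 : ‖h1.1.eigenvectorBasis i‖ ^ 2 = 1 := by rw [this]; norm_num
      rw [EuclideanSpace.real_norm_sq_eq] at h2
      rw [← h2]
      simp [dotProduct, hvdef, sq]
    have h3 : v ⬝ᵥ ((1 + X) *ᵥ v) = h1.1.eigenvalues i := by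
      rw [hv, dotProduct_smul, hn]; simp
    have h4 : 0 ≤ v ⬝ᵥ (X *ᵥ v) := by simpa using hX.dotProduct_mulVec_nonneg v
    rw [add_mulVec, one_mulVec, dotProduct_add, hn] at h3
    linarith
  calc (1 : ℝ) = ∏ _i : ι, (1 : ℝ) := by simp
    _ ≤ _ := by
      refine Finset.prod_le_prod (fun _ _ => zero_le_one) (fun i _ => ?_)
      simpa using this i

open scoped MatrixOrder in
lemma PosSemidef.exists_eq_transpose_mul_self {ι : Type*} [Fintype ι] [DecidableEq ι]
    {Q : Matrix ι ι ℝ} (hQ : Q.PosSemidef) : ∃ B : Matrix ι ι ℝ, Q = Bᵀ * B := by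
  refine ⟨CFC.sqrt Q, ?_⟩
  have h : (CFC.sqrt Q)ᵀ = CFC.sqrt Q := by
    simpa [IsSelfAdjoint, star_eq_conjTranspose] using (CFC.sqrt_nonneg Q).isSelfAdjoint
  rw [h, CFC.sqrt_mul_sqrt_self _ hQ.nonneg]

/-- Writing `Q = Bᵀ B` with `B` invertible gives `M = Bᵀ (1 + X) B` with `X ⪰ 0`, and the middle
factor has determinant at least one. -/
lemma det_le_det_of_sub_posSemidef {ι : Type*} [Fintype ι] [DecidableEq ι] {Q M : Matrix ι ι ℝ}
    (hQ : Q.PosDef) (h : (M - Q).PosSemidef) : Q.det ≤ M.det := by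
  obtain ⟨B, hB⟩ := PosSemidef.exists_eq_transpose_mul_self hQ.posSemidef
  have hdet : Q.det = B.det * B.det := by rw [hB]; simp
  have hB0 : IsUnit B.det := by
    rw [isUnit_iff_ne_zero]
    intro h0
    have := hQ.det_pos
    rw [hdet, h0] at this
    simp at this
  have hM : M = Bᵀ * (1 + (B⁻¹)ᵀ * (M - Q) * B⁻¹) * B := by
    rw [Matrix.mul_add, Matrix.add_mul, Matrix.mul_one]
    have h1 : Bᵀ * ((B⁻¹)ᵀ * (M - Q) * B⁻¹) * B = M - Q := by
      have e1 : Bᵀ * (B⁻¹)ᵀ = 1 := by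
        rw [← transpose_mul, nonsing_inv_mul _ hB0, transpose_one]
      calc Bᵀ * ((B⁻¹)ᵀ * (M - Q) * B⁻¹) * B = (Bᵀ * (B⁻¹)ᵀ) * (M - Q) * (B⁻¹ * B) := by
            simp only [Matrix.mul_assoc]
        _ = _ := by rw [e1, nonsing_inv_mul _ hB0]; simp
    rw [h1]
    rw [← hB]; abel
  have hX : ((B⁻¹)ᵀ * (M - Q) * B⁻¹).PosSemidef := by
    have := h.conjTranspose_mul_mul_same B⁻¹
    simpa using this
  rw [hM, det_mul, det_mul, det_transpose, hdet]
  have := one_le_det_one_add hX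
  nlinarith [mul_self_nonneg B.det]

/-- The two differences are the two Schur complements of the block matrix with diagonal blocks `M`,
`P⁻¹` and off-diagonal blocks `1`, so one is positive semidefinite exactly when the other is. -/
lemma posSemidef_inv_sub_inv {ι : Type*} [Fintype ι] [DecidableEq ι] {P M : Matrix ι ι ℝ}
    (hP : P.PosDef) (hM : M.PosDef) (h : (M - P).PosSemidef) : (P⁻¹ - M⁻¹).PosSemidef := by
  have := hP.inv
  let _ : Invertible M := hM.isUnit.invertible
  let _ : Invertible P⁻¹ := hP.inv.isUnit.invertible
  have h1 := PosDef.fromBlocks₁₁ (1 : Matrix ι ι ℝ) P⁻¹ hM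
  have h2 := PosDef.fromBlocks₂₂ M (1 : Matrix ι ι ℝ) hP.inv
  simp only [conjTranspose_one, Matrix.one_mul, Matrix.mul_one] at h1 h2
  rw [nonsing_inv_nonsing_inv _ ((isUnit_iff_isUnit_det _).1 hP.isUnit)] at h2
  exact h1.1 (h2.2 h)

/-- The covariance after one time step without observation. -/
def predCov (A : Matrix (Fin l) (Fin k) ℝ) (W : Matrix (Fin l) (Fin l) ℝ)
    (P : Matrix (Fin k) (Fin k) ℝ) : Matrix (Fin l) (Fin l) ℝ :=
  A * P * Aᵀ + W

/-- The covariance of the current state given the next state. -/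
def smoothCov (A : Matrix (Fin l) (Fin k) ℝ) (W : Matrix (Fin l) (Fin l) ℝ)
    (P : Matrix (Fin k) (Fin k) ℝ) : Matrix (Fin k) (Fin k) ℝ :=
  P - P * Aᵀ * (predCov A W P)⁻¹ * (A * P)

variable {A : Matrix (Fin l) (Fin k) ℝ} {W : Matrix (Fin l) (Fin l) ℝ}
  {P Q : Matrix (Fin k) (Fin k) ℝ}

lemma predCov_posDef (hP : P.PosSemidef) (hW : W.PosDef) : (predCov A W P).PosDef := by
  have : (A * P * Aᵀ).PosSemidef := by simpa using hP.mul_mul_conjTranspose_same A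
  exact PosDef.posSemidef_add this hW

/-- This is what eliminates `Π`: the lower right block is `predCov A W P ≻ 0`, and its Schur
complement is `smoothCov A W P - Q`. -/
lemma lmi_iff (hP : P.PosSemidef) (hW : W.PosDef) :
    (Matrix.fromBlocks (P - Q) (P * Aᵀ) (A * P) (W + A * P * Aᵀ)).PosSemidef ↔
      (smoothCov A W P - Q).PosSemidef := by
  have hS := predCov_posDef (A := A) hP hW
  let _ : Invertible (predCov A W P) := hS.isUnit.invertible
  have h := PosDef.fromBlocks₂₂ (P - Q) (P * Aᵀ) hS
  have e : (P * Aᵀ)ᴴ = A * P := by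
    rw [conjTranspose_mul]
    rw [hP.1.eq]; simp
  rw [e] at h
  have e2 : W + A * P * Aᵀ = predCov A W P := add_comm _ _
  rw [e2, h]
  have : P - Q - P * Aᵀ * (predCov A W P)⁻¹ * (A * P) = smoothCov A W P - Q := by
    unfold smoothCov; abel
  rw [this]

lemma isUnit_det_of_posDef {ι : Type*} [Fintype ι] [DecidableEq ι] {M : Matrix ι ι ℝ}
    (h : M.PosDef) : IsUnit M.det := (isUnit_iff_isUnit_det _).1 h.isUnit

/-- Woodbury's identity, checked by multiplication: `A P` times the second factor collapses to `Σ
W⁻¹ A`, where `Σ = predCov A W P`. -/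
lemma inv_smoothCov (hP : P.PosDef) (hW : W.PosDef) :
    (smoothCov A W P) * (P⁻¹ + Aᵀ * W⁻¹ * A) = 1 := by
  have hS := predCov_posDef (A := A) hP.posSemidef hW
  have uS := isUnit_det_of_posDef hS
  have uP := isUnit_det_of_posDef hP
  have uW := isUnit_det_of_posDef hW
  set Sg := predCov A W P with hSg
  have e1 : A * P * Aᵀ * W⁻¹ = Sg * W⁻¹ - 1 := by
    rw [hSg, predCov, Matrix.add_mul, mul_nonsing_inv _ uW]; abel
  have e2 : A * P * (P⁻¹ + Aᵀ * W⁻¹ * A) = Sg * W⁻¹ * A := by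
    rw [Matrix.mul_add, Matrix.mul_assoc A P P⁻¹, mul_nonsing_inv _ uP, Matrix.mul_one]
    have : A * P * (Aᵀ * W⁻¹ * A) = A * P * Aᵀ * W⁻¹ * A := by simp only [Matrix.mul_assoc]
    rw [this, e1, Matrix.sub_mul, Matrix.one_mul]; abel
  unfold smoothCov
  rw [← hSg, Matrix.sub_mul, Matrix.mul_assoc _ (A * P), e2, Matrix.mul_add, mul_nonsing_inv _ uP]
  have : P * Aᵀ * Sg⁻¹ * (Sg * W⁻¹ * A) = P * (Aᵀ * W⁻¹ * A) := by
    calc P * Aᵀ * Sg⁻¹ * (Sg * W⁻¹ * A) = P * Aᵀ * (Sg⁻¹ * Sg) * (W⁻¹ * A) := by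
          simp only [Matrix.mul_assoc]
      _ = _ := by rw [nonsing_inv_mul _ uS]; simp only [Matrix.mul_assoc, Matrix.mul_one]
  rw [this]; abel

lemma posDef_inv_add (hP : P.PosDef) (hW : W.PosDef) : (P⁻¹ + Aᵀ * W⁻¹ * A).PosDef := by
  have : (Aᵀ * W⁻¹ * A).PosSemidef := by
    simpa using hW.inv.posSemidef.conjTranspose_mul_mul_same A
  exact hP.inv.add_posSemidef this

lemma smoothCov_eq_inv (hP : P.PosDef) (hW : W.PosDef) :
    smoothCov A W P = (P⁻¹ + Aᵀ * W⁻¹ * A)⁻¹ :=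
  (inv_eq_left_inv (inv_smoothCov hP hW)).symm

lemma smoothCov_posDef (hP : P.PosDef) (hW : W.PosDef) : (smoothCov A W P).PosDef := by
  rw [smoothCov_eq_inv hP hW]
  exact (posDef_inv_add hP hW).inv

/-- The two sides factor the determinant of the joint covariance of two consecutive states in the
two possible orders. The proof uses `det (1 + XY) = det (1 + YX)`. -/
lemma det_smoothCov (hP : P.PosDef) (hW : W.PosDef) :
    (smoothCov A W P).det * (predCov A W P).det = P.det * W.det := by
  have uP := isUnit_det_of_posDef hP
  have uW := isUnit_det_of_posDef hW
  have h1 : predCov A W P = W * (1 + (W⁻¹ * A) * (P * Aᵀ)) := by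
    have : W * ((W⁻¹ * A) * (P * Aᵀ)) = (W * W⁻¹) * (A * P * Aᵀ) := by simp only [Matrix.mul_assoc]
    rw [Matrix.mul_add, predCov, Matrix.mul_one, this, mul_nonsing_inv _ uW, Matrix.one_mul,
      add_comm]
  have h2 : P⁻¹ + Aᵀ * W⁻¹ * A = P⁻¹ * (1 + (P * Aᵀ) * (W⁻¹ * A)) := by
    rw [Matrix.mul_add, Matrix.mul_one]
    have : P⁻¹ * ((P * Aᵀ) * (W⁻¹ * A)) = (P⁻¹ * P) * (Aᵀ * W⁻¹ * A) := by
      simp only [Matrix.mul_assoc]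
    rw [this, nonsing_inv_mul _ uP, Matrix.one_mul]
  have h3 := congrArg Matrix.det (inv_smoothCov (A := A) hP hW)
  rw [det_mul, h2, det_mul, det_one, det_one_add_mul_comm, det_nonsing_inv] at h3
  rw [h1, det_mul]
  have hp := hP.det_pos.ne'
  rw [Ring.inverse_eq_inv'] at h3
  field_simp at h3
  rw [mul_left_comm, h3, mul_comm]

lemma log_det_smoothCov (hP : P.PosDef) (hW : W.PosDef) :
    Real.log (smoothCov A W P).det =
      Real.log P.det + Real.log W.det - Real.log (predCov A W P).det := by
  have h := congrArg Real.log (det_smoothCov (A := A) hP hW)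
  rw [Real.log_mul (smoothCov_posDef hP hW).det_pos.ne'
    (predCov_posDef hP.posSemidef hW).det_pos.ne', Real.log_mul hP.det_pos.ne' hW.det_pos.ne'] at h
  linarith

end PosDef

/-! ### The rate function of a sequence of error covariances -/

variable {S : Source} {T : ℕ} {Θ : (t : ℕ) → Matrix (Fin (S.n t)) (Fin (S.n t)) ℝ} {D : ℕ → ℝ}
  {P Q : (t : ℕ) → Matrix (Fin (S.n t)) (Fin (S.n t)) ℝ}

/-- The prediction error covariance at time `t + 1`. -/
def predAt (S : Source) (P : (t : ℕ) → Matrix (Fin (S.n t)) (Fin (S.n t)) ℝ) (t : ℕ) :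
    Matrix (Fin (S.n (t + 1))) (Fin (S.n (t + 1))) ℝ :=
  predCov (S.A t) (S.W t) (P t)

/-- The rate `∑ ½ (log det Σ_{t+1} - log det P_{t+1})`, where `Σ_{t+1} = A_t P_t A_tᵀ + W_t`. -/
def rateOf (S : Source) (T : ℕ) (P : (t : ℕ) → Matrix (Fin (S.n t)) (Fin (S.n t)) ℝ) : ℝ :=
  ∑ t ∈ Finset.range T, (1 / 2) * (Real.log (predAt S P t).det - Real.log (P (t + 1)).det)

/-- The largest admissible `Π` for given `P`. -/
def maxPi (S : Source) (T : ℕ) (P : (t : ℕ) → Matrix (Fin (S.n t)) (Fin (S.n t)) ℝ) (t : ℕ) :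
    Matrix (Fin (S.n t)) (Fin (S.n t)) ℝ :=
  if t < T then smoothCov (S.A t) (S.W t) (P t) else P t

lemma MaxDetFeasible.posDef (hP0 : S.P0.PosDef) (h : MaxDetFeasible S T Θ D P Q) (t : ℕ)
    (ht : t ≤ T) : (P t).PosDef := by
  rcases Nat.eq_zero_or_pos t with rfl | h1
  · rw [h.init]; exact hP0
  rcases ht.lt_or_eq with h2 | rfl
  -- The upper left block of the matrix inequality gives `P_t ⪰ Π_t ≻ 0`.
  · have hb := (h.lmi t h1 h2).submatrix Sum.inl
    have e : (Matrix.fromBlocks (P t - Q t) (P t * (S.A t)ᵀ)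
      (S.A t * P t) (S.W t + S.A t * P t * (S.A t)ᵀ)).submatrix Sum.inl Sum.inl = P t - Q t := by
      ext i j; simp
    rw [e] at hb
    have := (h.pos t h1 h2.le).add_posSemidef hb
    simpa using this
  · rw [h.final]; exact h.pos t h1 le_rfl

lemma MaxDetFeasible.snr_posSemidef (hP0 : S.P0.PosDef) (hW : ∀ t, t < T → (S.W t).PosDef)
    (h : MaxDetFeasible S T Θ D P Q) (t : ℕ) (ht : t < T) : (snrOf S P t).PosSemidef :=
  posSemidef_inv_sub_inv (h.posDef hP0 _ ht)
    (predCov_posDef (h.posDef hP0 t ht.le).posSemidef (hW t ht)) (h.step t ht)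

/-- By `log_det_smoothCov`, each `log det Π_t` with `1 ≤ t < T` splits into the terms of `P_t`, of
`W_t` and of the next prediction. The terms of `W_t` cancel against the constant `c`, whose first
summand supplies the missing prediction at time one. -/
lemma rateOf_eq (hT : 1 ≤ T) (hW : ∀ t, t < T → (S.W t).PosDef) (h0 : P 0 = S.P0)
    (hP : ∀ t, t ≤ T → (P t).PosDef) : maxDetObj S T (maxPi S T P) = rateOf S T P := by
  obtain ⟨N, rfl⟩ : ∃ N, T = N + 1 := ⟨T - 1, by omega⟩
  unfold maxDetObj maxDetConst rateOf
  simp only [mul_sub, Finset.sum_sub_distrib]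
  rw [← Finset.Ico_add_one_right_eq_Icc, Finset.sum_Ico_succ_top (by omega),
    Finset.sum_Ico_eq_sum_range, Finset.sum_Ico_eq_sum_range, Finset.sum_range_succ',
    Finset.sum_range_succ (n := N), Nat.add_sub_cancel]
  have h1 : ∀ k ∈ Finset.range N, (1 / 2) * Real.log (maxPi S (N + 1) P (1 + k)).det =
      (1 / 2) * Real.log (P (k + 1)).det + (1 / 2) * Real.log (S.W (1 + k)).det
        - (1 / 2) * Real.log (predAt S P (k + 1)).det := by
    intro k hk
    rw [Finset.mem_range] at hk
    rw [maxPi, if_pos (by omega), log_det_smoothCov (hP _ (by omega)) (hW _ (by omega)),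
      add_comm 1 k, predAt]
    ring
  have h2 : maxPi S (N + 1) P (N + 1) = P (N + 1) := by rw [maxPi, if_neg (by omega)]
  have h3 : S.A 0 * S.P0 * (S.A 0)ᵀ + S.W 0 = predAt S P 0 := by rw [predAt, predCov, h0]
  rw [Finset.sum_congr rfl h1, h2, h3, Finset.sum_sub_distrib, Finset.sum_add_distrib]
  ring

lemma MaxDetFeasible.rateOf_le (hT : 1 ≤ T) (hP0 : S.P0.PosDef)
    (hW : ∀ t, t < T → (S.W t).PosDef) (h : MaxDetFeasible S T Θ D P Q) :
    rateOf S T P ≤ maxDetObj S T Q := by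
  rw [← rateOf_eq hT hW h.init (fun t ht => h.posDef hP0 t ht)]
  unfold maxDetObj
  gcongr with t ht
  · rw [Finset.mem_Icc] at ht
    exact (h.pos t ht.1 ht.2).det_pos
  · rw [Finset.mem_Icc] at ht
    refine det_le_det_of_sub_posSemidef (h.pos t ht.1 ht.2) ?_
    unfold maxPi
    split_ifs with h1
    · exact (lmi_iff (h.posDef hP0 t ht.2).posSemidef (hW t h1)).1 (h.lmi t ht.1 h1)
    · obtain rfl : t = T := by omega
      rw [h.final, sub_self]
      exact PosSemidef.zero

lemma maxDetFeasible_maxPi (hW : ∀ t, t < T → (S.W t).PosDef) (h0 : P 0 = S.P0)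
    (hP : ∀ t, t ≤ T → (P t).PosDef)
    (hstep : ∀ t, t < T → (predAt S P t - P (t + 1)).PosSemidef)
    (htr : ∀ t, 1 ≤ t → t ≤ T → (Θ t * P t).trace ≤ D t) :
    MaxDetFeasible S T Θ D P (maxPi S T P) where
  init := h0
  pos t _ h2 := by
    unfold maxPi
    split_ifs with h
    · exact smoothCov_posDef (hP t h2) (hW t h)
    · exact hP t h2
  step := hstep
  lmi t _ h2 := by
    rw [maxPi, if_pos h2]
    refine (lmi_iff (hP t h2.le).posSemidef (hW t h2)).2 ?_
    rw [sub_self]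
    exact PosSemidef.zero
  trace_le := htr
  final := by simp [maxPi]

/-- The form in which optimality is used: a competitor is only a sequence of positive definite
covariances obeying the order and trace constraints, its `Π` being supplied by `maxPi`. -/
lemma MaxDetOptimal.le_rateOf {P' : (t : ℕ) → Matrix (Fin (S.n t)) (Fin (S.n t)) ℝ}
    (hT : 1 ≤ T) (hW : ∀ t, t < T → (S.W t).PosDef) (h : MaxDetOptimal S T Θ D P Q)
    (h0 : P' 0 = S.P0) (hP : ∀ t, t ≤ T → (P' t).PosDef)
    (hstep : ∀ t, t < T → (predAt S P' t - P' (t + 1)).PosSemidef)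
    (htr : ∀ t, 1 ≤ t → t ≤ T → (Θ t * P' t).trace ≤ D t) :
    maxDetObj S T Q ≤ rateOf S T P' := by
  rw [← rateOf_eq hT hW h0 hP]
  exact h.2 _ _ (maxDetFeasible_maxPi hW h0 hP hstep htr)

/-! ### Reduced singular value decompositions -/

lemma mul_diagonal_mul_transpose_apply {κ ι : Type*} [Fintype ι] [DecidableEq ι]
    (U : Matrix κ ι ℝ) (σ : ι → ℝ) (i j : κ) :
    (U * Matrix.diagonal σ * Uᵀ) i j = ∑ x, U i x * σ x * U j x := by
  rw [mul_apply]
  simp only [mul_diagonal, transpose_apply]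

/-- The spectral decomposition with only the eigenvectors of positive eigenvalues kept; the dropped
eigenvalues are zero and contribute nothing to the product. -/
lemma exists_isReducedSVD {k : ℕ} {M : Matrix (Fin k) (Fin k) ℝ} (hM : M.PosSemidef) :
    ∃ (r : ℕ) (U : Matrix (Fin k) (Fin r) ℝ) (σ : Fin r → ℝ), IsReducedSVD M U σ := by
  classical
  set ev := hM.1.eigenvalues with hev
  let e : Fin (Fintype.card {i // 0 < ev i}) ≃ {i // 0 < ev i} := (Fintype.equivFin _).symm
  let B : Matrix (Fin k) (Fin k) ℝ := (hM.1.eigenvectorUnitary : Matrix (Fin k) (Fin k) ℝ)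
  have hB : Bᵀ * B = 1 := by
    have := (Matrix.mem_unitaryGroup_iff').1 hM.1.eigenvectorUnitary.2
    simpa [star_eq_conjTranspose] using this
  refine ⟨_, B.submatrix id (fun j => (e j : Fin k)), fun j => ev (e j), ?_, fun i => (e i).2, ?_⟩
  · ext i j
    have := congrFun (congrFun hB (e i)) (e j)
    simp only [mul_apply, transpose_apply, one_apply, submatrix_apply, id] at this ⊢
    rw [this]
    simp [Subtype.coe_injective.eq_iff]
  · have hs : M = B * Matrix.diagonal ev * Bᵀ := by
      have := hM.1.spectral_theorem
      rw [Unitary.conjStarAlgAut_apply] at this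
      simpa [star_eq_conjTranspose, B] using this
    ext i j
    have h1 := congrFun (congrFun hs i) j
    rw [mul_diagonal_mul_transpose_apply] at h1 ⊢
    rw [h1]
    have h0 : ∀ x, x ∉ Finset.univ.filter (fun x => 0 < ev x) → ev x = 0 := by
      intro x hx
      simp only [Finset.mem_filter, Finset.mem_univ, true_and, not_lt] at hx
      exact le_antisymm hx (hM.eigenvalues_nonneg x)
    rw [← Finset.sum_subset (Finset.subset_univ (Finset.univ.filter (fun x => 0 < ev x)))
      (fun x _ hx => by rw [h0 x hx]; ring)]
    exact (Finset.sum_subtype (p := fun x => 0 < ev x) _ (by simp) _).trans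
      (Equiv.sum_comp e (fun x : {i // 0 < ev i} => B i x * ev x * B j x)).symm

lemma IsReducedSVD.snr_eq {k r : ℕ} {M : Matrix (Fin k) (Fin k) ℝ} {U : Matrix (Fin k) (Fin r) ℝ}
    {σ : Fin r → ℝ} (h : IsReducedSVD M U σ) :
    (Uᵀ)ᵀ * (Matrix.diagonal (fun i => (σ i)⁻¹))⁻¹ * Uᵀ = M := by
  have : (Matrix.diagonal (fun i => (σ i)⁻¹))⁻¹ = Matrix.diagonal σ := by
    refine inv_eq_left_inv ?_
    rw [diagonal_mul_diagonal, ← diagonal_one]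
    congr 1
    ext i
    exact mul_inv_cancel₀ (h.pos i).ne'
  rw [this, transpose_transpose, ← h.eq]

/-! ### Existence of an optimal solution of the determinant maximization problem -/

section Existence

lemma isClosed_posSemidef {ι : Type*} [Fintype ι] :
    IsClosed {M : Matrix ι ι ℝ | M.PosSemidef} := by
  have : {M : Matrix ι ι ℝ | M.PosSemidef} =
      {M : Matrix ι ι ℝ | Mᵀ = M} ∩ ⋂ x : ι → ℝ, {M | 0 ≤ x ⬝ᵥ (M *ᵥ x)} := by
    ext M
    simp only [Set.mem_ofPred_eq, Set.mem_inter_iff, Set.mem_iInter,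
      posSemidef_iff_dotProduct_mulVec]
    simp [IsHermitian]
  rw [this]
  refine (isClosed_eq (by fun_prop) (by fun_prop)).inter (isClosed_iInter fun x => ?_)
  exact isClosed_le (by fun_prop) (by fun_prop)

/-- With `M = Bᵀ B`, an entry is at most the mean of the two corresponding diagonal entries, each
bounded by the trace. -/
lemma PosSemidef.abs_apply_le_trace {ι : Type*} [Fintype ι] [DecidableEq ι] {M : Matrix ι ι ℝ}
    (hM : M.PosSemidef) (i j : ι) : |M i j| ≤ M.trace := by
  obtain ⟨B, rfl⟩ := PosSemidef.exists_eq_transpose_mul_self hM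
  have hd : ∀ i, (Bᵀ * B) i i = ∑ x, B x i * B x i := fun i => by simp [mul_apply]
  have hle : ∀ i, ∑ x, B x i * B x i ≤ (Bᵀ * B).trace := by
    intro i
    rw [← hd]
    exact Finset.single_le_sum (f := fun i => (Bᵀ * B) i i) (fun i _ => hM.diag_nonneg)
      (Finset.mem_univ i)
  have h : |(Bᵀ * B) i j| ≤ (∑ x, B x i * B x i + ∑ x, B x j * B x j) / 2 := by
    rw [mul_apply, ← Finset.sum_add_distrib, Finset.sum_div]
    refine (Finset.abs_sum_le_sum_abs _ _).trans (Finset.sum_le_sum fun x _ => ?_)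
    rw [transpose_apply, abs_le]
    constructor <;> nlinarith [sq_nonneg (B x i - B x j), sq_nonneg (B x i + B x j)]
  linarith [hle i, hle j]

variable {S : Source} {T : ℕ} {Θ : (t : ℕ) → Matrix (Fin (S.n t)) (Fin (S.n t)) ℝ} {D : ℕ → ℝ}

/-- The variables of the determinant maximization problem. -/
abbrev MaxDetVars (S : Source) : Type :=
  (t : ℕ) → Matrix (Fin (S.n t)) (Fin (S.n t)) ℝ × Matrix (Fin (S.n t)) (Fin (S.n t)) ℝ

/-- The closure of the feasible set, with the variables outside the horizon set to zero. -/
def closedFeasible (S : Source) (T : ℕ)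
    (Θ : (t : ℕ) → Matrix (Fin (S.n t)) (Fin (S.n t)) ℝ) (D : ℕ → ℝ) : Set (MaxDetVars S) :=
  {x | (x 0).1 = S.P0} ∩ {x | (x 0).2 = 0} ∩ {x | ∀ t, T < t → x t = 0} ∩
  {x | ∀ t, 1 ≤ t → t ≤ T → (x t).2.PosSemidef} ∩
  {x | ∀ t, t < T → (predAt S (fun t => (x t).1) t - (x (t + 1)).1).PosSemidef} ∩
  {x | ∀ t, 1 ≤ t → t < T → (Matrix.fromBlocks ((x t).1 - (x t).2) ((x t).1 * (S.A t)ᵀ)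
      (S.A t * (x t).1) (S.W t + S.A t * (x t).1 * (S.A t)ᵀ)).PosSemidef} ∩
  {x | ∀ t, 1 ≤ t → t ≤ T → (Θ t * (x t).1).trace ≤ D t} ∩ {x | (x T).1 = (x T).2}

/-- The covariances of the uncontrolled source. -/
def priorCov (S : Source) : (t : ℕ) → Matrix (Fin (S.n t)) (Fin (S.n t)) ℝ
  | 0 => S.P0
  | t + 1 => predCov (S.A t) (S.W t) (priorCov S t)

lemma isClosed_closedFeasible : IsClosed (closedFeasible S T Θ D) := by
  unfold closedFeasible predAt predCov
  simp only [Set.ofPred_forall]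
  have cont : ∀ t, Continuous fun x : MaxDetVars S => x t := fun t => continuous_apply t
  refine IsClosed.inter (IsClosed.inter (IsClosed.inter (IsClosed.inter (IsClosed.inter
    (IsClosed.inter (IsClosed.inter ?_ ?_) ?_) ?_) ?_) ?_) ?_) ?_
  · exact isClosed_eq (by fun_prop) continuous_const
  · exact isClosed_eq (by fun_prop) continuous_const
  · exact isClosed_iInter fun t => isClosed_iInter fun _ =>
      isClosed_eq (by fun_prop) continuous_const
  · exact isClosed_iInter fun t => isClosed_iInter fun _ => isClosed_iInter fun _ =>
      isClosed_posSemidef.preimage (by fun_prop : Continuous fun x : MaxDetVars S => (x t).2)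
  · exact isClosed_iInter fun t => isClosed_iInter fun _ =>
      isClosed_posSemidef.preimage (by fun_prop : Continuous fun x : MaxDetVars S =>
        S.A t * (x t).1 * (S.A t)ᵀ + S.W t - (x (t + 1)).1)
  · refine isClosed_iInter fun t => isClosed_iInter fun _ => isClosed_iInter fun _ =>
      isClosed_posSemidef.preimage (f := fun x : MaxDetVars S =>
        Matrix.fromBlocks ((x t).1 - (x t).2) ((x t).1 * (S.A t)ᵀ)
      (S.A t * (x t).1) (S.W t + S.A t * (x t).1 * (S.A t)ᵀ)) ?_
    exact Continuous.matrix_fromBlocks (by fun_prop) (by fun_prop) (by fun_prop) (by fun_prop)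
  · exact isClosed_iInter fun t => isClosed_iInter fun _ => isClosed_iInter fun _ =>
      isClosed_le (by fun_prop) continuous_const
  · exact isClosed_eq (by fun_prop) (by fun_prop)

lemma closedFeasible_sub_posSemidef {x : MaxDetVars S} (hx : x ∈ closedFeasible S T Θ D) (t : ℕ)
    (h1 : 1 ≤ t) (h2 : t ≤ T) : ((x t).1 - (x t).2).PosSemidef := by
  obtain ⟨⟨⟨-, hl⟩, -⟩, hf⟩ := hx
  rcases h2.lt_or_eq with h2 | rfl
  · have hb := (hl t h1 h2).submatrix Sum.inl
    convert hb using 1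
    ext i j; simp
  · rw [hf, sub_self]
    exact PosSemidef.zero

/-- Prediction is monotone in the covariance, so the constraints `P_{t+1} ⪯ A_t P_t A_tᵀ + W_t` keep
every `P_t` below the unconditional covariance. This bounds the feasible set. -/
lemma priorCov_sub_posSemidef {x : MaxDetVars S} (hx : x ∈ closedFeasible S T Θ D) (t : ℕ)
    (h2 : t ≤ T) : (priorCov S t - (x t).1).PosSemidef := by
  induction t with
  | zero =>
    obtain ⟨⟨⟨⟨⟨⟨⟨h0, -⟩, -⟩, -⟩, -⟩, -⟩, -⟩, -⟩ := hx
    rw [h0, priorCov, sub_self]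
    exact PosSemidef.zero
  | succ t ih =>
    have hs : (predAt S (fun t => (x t).1) t - (x (t + 1)).1).PosSemidef := hx.1.1.1.2 t h2
    have h3 : (S.A t * (priorCov S t - (x t).1) * (S.A t)ᵀ).PosSemidef := by
      simpa using (ih (by omega)).mul_mul_conjTranspose_same (S.A t)
    convert h3.add hs using 1
    simp only [priorCov, predAt, predCov, Matrix.mul_sub, Matrix.sub_mul]
    abel

lemma closedFeasible_posSemidef (hP0 : S.P0.PosSemidef) {x : MaxDetVars S}
    (hx : x ∈ closedFeasible S T Θ D) (t : ℕ) : (x t).1.PosSemidef ∧ (x t).2.PosSemidef := by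
  have h := hx
  obtain ⟨⟨⟨⟨⟨⟨⟨h0, h0'⟩, hz⟩, hq⟩, -⟩, -⟩, -⟩, -⟩ := h
  rcases Nat.eq_zero_or_pos t with rfl | h1
  · rw [h0, h0']
    exact ⟨hP0, PosSemidef.zero⟩
  rcases le_or_gt t T with h2 | h2
  · have h3 := (closedFeasible_sub_posSemidef hx t h1 h2).add (hq t h1 h2)
    rw [sub_add_cancel] at h3
    exact ⟨h3, hq t h1 h2⟩
  · rw [hz t h2]
    exact ⟨PosSemidef.zero, PosSemidef.zero⟩

/-- From `0 ⪯ Π_t ⪯ P_t ⪯ priorCov S t` within the horizon, all entries lie in a box given by the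
prior trace. The set sits in an infinite product of such boxes because the variables beyond the
horizon vanish. -/
lemma isCompact_closedFeasible (hP0 : S.P0.PosSemidef) :
    IsCompact (closedFeasible S T Θ D) := by
  let b : ℕ → ℝ := fun t => |(priorCov S t).trace|
  let K (t : ℕ) : Set (Matrix (Fin (S.n t)) (Fin (S.n t)) ℝ) :=
    Set.univ.pi fun _ => Set.univ.pi fun _ => Set.Icc (-b t) (b t)
  have hK : ∀ t, IsCompact (K t) := fun t =>
    isCompact_univ_pi fun _ => isCompact_univ_pi fun _ => isCompact_Icc
  refine IsCompact.of_isClosed_subset (isCompact_univ_pi fun t => (hK t).prod (hK t))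
    isClosed_closedFeasible fun x hx t _ => ?_
  obtain ⟨hP, hQ⟩ := closedFeasible_posSemidef hP0 hx t
  have hsub : ((x t).1 - (x t).2).PosSemidef := by
    rcases Nat.eq_zero_or_pos t with rfl | h1
    · rw [hx.1.1.1.1.1.1.2, sub_zero]
      exact hP
    rcases le_or_gt t T with h2 | h2
    · exact closedFeasible_sub_posSemidef hx t h1 h2
    · rw [hx.1.1.1.1.1.2 t h2, Prod.fst_zero, Prod.snd_zero, sub_zero]
      exact PosSemidef.zero
  have hPb : (x t).1.trace ≤ b t := by
    rcases le_or_gt t T with h2 | h2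
    · have := (priorCov_sub_posSemidef hx t h2).trace_nonneg
      rw [trace_sub] at this
      exact (by linarith : (x t).1.trace ≤ (priorCov S t).trace).trans (le_abs_self _)
    · rw [hx.1.1.1.1.1.2 t h2, Prod.fst_zero, trace_zero]
      exact abs_nonneg _
  have hQb : (x t).2.trace ≤ b t := by
    have := hsub.trace_nonneg
    rw [trace_sub] at this
    linarith
  exact ⟨fun i _ j _ => abs_le.1 ((PosSemidef.abs_apply_le_trace hP i j).trans hPb),
    fun i _ j _ => abs_le.1 ((PosSemidef.abs_apply_le_trace hQ i j).trans hQb)⟩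

/-- Sets the variables outside the horizon to zero. -/
def truncVars (S : Source) (T : ℕ) (P Q : (t : ℕ) → Matrix (Fin (S.n t)) (Fin (S.n t)) ℝ) :
    MaxDetVars S :=
  fun t => (if t ≤ T then P t else 0, if 1 ≤ t ∧ t ≤ T then Q t else 0)

lemma MaxDetFeasible.truncVars_mem (hT : 1 ≤ T)
    {P Q : (t : ℕ) → Matrix (Fin (S.n t)) (Fin (S.n t)) ℝ}
    (h : MaxDetFeasible S T Θ D P Q) : truncVars S T P Q ∈ closedFeasible S T Θ D := by
  have eP : ∀ t, t ≤ T → (truncVars S T P Q t).1 = P t := fun t ht => if_pos ht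
  have eQ : ∀ t, 1 ≤ t → t ≤ T → (truncVars S T P Q t).2 = Q t := fun t h1 ht => if_pos ⟨h1, ht⟩
  refine ⟨⟨⟨⟨⟨⟨⟨?_, ?_⟩, ?_⟩, ?_⟩, ?_⟩, ?_⟩, ?_⟩, ?_⟩
  · exact (eP 0 (by omega)).trans h.init
  · simp [truncVars]
  · intro t ht
    simp [truncVars, ht]
  · intro t h1 h2
    rw [eQ t h1 h2]
    exact (h.pos t h1 h2).posSemidef
  · intro t ht
    rw [predAt, eP t ht.le, eP (t + 1) ht]
    exact h.step t ht
  · intro t h1 h2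
    rw [eP t h2.le, eQ t h1 h2.le]
    exact h.lmi t h1 h2
  · intro t h1 h2
    rw [eP t h2]
    exact h.trace_le t h1 h2
  · change (truncVars S T P Q T).1 = (truncVars S T P Q T).2
    rw [eP T le_rfl, eQ T hT le_rfl, h.final]

/-- A strictly feasible sequence of covariances. -/
def smallCov (S : Source) (Θ : (t : ℕ) → Matrix (Fin (S.n t)) (Fin (S.n t)) ℝ) (D : ℕ → ℝ) :
    (t : ℕ) → Matrix (Fin (S.n t)) (Fin (S.n t)) ℝ
  | 0 => S.P0
  | t + 1 => min 1 (D (t + 1) / (1 + |(Θ (t + 1) * S.W t).trace|)) • S.W t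

/-- With `P_{t+1} = ε W_t`, the bound `ε ≤ 1` gives the order constraint, and `ε ≤ D_{t+1} / (1 +
|tr (Θ_{t+1} W_t)|)` gives the trace constraint. -/
lemma smallCov_feasible (hP0 : S.P0.PosDef) (hW : ∀ t, t < T → (S.W t).PosDef)
    (hD : ∀ t, 1 ≤ t → t ≤ T → 0 < D t) :
    MaxDetFeasible S T Θ D (smallCov S Θ D) (maxPi S T (smallCov S Θ D)) := by
  have hε : ∀ t, t < T → 0 < min 1 (D (t + 1) / (1 + |(Θ (t + 1) * S.W t).trace|)) := by
    intro t ht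
    have := hD (t + 1) (by omega) ht
    positivity
  have hpos : ∀ t, t ≤ T → (smallCov S Θ D t).PosDef := by
    intro t ht
    cases t with
    | zero => exact hP0
    | succ t => exact (hW t ht).smul (hε t ht)
  refine maxDetFeasible_maxPi hW rfl hpos (fun t ht => ?_) (fun t h1 h2 => ?_)
  · set ε := min 1 (D (t + 1) / (1 + |(Θ (t + 1) * S.W t).trace|)) with hεd
    have h1 : (S.A t * smallCov S Θ D t * (S.A t)ᵀ).PosSemidef := by
      simpa using (hpos t ht.le).posSemidef.mul_mul_conjTranspose_same (S.A t)
    have h2 : ((1 - ε) • S.W t).PosSemidef :=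
      (hW t ht).posSemidef.smul (sub_nonneg.2 (min_le_left _ _))
    convert h1.add h2 using 1
    rw [sub_smul, one_smul, predAt, predCov, add_sub_assoc]
    rfl
  · obtain ⟨t, rfl⟩ : ∃ u, t = u + 1 := ⟨t - 1, by omega⟩
    set ε := min 1 (D (t + 1) / (1 + |(Θ (t + 1) * S.W t).trace|)) with hεd
    have e : Θ (t + 1) * smallCov S Θ D (t + 1) = ε • (Θ (t + 1) * S.W t) := by
      rw [← Matrix.mul_smul]
      rfl
    rw [e, trace_smul, smul_eq_mul]
    have h3 : ε ≤ D (t + 1) / (1 + |(Θ (t + 1) * S.W t).trace|) := min_le_right _ _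
    rw [le_div_iff₀ (by positivity)] at h3
    nlinarith [le_abs_self (Θ (t + 1) * S.W t).trace, hε t h2]

/-- The product of the determinants of the `Π_t` is continuous on the compact closure, where `-log
det` need not be. Its maximum is positive because a strictly feasible point exists, so every `Π_t`
is nonsingular there and the maximizer is feasible for the original problem. -/
theorem exists_maxDetOptimal (hT : 1 ≤ T) (hP0 : S.P0.PosDef)
    (hW : ∀ t, t < T → (S.W t).PosDef) (hD : ∀ t, 1 ≤ t → t ≤ T → 0 < D t) :
    ∃ P Q, MaxDetOptimal S T Θ D P Q := by
  have hf := smallCov_feasible (Θ := Θ) hP0 hW hD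
  let J : MaxDetVars S → ℝ := fun x => ∏ t ∈ Finset.Icc 1 T, (x t).2.det
  have hJ : Continuous J := by
    refine continuous_finsetProd _ fun t _ => Continuous.matrix_det ?_
    fun_prop
  have hJtr : ∀ P Q, J (truncVars S T P Q) = ∏ t ∈ Finset.Icc 1 T, (Q t).det := fun P Q =>
    Finset.prod_congr rfl fun t ht => by
      rw [truncVars, if_pos (Finset.mem_Icc.1 ht)]
  have hJpos : ∀ P Q, MaxDetFeasible S T Θ D P Q → 0 < J (truncVars S T P Q) := by
    intro P Q h
    rw [hJtr]
    exact Finset.prod_pos fun t ht =>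
      (h.pos t (Finset.mem_Icc.1 ht).1 (Finset.mem_Icc.1 ht).2).det_pos
  obtain ⟨x, hx, hmax⟩ := (isCompact_closedFeasible (Θ := Θ) (D := D) (T := T)
    hP0.posSemidef).exists_isMaxOn ⟨_, hf.truncVars_mem hT⟩ hJ.continuousOn
  have hxpos : 0 < J x := (hJpos _ _ hf).trans_le (hmax (hf.truncVars_mem hT))
  have hdet : ∀ t ∈ Finset.Icc 1 T, (x t).2.det ≠ 0 := Finset.prod_ne_zero_iff.1 hxpos.ne'
  have hxf : MaxDetFeasible S T Θ D (fun t => (x t).1) (fun t => (x t).2) := by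
    have h := hx
    obtain ⟨⟨⟨⟨⟨⟨⟨h0, -⟩, -⟩, hq⟩, hs⟩, hl⟩, ht⟩, hfin⟩ := h
    exact ⟨h0, fun t h1 h2 => ((hq t h1 h2).posDef_iff_det_ne_zero).2
      (hdet t (Finset.mem_Icc.2 ⟨h1, h2⟩)), hs, hl, ht, hfin⟩
  refine ⟨_, _, hxf, fun P' Q' h' => ?_⟩
  have hlog : ∀ P Q, MaxDetFeasible S T Θ D P Q →
      maxDetObj S T Q = -((1 / 2) * Real.log (∏ t ∈ Finset.Icc 1 T, (Q t).det)) +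
        maxDetConst S T := by
    intro P Q h
    rw [maxDetObj, Real.log_prod, Finset.mul_sum]
    exact fun t ht => (h.pos t (Finset.mem_Icc.1 ht).1 (Finset.mem_Icc.1 ht).2).det_pos.ne'
  rw [hlog _ _ hxf, hlog _ _ h']
  have h1 : J (truncVars S T P' Q') ≤ J x := hmax (h'.truncVars_mem hT)
  have h2 := hJpos _ _ h'
  rw [hJtr] at h1 h2
  have := Real.log_le_log h2 h1
  change _ ≤ Real.log (∏ t ∈ Finset.Icc 1 T, (x t).2.det) at this
  linarith

end Existence

/-! ### Linear maps on Euclidean vectors -/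

section MulVec

variable {a b c k : ℕ}

/-- `mulVecE` as a continuous linear map. -/
def mulVecL (M : Matrix (Fin b) (Fin a) ℝ) : Vec a →L[ℝ] Vec b :=
  LinearMap.toContinuousLinearMap (Matrix.toEuclideanLin M)

lemma continuous_mulVecE (M : Matrix (Fin b) (Fin a) ℝ) : Continuous (mulVecE M) :=
  (mulVecL M).continuous

@[fun_prop]
lemma measurable_mulVecE (M : Matrix (Fin b) (Fin a) ℝ) : Measurable (mulVecE M) :=
  (continuous_mulVecE M).measurable

lemma mulVecE_sub (M : Matrix (Fin b) (Fin a) ℝ) (v w : Vec a) :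
    mulVecE M (v - w) = mulVecE M v - mulVecE M w := (mulVecL M).map_sub v w

lemma mulVecE_mulVecE (M : Matrix (Fin c) (Fin b) ℝ) (N : Matrix (Fin b) (Fin a) ℝ) (v : Vec a) :
    mulVecE M (mulVecE N v) = mulVecE (M * N) v := by
  simp [mulVecE]

lemma mulVecE_apply (M : Matrix (Fin b) (Fin a) ℝ) (v : Vec a) (i : Fin b) :
    mulVecE M v i = ∑ j, M i j * v j := rfl

lemma sub_mulVecE (M N : Matrix (Fin b) (Fin a) ℝ) (v : Vec a) :
    mulVecE (M - N) v = mulVecE M v - mulVecE N v := by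
  simp [mulVecE, sub_mulVec]

lemma neg_mulVecE (M : Matrix (Fin b) (Fin a) ℝ) (v : Vec a) :
    mulVecE (-M) v = -mulVecE M v := by
  simp [mulVecE, neg_mulVec]

lemma one_mulVecE (v : Vec a) : mulVecE (1 : Matrix (Fin a) (Fin a) ℝ) v = v := by
  simp [mulVecE]

lemma wnormSq_eq_sum (Θ : Matrix (Fin k) (Fin k) ℝ) (v : Vec k) :
    wnormSq Θ v = ∑ i, ∑ j, Θ i j * (v j * v i) := by
  simp only [wnormSq, dotProduct, mulVec, Finset.mul_sum]
  exact Finset.sum_congr rfl fun i _ => Finset.sum_congr rfl fun j _ => by ring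

lemma continuous_wnormSq (Θ : Matrix (Fin k) (Fin k) ℝ) : Continuous (wnormSq Θ) := by
  have : wnormSq Θ = fun v => ∑ i, ∑ j, Θ i j * (v j * v i) := funext (wnormSq_eq_sum Θ)
  rw [this]
  fun_prop

@[fun_prop]
lemma measurable_wnormSq (Θ : Matrix (Fin k) (Fin k) ℝ) : Measurable (wnormSq Θ) :=
  (continuous_wnormSq Θ).measurable

end MulVec

/-! ### Second moments -/

section SecondMoment

variable {Ω : Type*} [MeasurableSpace Ω] {μ : Measure Ω} {k l : ℕ}

/-- The matrix of second moments of a random vector. -/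
def secondMoment (μ : Measure Ω) (e : Ω → Vec k) : Matrix (Fin k) (Fin k) ℝ :=
  Matrix.of fun i j => ∫ ω, e ω i * e ω j ∂μ

lemma memLp_coord {e : Ω → Vec k} (he : MemLp e 2 μ) (i : Fin k) : MemLp (fun ω => e ω i) 2 μ :=
  (EuclideanSpace.proj (𝕜 := ℝ) i : Vec k →L[ℝ] ℝ).comp_memLp' he

lemma integrable_coord_mul {e : Ω → Vec k} {f : Ω → Vec l} (he : MemLp e 2 μ) (hf : MemLp f 2 μ)
    (i : Fin k) (j : Fin l) : Integrable (fun ω => e ω i * f ω j) μ :=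
  (memLp_coord he i).integrable_mul (memLp_coord hf j)

lemma integrable_wnormSq {e : Ω → Vec k} (he : MemLp e 2 μ) (Θ : Matrix (Fin k) (Fin k) ℝ) :
    Integrable (fun ω => wnormSq Θ (e ω)) μ := by
  simp only [wnormSq_eq_sum]
  exact integrable_finsetSum _ fun i _ => integrable_finsetSum _ fun j _ =>
    (integrable_coord_mul he he j i).const_mul _

lemma integral_wnormSq {e : Ω → Vec k} (he : MemLp e 2 μ) (Θ : Matrix (Fin k) (Fin k) ℝ) :
    ∫ ω, wnormSq Θ (e ω) ∂μ = (Θ * secondMoment μ e).trace := by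
  simp only [wnormSq_eq_sum]
  have hi : ∀ i j, Integrable (fun ω => Θ i j * (e ω j * e ω i)) μ := fun i j =>
    (integrable_coord_mul he he j i).const_mul _
  refine (integral_finsetSum _ fun i _ => integrable_finsetSum _ fun j _ => hi i j).trans ?_
  refine Finset.sum_congr rfl fun i _ => ?_
  refine (integral_finsetSum _ fun j _ => hi i j).trans ?_
  rw [diag_apply, mul_apply]
  refine Finset.sum_congr rfl fun j _ => ?_
  rw [integral_const_mul]
  rfl

lemma secondMoment_transpose (e : Ω → Vec k) : (secondMoment μ e)ᵀ = secondMoment μ e := by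
  ext i j
  simp [secondMoment, mul_comm]

lemma dotProduct_secondMoment {e : Ω → Vec k} (he : MemLp e 2 μ) (u : Fin k → ℝ) :
    u ⬝ᵥ (secondMoment μ e *ᵥ u) = ∫ ω, (u ⬝ᵥ (e ω).ofLp) ^ 2 ∂μ := by
  have h := integral_wnormSq he (vecMulVec u u)
  have h1 : ∀ v : Vec k, wnormSq (vecMulVec u u) v = (u ⬝ᵥ v.ofLp) ^ 2 := by
    intro v
    rw [wnormSq, vecMulVec_mulVec, dotProduct_smul, dotProduct_comm v.ofLp u]
    simp [sq]
  simp only [h1] at h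
  rw [h, vecMulVec_mul, trace_vecMulVec, ← mulVec_transpose, secondMoment_transpose]

lemma secondMoment_posSemidef {e : Ω → Vec k} (he : MemLp e 2 μ) :
    (secondMoment μ e).PosSemidef := by
  refine PosSemidef.of_dotProduct_mulVec_nonneg ?_ fun u => ?_
  · simpa [IsHermitian] using secondMoment_transpose (μ := μ) e
  · simp only [star_trivial]
    rw [dotProduct_secondMoment he]
    positivity

end SecondMoment

/-! ### Gaussian densities -/

section Gaussian

-- Both measures have the same characteristic function, by the Fourier transform of the Gaussian.
open Real Complex in
lemma stdGaussian_eq_withDensity (k : ℕ) : stdGaussian (Vec k) = volume.withDensity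
    (fun x => ENNReal.ofReal (rexp (-(1 / 2) * ‖x‖ ^ 2 - k / 2 * Real.log (2 * π)))) := by
  have hcont : Continuous fun x : Vec k =>
      rexp (-(1 / 2) * ‖x‖ ^ 2 - k / 2 * Real.log (2 * π)) := by fun_prop
  have hb : 0 < ((1 / 2 : ℂ)).re := by norm_num
  have hint := GaussianFourier.integrable_cexp_neg_mul_sq_norm_add (V := Vec k) hb 0 0
  have hint2 : Integrable fun x : Vec k =>
      rexp (-(1 / 2) * ‖x‖ ^ 2 - k / 2 * Real.log (2 * π)) := by
    have := hint.norm.mul_const (rexp (-(k / 2 * Real.log (2 * π))))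
    refine this.congr (ae_of_all _ fun x => ?_)
    beta_reduce
    rw [Complex.norm_exp, ← Real.exp_add]
    congr 1
    simp [← Complex.ofReal_pow]
    ring
  have := isFiniteMeasure_withDensity_ofReal hint2.2
  refine Measure.ext_of_charFun ?_
  ext t
  rw [charFun_stdGaussian, charFun_apply, integral_withDensity_eq_integral_toReal_smul
    (by fun_prop) (by simp)]
  have h := GaussianFourier.integral_cexp_neg_mul_sq_norm_add (V := Vec k) hb Complex.I t
  have hc : ∀ x : Vec k, (ENNReal.ofReal (rexp (-(1 / 2) * ‖x‖ ^ 2 - k / 2 * Real.log (2 * π)))).toReal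
      • cexp (inner ℝ x t * Complex.I) = cexp (-(k / 2 * Real.log (2 * π) : ℝ)) *
        cexp (-(1 / 2) * (‖x‖ : ℂ) ^ 2 + Complex.I * (inner ℝ t x : ℝ)) := by
    intro x
    rw [ENNReal.toReal_ofReal (Real.exp_nonneg _), Complex.real_smul, Complex.ofReal_exp,
      ← Complex.exp_add, ← Complex.exp_add, real_inner_comm]
    congr 1
    push_cast
    ring
  simp_rw [hc]
  rw [integral_const_mul, h]
  have h2 : ((π : ℂ) / (1 / 2)) ^ ((Module.finrank ℝ (Vec k) : ℂ) / 2) =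
      cexp ((k / 2 * Real.log (2 * π) : ℝ)) := by
    have h3 : (π : ℂ) / (1 / 2) = ((2 * π : ℝ) : ℂ) := by push_cast; ring
    rw [h3, finrank_euclideanSpace_fin, Complex.cpow_def_of_ne_zero, ← Complex.ofReal_log]
    · congr 1
      push_cast
      ring
    · positivity
    · norm_cast
      positivity
  rw [h2, ← mul_assoc, ← Complex.exp_add, ← Complex.exp_add]
  congr 1
  rw [Complex.I_sq]
  push_cast
  ring

variable {k l : ℕ}

/-- The logarithm of the density of a nondegenerate Gaussian measure. -/
def gaussLogPDF (m : Vec k) (S : Matrix (Fin k) (Fin k) ℝ) (x : Vec k) : ℝ :=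
  -(1 / 2) * Real.log S.det - 1 / 2 * wnormSq S⁻¹ (x - m) - k / 2 * Real.log (2 * Real.pi)

@[fun_prop]
lemma measurable_gaussLogPDF (m : Vec k) (S : Matrix (Fin k) (Fin k) ℝ) :
    Measurable (gaussLogPDF m S) := by
  unfold gaussLogPDF
  fun_prop

lemma map_withDensity_comp {α β : Type*} [MeasurableSpace α] [MeasurableSpace β] {μ : Measure α}
    {g : α → β} (hg : Measurable g) {f : β → ℝ≥0∞} (hf : Measurable f) :
    (μ.withDensity (f ∘ g)).map g = (μ.map g).withDensity f := by
  ext s hs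
  rw [Measure.map_apply hg hs, withDensity_apply _ (hg hs), withDensity_apply _ hs,
    setLIntegral_map hs hf hg]
  rfl

-- The measure is the image of the standard Gaussian under `x ↦ m + R x` with `R = √S`. The identity
-- `R S⁻¹ R = 1` turns the quadratic form into `‖x‖²`, and the Jacobian supplies `-½ log det S`.
open scoped MatrixOrder in
lemma multivariateGaussian_eq_withDensity (m : Vec k) {S : Matrix (Fin k) (Fin k) ℝ}
    (hS : S.PosDef) : multivariateGaussian m S = volume.withDensity
      (fun x => ENNReal.ofReal (Real.exp (gaussLogPDF m S x))) := by
  set R := CFC.sqrt S with hR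
  have hRR : R * R = S := CFC.sqrt_mul_sqrt_self _ hS.posSemidef.nonneg
  have hRt : Rᵀ = R := by
    simpa [IsSelfAdjoint, star_eq_conjTranspose] using (CFC.sqrt_nonneg S).isSelfAdjoint
  have hdet : R.det * R.det = S.det := by rw [← det_mul, hRR]
  have hdet0 : R.det ≠ 0 := by
    intro h
    have := hS.det_pos
    rw [← hdet, h] at this
    simp at this
  have uR : IsUnit R.det := isUnit_iff_ne_zero.2 hdet0
  have hRinv : R * S⁻¹ * R = 1 := by
    rw [← hRR, Matrix.mul_inv_rev, ← Matrix.mul_assoc, mul_nonsing_inv _ uR, Matrix.one_mul,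
      nonsing_inv_mul _ uR]
  let L : Vec k →ₗ[ℝ] Vec k := Matrix.toEuclideanLin R
  have hL : LinearMap.det L = R.det := by
    have : L = Matrix.toLin (EuclideanSpace.basisFun (Fin k) ℝ).toBasis
      (EuclideanSpace.basisFun (Fin k) ℝ).toBasis R := by
      rw [← Matrix.toEuclideanLin_eq_toLin_orthonormal]
    rw [this, LinearMap.det_toLin]
  let f : Vec k → ℝ≥0∞ := fun y =>
    ENNReal.ofReal (Real.exp (-(1 / 2) * wnormSq S⁻¹ (y - m) - k / 2 * Real.log (2 * Real.pi)))
  have hf : Measurable f := by fun_prop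
  have hg : Measurable fun x : Vec k => m + mulVecE R x := by fun_prop
  have e1 : (fun x => ENNReal.ofReal (Real.exp (-(1 / 2) * ‖x‖ ^ 2
      - k / 2 * Real.log (2 * Real.pi)))) = f ∘ fun x : Vec k => m + mulVecE R x := by
    ext x
    have : wnormSq S⁻¹ (m + mulVecE R x - m) = ‖x‖ ^ 2 := by
      rw [add_sub_cancel_left, wnormSq, mulVecE, EuclideanSpace.real_norm_sq_eq]
      have : (R *ᵥ x.ofLp) ⬝ᵥ (S⁻¹ *ᵥ (R *ᵥ x.ofLp)) = x.ofLp ⬝ᵥ ((R * S⁻¹ * R) *ᵥ x.ofLp) := by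
        rw [← mulVec_mulVec, ← mulVec_mulVec, dotProduct_mulVec x.ofLp R, ← mulVec_transpose, hRt]
      simp only [this, hRinv, one_mulVec]
      simp [dotProduct, sq]
    simp only [f, Function.comp_apply, this]
  have e2 : (volume : Measure (Vec k)).map (fun x : Vec k => m + mulVecE R x) =
      ENNReal.ofReal |R.det⁻¹| • volume := by
    have h1 := Measure.map_linearMap_addHaar_eq_smul_addHaar (volume : Measure (Vec k))
      (f := L) (by rw [hL]; exact hdet0)
    rw [hL] at h1
    have h2 : (fun x : Vec k => m + mulVecE R x) = (fun y => m + y) ∘ L := rfl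
    rw [h2, ← Measure.map_map (measurable_const_add m)
      (show Measurable L from measurable_mulVecE R), h1, Measure.map_smul,
      map_add_left_eq_self]
  have e3 : multivariateGaussian m S = (stdGaussian (Vec k)).map (fun x => m + mulVecE R x) := rfl
  rw [e3, stdGaussian_eq_withDensity, e1, map_withDensity_comp hg hf, e2, withDensity_smul_measure,
    ← withDensity_smul _ hf]
  congr 1
  ext y
  simp only [Pi.smul_apply, smul_eq_mul, f]
  rw [← ENNReal.ofReal_mul (abs_nonneg _)]
  congr 1
  have h3 : |R.det⁻¹| = Real.exp (-(1 / 2) * Real.log S.det) := by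
    rw [← hdet, Real.log_mul hdet0 hdet0, abs_inv, ← Real.exp_log (abs_pos.2 hdet0), Real.log_abs,
      ← Real.exp_neg]
    congr 1
    ring
  rw [h3, ← Real.exp_add, gaussLogPDF]
  congr 1
  ring

/-- The log-likelihood ratio of two Gaussian measures. -/
def gaussLLR (b : Vec k) (P : Matrix (Fin k) (Fin k) ℝ) (a : Vec k)
    (S : Matrix (Fin k) (Fin k) ℝ) (x : Vec k) : ℝ :=
  1 / 2 * (Real.log S.det - Real.log P.det + wnormSq S⁻¹ (x - a) - wnormSq P⁻¹ (x - b))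

@[fun_prop]
lemma measurable_gaussLLR (b : Vec k) (P : Matrix (Fin k) (Fin k) ℝ) (a : Vec k)
    (S : Matrix (Fin k) (Fin k) ℝ) : Measurable (gaussLLR b P a S) := by
  unfold gaussLLR
  fun_prop

lemma multivariateGaussian_withDensity (b : Vec k) {P : Matrix (Fin k) (Fin k) ℝ}
    (hP : P.PosDef) (a : Vec k) {S : Matrix (Fin k) (Fin k) ℝ} (hS : S.PosDef) :
    (multivariateGaussian a S).withDensity
      (fun x => ENNReal.ofReal (Real.exp (gaussLLR b P a S x))) = multivariateGaussian b P := by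
  rw [multivariateGaussian_eq_withDensity a hS, multivariateGaussian_eq_withDensity b hP,
    ← withDensity_mul _ (by fun_prop) (by fun_prop)]
  congr 1
  ext x
  rw [Pi.mul_apply, ← ENNReal.ofReal_mul (Real.exp_nonneg _), ← Real.exp_add]
  congr 2
  simp only [gaussLogPDF, gaussLLR]
  ring

end Gaussian

/-! ### Gaussian channels -/

section Channel

variable {k l : ℕ}

lemma map_const_add_multivariateGaussian (c m : Vec k) (S : Matrix (Fin k) (Fin k) ℝ) :
    (multivariateGaussian m S).map (fun x => c + x) = multivariateGaussian (c + m) S := by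
  unfold multivariateGaussian
  rw [Measure.map_map (by fun_prop) (by fun_prop)]
  congr 1
  ext1 x
  simp [add_assoc]

lemma gaussChannel_apply (M : Matrix (Fin l) (Fin k) ℝ) (S : Matrix (Fin l) (Fin l) ℝ)
    (v : Vec k) : gaussChannel M S v = multivariateGaussian (mulVecE M v) S := by
  unfold gaussChannel
  rw [Kernel.map_apply _ (measurable_mulVecE_add M), Kernel.prod_apply, Kernel.id_apply,
    Kernel.const_apply, Measure.dirac_prod,
    Measure.map_map (measurable_mulVecE_add M) (by fun_prop)]
  have := map_const_add_multivariateGaussian (mulVecE M v) 0 S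
  rw [add_zero] at this
  exact this

lemma memLp_id_multivariateGaussian (m : Vec k) (S : Matrix (Fin k) (Fin k) ℝ) :
    MemLp (fun x : Vec k => x) 2 (multivariateGaussian m S) := IsGaussian.memLp_two_id

lemma integral_coord_multivariateGaussian (m : Vec k) (S : Matrix (Fin k) (Fin k) ℝ) (i : Fin k) :
    ∫ x, x i ∂(multivariateGaussian m S) = m i := by
  have h := (EuclideanSpace.proj (𝕜 := ℝ) i : Vec k →L[ℝ] ℝ).integral_comp_comm
    ((memLp_id_multivariateGaussian m S).integrable one_le_two)
  rw [integral_id_multivariateGaussian] at h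
  exact h

lemma secondMoment_multivariateGaussian (a b : Vec k) {V : Matrix (Fin k) (Fin k) ℝ}
    (hV : V.PosSemidef) : secondMoment (multivariateGaussian a V) (fun x => x - b) =
      V + vecMulVec (a - b).ofLp (a - b).ofLp := by
  ext i j
  have hm : ∀ i, MemLp (fun x : Vec k => x i) 2 (multivariateGaussian a V) :=
    memLp_coord (memLp_id_multivariateGaussian a V)
  have h := covariance_eval_multivariateGaussian (μ := a) hV i j
  rw [covariance_eq_sub (hm i) (hm j)] at h
  have hi : ∀ i, Integrable (fun x : Vec k => x i) (multivariateGaussian a V) := fun i =>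
    (hm i).integrable one_le_two
  have hij : Integrable (fun x : Vec k => x i * x j) (multivariateGaussian a V) :=
    (hm i).integrable_mul (hm j)
  simp only [Pi.mul_apply, integral_coord_multivariateGaussian] at h
  have e : ∀ x : Vec k, (x - b) i * (x - b) j = x i * x j - b j * x i - b i * x j + b i * b j := by
    intro x
    simp only [PiLp.sub_apply]
    ring
  simp only [secondMoment, of_apply, e, Matrix.add_apply, vecMulVec_apply]
  rw [integral_add, integral_sub, integral_sub, integral_const_mul, integral_const_mul,
    integral_coord_multivariateGaussian, integral_coord_multivariateGaussian, integral_const]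
  · simp only [probReal_univ, one_smul]
    linarith
  · exact hij
  · exact (hi i).const_mul _
  · exact hij.sub ((hi i).const_mul _)
  · exact (hi j).const_mul _
  · exact (hij.sub ((hi i).const_mul _)).sub ((hi j).const_mul _)
  · exact integrable_const _

lemma memLp_sub_const_multivariateGaussian (a b : Vec k) (V : Matrix (Fin k) (Fin k) ℝ) :
    MemLp (fun x : Vec k => x - b) 2 (multivariateGaussian a V) :=
  (memLp_id_multivariateGaussian a V).sub (memLp_const b)

lemma trace_mul_vecMulVec_self (Θ : Matrix (Fin k) (Fin k) ℝ) (v : Vec k) :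
    (Θ * vecMulVec v.ofLp v.ofLp).trace = wnormSq Θ v := by
  rw [mul_vecMulVec, trace_vecMulVec, wnormSq, dotProduct_comm]

lemma integral_wnormSq_multivariateGaussian (a b : Vec k) {V : Matrix (Fin k) (Fin k) ℝ}
    (hV : V.PosSemidef) (Θ : Matrix (Fin k) (Fin k) ℝ) :
    ∫ x, wnormSq Θ (x - b) ∂(multivariateGaussian a V) = (Θ * V).trace + wnormSq Θ (a - b) := by
  rw [integral_wnormSq (memLp_sub_const_multivariateGaussian a b V),
    secondMoment_multivariateGaussian a b hV, Matrix.mul_add, trace_add, trace_mul_vecMulVec_self]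

lemma wnormSq_zero (Θ : Matrix (Fin k) (Fin k) ℝ) : wnormSq Θ 0 = 0 := by simp [wnormSq]

/-- The explicit log-likelihood ratio is integrated. Nonnegativity is recorded as well, so that
`ENNReal.ofReal` can later be exchanged with an integral. -/
lemma klDiv_multivariateGaussian (a b : Vec k) {V S : Matrix (Fin k) (Fin k) ℝ} (hV : V.PosDef)
    (hS : S.PosDef) :
    klDiv (multivariateGaussian a V) (multivariateGaussian b S) = ENNReal.ofReal
      (1 / 2 * (Real.log S.det - Real.log V.det + (S⁻¹ * V).trace - k + wnormSq S⁻¹ (a - b))) ∧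
    0 ≤ 1 / 2 * (Real.log S.det - Real.log V.det + (S⁻¹ * V).trace - k +
      wnormSq S⁻¹ (a - b)) := by
  have hd := multivariateGaussian_withDensity a hV b hS
  set ρ : Vec k → ℝ≥0∞ := fun x => ENNReal.ofReal (Real.exp (gaussLLR a V b S x)) with hρ
  have hac : multivariateGaussian a V ≪ multivariateGaussian b S := by
    rw [← hd]
    exact withDensity_absolutelyContinuous _ _
  have hllr : llr (multivariateGaussian a V) (multivariateGaussian b S)
      =ᵐ[multivariateGaussian a V] gaussLLR a V b S := by
    have h1 : (multivariateGaussian a V).rnDeriv (multivariateGaussian b S)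
        =ᵐ[multivariateGaussian b S] ρ := by
      rw [← hd]
      exact Measure.rnDeriv_withDensity _ (by fun_prop)
    filter_upwards [hac.ae_le h1] with x hx
    rw [llr, hx, hρ]
    simp only
    rw [ENNReal.toReal_ofReal (Real.exp_nonneg _), Real.log_exp]
  have hi : ∀ (Θ : Matrix (Fin k) (Fin k) ℝ) (c : Vec k),
      Integrable (fun x : Vec k => wnormSq Θ (x - c)) (multivariateGaussian a V) := fun Θ c =>
    integrable_wnormSq (memLp_sub_const_multivariateGaussian a c V) Θ
  have hint : Integrable (gaussLLR a V b S) (multivariateGaussian a V) := by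
    unfold gaussLLR
    exact ((((integrable_const _).sub (integrable_const _)).add (hi _ _)).sub (hi _ _)).const_mul _
  have hval : ∫ x, gaussLLR a V b S x ∂(multivariateGaussian a V) =
      1 / 2 * (Real.log S.det - Real.log V.det + (S⁻¹ * V).trace - k + wnormSq S⁻¹ (a - b)) := by
    unfold gaussLLR
    rw [integral_const_mul, integral_sub, integral_add, integral_const,
      integral_wnormSq_multivariateGaussian a b hV.posSemidef,
      integral_wnormSq_multivariateGaussian a a hV.posSemidef, sub_self a, wnormSq_zero,
      nonsing_inv_mul _ (isUnit_det_of_posDef hV), trace_one, Fintype.card_fin]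
    · simp only [probReal_univ, one_smul]
      ring
    · exact integrable_const _
    · exact hi _ _
    · exact (integrable_const _).add (hi _ _)
    · exact hi _ _
  have hint' := hint.congr hllr.symm
  have hk := klDiv_of_ac_of_integrable hac hint'
  have hnn := integral_llr_add_sub_measure_univ_nonneg hac hint'
  rw [integral_congr_ae hllr, hval] at hk hnn
  simp only [probReal_univ] at hk hnn
  constructor
  · rw [hk]; congr 1; ring
  · linarith

open Complex in
lemma charFun_map_mulVecE (M : Matrix (Fin l) (Fin k) ℝ) (μ : Measure (Vec k)) (t : Vec l) :
    charFun (μ.map (mulVecE M)) t = charFun μ (mulVecE Mᵀ t) := by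
  rw [charFun_apply, charFun_apply, integral_map (by fun_prop)
    (by fun_prop)]
  congr 1
  ext x
  congr 3
  simp only [mulVecE, EuclideanSpace.inner_eq_star_dotProduct, star_trivial]
  rw [dotProduct_mulVec, mulVec_transpose]

lemma map_prod_add_multivariateGaussian (M : Matrix (Fin l) (Fin k) ℝ) (m : Vec k)
    {P : Matrix (Fin k) (Fin k) ℝ} (hP : P.PosSemidef) {W : Matrix (Fin l) (Fin l) ℝ}
    (hW : W.PosSemidef) :
    ((multivariateGaussian m P).prod (multivariateGaussian 0 W)).map
      (fun p : Vec k × Vec l => mulVecE M p.1 + p.2) =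
    multivariateGaussian (mulVecE M m) (predCov M W P) := by
  have hS : (predCov M W P).PosSemidef := by
    have : (M * P * Mᵀ).PosSemidef := by simpa using hP.mul_mul_conjTranspose_same M
    exact this.add hW
  have h1 : ((multivariateGaussian m P).prod (multivariateGaussian (0 : Vec l) W)).map
      (fun p : Vec k × Vec l => mulVecE M p.1 + p.2) =
      ((multivariateGaussian m P).map (mulVecE M)) ∗ (multivariateGaussian 0 W) := by
    have h2 := Measure.map_prod_map (multivariateGaussian m P)
      (multivariateGaussian (0 : Vec l) W) (measurable_mulVecE M) measurable_id
    rw [Measure.map_id] at h2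
    rw [Measure.conv, h2, Measure.map_map (by fun_prop) (by fun_prop)]
    rfl
  rw [h1]
  refine Measure.ext_of_charFun ?_
  ext t
  rw [charFun_conv, charFun_map_mulVecE, charFun_multivariateGaussian hP,
    charFun_multivariateGaussian hW, charFun_multivariateGaussian hS, ← Complex.exp_add]
  congr 1
  have e1 : inner ℝ (mulVecE Mᵀ t) m = inner ℝ t (mulVecE M m) := by
    simp only [mulVecE, EuclideanSpace.inner_eq_star_dotProduct, star_trivial]
    rw [mulVec_transpose, dotProduct_comm, ← dotProduct_mulVec, dotProduct_comm]
  have e2 : (mulVecE Mᵀ t).ofLp ⬝ᵥ (P *ᵥ (mulVecE Mᵀ t).ofLp) =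
      t.ofLp ⬝ᵥ ((M * P * Mᵀ) *ᵥ t.ofLp) := by
    simp only [mulVecE]
    rw [← mulVec_mulVec, ← mulVec_mulVec, dotProduct_mulVec t.ofLp M, mulVec_transpose]
  rw [e1, e2, predCov, add_mulVec, dotProduct_add, inner_zero_right]
  push_cast
  ring

lemma gaussChannel_comp_multivariateGaussian (M : Matrix (Fin l) (Fin k) ℝ) (m : Vec k)
    {P : Matrix (Fin k) (Fin k) ℝ} (hP : P.PosSemidef) {W : Matrix (Fin l) (Fin l) ℝ}
    (hW : W.PosSemidef) {f : Vec l → ℝ≥0∞} (hf : Measurable f) :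
    ∫⁻ x, ∫⁻ y, f y ∂(gaussChannel M W x) ∂(multivariateGaussian m P) =
      ∫⁻ y, f y ∂(multivariateGaussian (mulVecE M m) (predCov M W P)) := by
  rw [← map_prod_add_multivariateGaussian M m hP hW,
    lintegral_map hf (measurable_mulVecE_add M), lintegral_prod
      (fun p : Vec k × Vec l => f (mulVecE M p.1 + p.2))
      (hf.comp (measurable_mulVecE_add M)).aemeasurable]
  refine lintegral_congr fun x => ?_
  have := map_const_add_multivariateGaussian (mulVecE M x) 0 W
  rw [add_zero] at this
  rw [gaussChannel_apply, ← this, lintegral_map hf (by fun_prop)]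

end Channel

/-! ### Kullback-Leibler divergence -/

section KL

variable {α β γ : Type*} [MeasurableSpace α] [MeasurableSpace β] [MeasurableSpace γ]

/-- Data processing along `g` and then along `h`. -/
lemma klDiv_map_eq_of_leftInverse (μ ν : Measure α) [IsFiniteMeasure μ] [IsFiniteMeasure ν]
    {g : α → β} {h : β → α} (hg : Measurable g) (hh : Measurable h)
    (hgh : Function.LeftInverse h g) : klDiv (μ.map g) (ν.map g) = klDiv μ ν := by
  refine le_antisymm (klDiv_map_le _ _ hg) ?_
  have h1 : ∀ ρ : Measure α, (ρ.map g).map h = ρ := fun ρ => by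
    rw [Measure.map_map hh hg, hgh.comp_eq_id, Measure.map_id]
  calc klDiv μ ν = klDiv ((μ.map g).map h) ((ν.map g).map h) := by rw [h1, h1]
    _ ≤ _ := klDiv_map_le _ _ hh

/-- Under absolute continuity the density of the joint measures is the fibrewise density of the
kernels. Otherwise `κ x ≪ η x` fails on a set of positive measure, and both sides are infinite. -/
lemma klDiv_compProd_right_eq_lintegral [MeasurableSpace.CountableOrCountablyGenerated α β]
    (μ : Measure α) [IsFiniteMeasure μ] (κ η : Kernel α β) [IsMarkovKernel κ] [IsMarkovKernel η] :
    klDiv (μ ⊗ₘ κ) (μ ⊗ₘ η) = ∫⁻ x, klDiv (κ x) (η x) ∂μ := by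
  by_cases hac : μ ⊗ₘ κ ≪ μ ⊗ₘ η
  · have hac' := Measure.absolutelyContinuous_compProd_right_iff.1 hac
    have hκ : κ =ᵐ[μ] η.withDensity (κ.rnDeriv η) := by
      filter_upwards [hac'] with a ha using (Kernel.withDensity_rnDeriv_eq ha).symm
    have hd : (μ ⊗ₘ κ).rnDeriv (μ ⊗ₘ η) =ᵐ[μ ⊗ₘ η] fun p => κ.rnDeriv η p.1 p.2 := by
      rw [Measure.compProd_congr hκ, Measure.compProd_withDensity (by fun_prop)]
      exact Measure.rnDeriv_withDensity _ (by fun_prop)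
    rw [klDiv_eq_lintegral_klFun_of_ac hac]
    calc ∫⁻ p, ENNReal.ofReal (klFun (((μ ⊗ₘ κ).rnDeriv (μ ⊗ₘ η)) p).toReal) ∂(μ ⊗ₘ η)
        = ∫⁻ p, ENNReal.ofReal (klFun (κ.rnDeriv η p.1 p.2).toReal) ∂(μ ⊗ₘ η) := by
          refine lintegral_congr_ae ?_
          filter_upwards [hd] with p hp
          rw [hp]
      _ = ∫⁻ x, ∫⁻ y, ENNReal.ofReal (klFun (κ.rnDeriv η x y).toReal) ∂(η x) ∂μ := by
          rw [Measure.lintegral_compProd (by fun_prop)]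
      _ = _ := by
          refine lintegral_congr_ae ?_
          filter_upwards [hac'] with x hx
          rw [klDiv_eq_lintegral_klFun_of_ac hx]
          refine lintegral_congr_ae ?_
          filter_upwards [κ.rnDeriv_eq_rnDeriv_measure (η := η) (a := x)] with y hy
          rw [hy]
  · rw [klDiv_of_not_ac hac]
    have hs : MeasurableSet {x | κ x ≪ η x} := Kernel.measurableSet_absolutelyContinuous κ η
    have hpos : μ {x | κ x ≪ η x}ᶜ ≠ 0 := by
      intro h0
      exact hac (Measure.absolutelyContinuous_compProd_right_iff.2 h0)
    symm
    rw [eq_top_iff]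
    calc (⊤ : ℝ≥0∞) = ∫⁻ x, ({x | κ x ≪ η x}ᶜ).indicator (fun _ => ⊤) x ∂μ := by
          rw [lintegral_indicator hs.compl, setLIntegral_const, ENNReal.top_mul hpos]
      _ ≤ _ := by
          refine lintegral_mono fun x => ?_
          by_cases hx : x ∈ {x | κ x ≪ η x}ᶜ
          · rw [klDiv_of_not_ac hx]
            exact le_top
          · rw [Set.indicator_of_notMem hx]
            exact zero_le

lemma measurable_klDiv_kernel [MeasurableSpace.CountableOrCountablyGenerated α β]
    (κ η : Kernel α β) [IsMarkovKernel κ] [IsMarkovKernel η] :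
    Measurable fun x => klDiv (κ x) (η x) := by
  classical
  have : (fun x => klDiv (κ x) (η x)) = fun x => if κ x ≪ η x then
      ∫⁻ y, ENNReal.ofReal (klFun (κ.rnDeriv η x y).toReal) ∂(η x) else ⊤ := by
    ext x
    split_ifs with hx
    · rw [klDiv_eq_lintegral_klFun_of_ac hx]
      refine lintegral_congr_ae ?_
      filter_upwards [κ.rnDeriv_eq_rnDeriv_measure (η := η) (a := x)] with y hy
      rw [hy]
    · exact klDiv_of_not_ac hx
  rw [this]
  have hm : Measurable fun p : α × β => ENNReal.ofReal (klFun (κ.rnDeriv η p.1 p.2).toReal) := by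
    fun_prop
  exact Measurable.ite (Kernel.measurableSet_absolutelyContinuous κ η)
    hm.lintegral_kernel_prod_right' measurable_const

/-- The Donsker-Varadhan lower bound. -/
lemma ofReal_integral_le_klDiv {P Q : Measure α} [IsProbabilityMeasure P] [IsProbabilityMeasure Q]
    {g : α → ℝ} (hg : Measurable g) (hgi : Integrable g P)
    (h1 : ∫⁻ x, ENNReal.ofReal (Real.exp (g x)) ∂Q ≤ 1) :
    ENNReal.ofReal (∫ x, g x ∂P) ≤ klDiv P Q := by
  by_cases hac : P ≪ Q
  swap; · rw [klDiv_of_not_ac hac]; exact le_top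
  by_cases hint : Integrable (llr P Q) P
  swap; · rw [klDiv_of_not_integrable hint]; exact le_top
  rw [klDiv_of_ac_of_integrable hac hint]
  refine ENNReal.ofReal_le_ofReal ?_
  simp only [probReal_univ, add_sub_cancel_right]
  have hmeas : Measurable (llr P Q) := measurable_llr P Q
  -- A change of measure; only an inequality, because `Q` may charge the set where `dP/dQ` vanishes.
  have hle : ∫⁻ x, ENNReal.ofReal (Real.exp (g x - llr P Q x)) ∂P ≤ 1 := by
    refine le_trans ?_ h1
    rw [← lintegral_rnDeriv_mul hac (by fun_prop)]
    refine lintegral_mono_ae ?_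
    filter_upwards [P.rnDeriv_lt_top Q] with x hx
    rw [llr]
    set f := P.rnDeriv Q x
    rcases eq_or_ne f 0 with h0 | h0
    · rw [h0, zero_mul]; exact zero_le
    have hf : 0 < f.toReal := ENNReal.toReal_pos h0 hx.ne
    rw [Real.exp_sub, Real.exp_log hf, ENNReal.ofReal_div_of_pos hf, ENNReal.ofReal_toReal hx.ne,
      ENNReal.mul_div_cancel h0 hx.ne]
  have hexp : Integrable (fun x => Real.exp (g x - llr P Q x)) P := by
    refine ⟨by fun_prop, ?_⟩
    rw [hasFiniteIntegral_iff_ofReal (ae_of_all _ fun x => Real.exp_nonneg _)]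
    exact hle.trans_lt ENNReal.one_lt_top
  have h2 : ∫ x, Real.exp (g x - llr P Q x) ∂P ≤ 1 := by
    rw [integral_eq_lintegral_of_nonneg_ae (ae_of_all _ fun x => Real.exp_nonneg _) (by fun_prop)]
    exact ENNReal.toReal_mono ENNReal.one_ne_top hle
  -- The tangent inequality `1 + u ≤ exp u` replaces Jensen's inequality.
  have h3 : ∫ x, (g x - llr P Q x) ∂P ≤ ∫ x, (Real.exp (g x - llr P Q x) - 1) ∂P := by
    refine integral_mono (hgi.sub hint) (hexp.sub (integrable_const _)) fun x => ?_
    have := Real.add_one_le_exp (g x - llr P Q x)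
    simp only
    linarith
  rw [integral_sub hgi hint, integral_sub hexp (integrable_const _), integral_const] at h3
  simp only [probReal_univ, one_smul] at h3
  linarith

lemma map_compProd_comap (μ : Measure α) [SFinite μ] {g : α → β} (hg : Measurable g)
    (κ : Kernel β γ) [IsMarkovKernel κ] :
    (μ ⊗ₘ κ.comap g hg).map (fun p => (g p.1, p.2)) = (μ.map g) ⊗ₘ κ := by
  refine Measure.ext_of_lintegral _ fun f hf => ?_
  rw [lintegral_map hf (by fun_prop), Measure.lintegral_compProd (by fun_prop),
    Measure.lintegral_compProd hf, lintegral_map (by fun_prop) hg]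
  rfl

lemma map_compProd_prod (μ : Measure γ) [SFinite μ] (κ : Kernel γ α) (η : Kernel γ β)
    [IsMarkovKernel κ] [IsMarkovKernel η] :
    (μ ⊗ₘ (κ ×ₖ η)).map (fun p => ((p.2.1, p.1), p.2.2)) =
      ((μ ⊗ₘ κ).map Prod.swap) ⊗ₘ (η.comap Prod.snd measurable_snd) := by
  refine Measure.ext_of_lintegral _ fun f hf => ?_
  rw [lintegral_map hf (by fun_prop), Measure.lintegral_compProd (by fun_prop),
    Measure.lintegral_compProd hf, lintegral_map hf.lintegral_kernel_prod_right' (by fun_prop),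
    Measure.lintegral_compProd]
  swap
  · exact hf.lintegral_kernel_prod_right'.comp measurable_swap
  refine lintegral_congr fun z => ?_
  rw [Kernel.prod_apply, lintegral_prod _ (by fun_prop)]
  rfl

lemma map_compProd_prod' (μ : Measure γ) [SFinite μ] (κ : Kernel γ α) (η : Kernel γ β)
    [IsMarkovKernel κ] [IsMarkovKernel η] :
    (μ ⊗ₘ (κ ×ₖ η)).map (fun p => ((p.2.2, p.1), p.2.1)) =
      ((μ ⊗ₘ η).map Prod.swap) ⊗ₘ (κ.comap Prod.snd measurable_snd) := by
  refine Measure.ext_of_lintegral _ fun f hf => ?_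
  rw [lintegral_map hf (by fun_prop), Measure.lintegral_compProd (by fun_prop),
    Measure.lintegral_compProd hf, lintegral_map hf.lintegral_kernel_prod_right' (by fun_prop),
    Measure.lintegral_compProd]
  swap
  · exact hf.lintegral_kernel_prod_right'.comp measurable_swap
  refine lintegral_congr fun z => ?_
  rw [Kernel.prod_apply, lintegral_prod_symm _ (by fun_prop)]
  rfl

end KL

/-! ### Conditional mutual information -/

section CondMutualInfo

variable {Ω α β γ : Type*} [MeasurableSpace Ω]
  [MeasurableSpace α] [StandardBorelSpace α] [Nonempty α]
  [MeasurableSpace β] [StandardBorelSpace β] [Nonempty β] [MeasurableSpace γ]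
  {μ : Measure Ω} [IsProbabilityMeasure μ] {X : Ω → α} {Y : Ω → β} {Z : Ω → γ}

/-- The averaged divergence becomes a single divergence of joint laws, to which the chain rule and
data processing apply. -/
lemma condMutualInfo_eq_klDiv (hX : Measurable X) (hY : Measurable Y) (hZ : Measurable Z) :
    condMutualInfo μ X Y Z = klDiv (μ.map fun ω => (Z ω, (X ω, Y ω)))
      ((μ.map Z) ⊗ₘ (condDistrib X Z μ ×ₖ condDistrib Y Z μ)) := by
  have := Measure.isProbabilityMeasure_map (μ := μ) hZ.aemeasurable
  rw [← compProd_map_condDistrib (X := Z) (hX.prodMk hY).aemeasurable,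
    klDiv_compProd_right_eq_lintegral]
  simp only [Kernel.prod_apply]
  rfl

lemma map_swap_compProd_condDistrib (hX : Measurable X) (hZ : Measurable Z) :
    ((μ.map Z) ⊗ₘ condDistrib X Z μ).map Prod.swap = μ.map fun ω => (X ω, Z ω) := by
  rw [compProd_map_condDistrib hX.aemeasurable, Measure.map_map (by fun_prop) (by fun_prop)]
  rfl

omit [StandardBorelSpace β] [Nonempty β] in
lemma klDiv_rearrange (hX : Measurable X) (hY : Measurable Y) (hZ : Measurable Z)
    (η : Kernel γ β) [IsMarkovKernel η] :
    klDiv (μ.map fun ω => (Z ω, (X ω, Y ω))) ((μ.map Z) ⊗ₘ (condDistrib X Z μ ×ₖ η)) =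
      klDiv (μ.map fun ω => ((X ω, Z ω), Y ω))
        ((μ.map fun ω => (X ω, Z ω)) ⊗ₘ (η.comap Prod.snd measurable_snd)) := by
  have := Measure.isProbabilityMeasure_map (μ := μ) hZ.aemeasurable
  have := Measure.isProbabilityMeasure_map (μ := μ) (hZ.prodMk (hX.prodMk hY)).aemeasurable
  rw [← klDiv_map_eq_of_leftInverse _ _
    (g := fun p : γ × α × β => ((p.2.1, p.1), p.2.2))
    (h := fun p : (α × γ) × β => (p.1.2, (p.1.1, p.2))) (by fun_prop) (by fun_prop) (fun _ => rfl),
    map_compProd_prod, map_swap_compProd_condDistrib hX hZ, Measure.map_map (by fun_prop)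
    (by fun_prop)]
  rfl

omit [StandardBorelSpace β] [Nonempty β] in
lemma klDiv_rearrange' (hX : Measurable X) (hY : Measurable Y) (hZ : Measurable Z)
    (η : Kernel γ β) [IsMarkovKernel η] :
    klDiv (μ.map fun ω => (Z ω, (X ω, Y ω))) ((μ.map Z) ⊗ₘ (condDistrib X Z μ ×ₖ η)) =
      klDiv (μ.map fun ω => ((Y ω, Z ω), X ω))
        ((((μ.map Z) ⊗ₘ η).map Prod.swap) ⊗ₘ
          ((condDistrib X Z μ).comap Prod.snd measurable_snd)) := by
  have := Measure.isProbabilityMeasure_map (μ := μ) hZ.aemeasurable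
  have := Measure.isProbabilityMeasure_map (μ := μ) (hZ.prodMk (hX.prodMk hY)).aemeasurable
  rw [← klDiv_map_eq_of_leftInverse _ _
    (g := fun p : γ × α × β => ((p.2.2, p.1), p.2.1))
    (h := fun p : (β × γ) × α => (p.1.2, (p.2, p.1.1))) (by fun_prop) (by fun_prop) (fun _ => rfl),
    map_compProd_prod', Measure.map_map (by fun_prop) (by fun_prop)]
  rfl

lemma condMutualInfo_eq_klDiv_compProd (hX : Measurable X) (hY : Measurable Y)
    (hZ : Measurable Z) :
    condMutualInfo μ X Y Z = klDiv (μ.map fun ω => ((X ω, Z ω), Y ω))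
      ((μ.map fun ω => (X ω, Z ω)) ⊗ₘ ((condDistrib Y Z μ).comap Prod.snd measurable_snd)) := by
  rw [condMutualInfo_eq_klDiv hX hY hZ, klDiv_rearrange hX hY hZ]

/-- The chain rule `I(X; (Z, Y)) = I(X; Z) + I(X; Y | Z)`. -/
lemma klDiv_prod_eq_add_condMutualInfo (hX : Measurable X) (hY : Measurable Y)
    (hZ : Measurable Z) :
    klDiv (μ.map fun ω => (X ω, (Z ω, Y ω))) ((μ.map X).prod (μ.map fun ω => (Z ω, Y ω))) =
      klDiv (μ.map fun ω => (X ω, Z ω)) ((μ.map X).prod (μ.map Z)) + condMutualInfo μ X Y Z := by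
  have := Measure.isProbabilityMeasure_map (μ := μ) hZ.aemeasurable
  have := Measure.isProbabilityMeasure_map (μ := μ) hX.aemeasurable
  have := Measure.isProbabilityMeasure_map (μ := μ) (hZ.prodMk hY).aemeasurable
  have := Measure.isProbabilityMeasure_map (μ := μ) (hX.prodMk hZ).aemeasurable
  have := Measure.isProbabilityMeasure_map (μ := μ) (hX.prodMk (hZ.prodMk hY)).aemeasurable
  have h1 : ((μ.map X).prod (μ.map fun ω => (Z ω, Y ω))).map
      (fun p : α × γ × β => ((p.1, p.2.1), p.2.2)) =
      ((μ.map X).prod (μ.map Z)) ⊗ₘ ((condDistrib Y Z μ).comap Prod.snd measurable_snd) := by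
    rw [← compProd_map_condDistrib (X := Z) hY.aemeasurable]
    refine Measure.ext_of_lintegral _ fun f hf => ?_
    rw [lintegral_map hf (by fun_prop), lintegral_prod _ (by fun_prop),
      Measure.lintegral_compProd hf,
      lintegral_prod _ (Measurable.lintegral_kernel_prod_right' hf).aemeasurable]
    refine lintegral_congr fun x => ?_
    rw [Measure.lintegral_compProd (by fun_prop)]
    rfl
  rw [← klDiv_map_eq_of_leftInverse _ _
    (g := fun p : α × γ × β => ((p.1, p.2.1), p.2.2))
    (h := fun p : (α × γ) × β => (p.1.1, (p.1.2, p.2))) (by fun_prop) (by fun_prop) (fun _ => rfl),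
    h1, Measure.map_map (by fun_prop) (by fun_prop), condMutualInfo_eq_klDiv_compProd hX hY hZ]
  have h2 : (μ.map ((fun p : α × γ × β => ((p.1, p.2.1), p.2.2)) ∘
      fun ω => (X ω, (Z ω, Y ω)))) = (μ.map fun ω => (X ω, Z ω)) ⊗ₘ
        condDistrib Y (fun ω => (X ω, Z ω)) μ := by
    rw [compProd_map_condDistrib hY.aemeasurable]
    rfl
  have h3 : (μ.map fun ω => ((X ω, Z ω), Y ω)) = (μ.map fun ω => (X ω, Z ω)) ⊗ₘ
        condDistrib Y (fun ω => (X ω, Z ω)) μ := by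
    rw [compProd_map_condDistrib hY.aemeasurable]
  rw [h2, h3]
  exact klDiv_compProd_eq_add _ _ _ _

/-- The conditional law of `Y` given `Z` is the best kernel of `Z` for describing `Y`. Splitting the
right side along `(Y, Z)` first gives the divergence of the law of `(Y, Z)` from the one built with
`η`, plus a remainder that does not involve `η` and equals the conditional mutual information. -/
lemma condMutualInfo_le_klDiv (hX : Measurable X) (hY : Measurable Y) (hZ : Measurable Z)
    (η : Kernel γ β) [IsMarkovKernel η] :
    condMutualInfo μ X Y Z ≤ klDiv (μ.map fun ω => ((X ω, Z ω), Y ω))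
        ((μ.map fun ω => (X ω, Z ω)) ⊗ₘ (η.comap Prod.snd measurable_snd)) := by
  have := Measure.isProbabilityMeasure_map (μ := μ) hZ.aemeasurable
  have := Measure.isProbabilityMeasure_map (μ := μ) (hY.prodMk hZ).aemeasurable
  have h3 : (μ.map fun ω => ((Y ω, Z ω), X ω)) = (μ.map fun ω => (Y ω, Z ω)) ⊗ₘ
        condDistrib X (fun ω => (Y ω, Z ω)) μ := by
    rw [compProd_map_condDistrib hX.aemeasurable]
  have := Measure.isProbabilityMeasure_map (μ := (μ.map Z) ⊗ₘ η)
    (measurable_swap (α := γ) (β := β)).aemeasurable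
  rw [condMutualInfo_eq_klDiv hX hY hZ, ← klDiv_rearrange hX hY hZ, klDiv_rearrange' hX hY hZ,
    klDiv_rearrange' hX hY hZ, map_swap_compProd_condDistrib hY hZ, h3,
    klDiv_compProd_eq_add (μ.map fun ω => (Y ω, Z ω)) (((μ.map Z) ⊗ₘ η).map Prod.swap)]
  exact le_add_self

omit [StandardBorelSpace α] [Nonempty α] [Nonempty β] in
lemma klDiv_map_compProd_comap_eq_lintegral {γ' : Type*} [MeasurableSpace γ'] {κ : Kernel γ' β}
    [IsMarkovKernel κ] {f : α → γ'} (hf : Measurable f) (hX : Measurable X) (hZ : Measurable Z)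
    (η : Kernel γ β) [IsMarkovKernel η] :
    klDiv ((μ.map fun ω => (X ω, Z ω)) ⊗ₘ κ.comap (fun p => f p.1) (hf.comp measurable_fst))
      ((μ.map fun ω => (X ω, Z ω)) ⊗ₘ (η.comap Prod.snd measurable_snd)) =
      ∫⁻ ω, klDiv (κ (f (X ω))) (η (Z ω)) ∂μ := by
  have := Measure.isProbabilityMeasure_map (μ := μ) (hX.prodMk hZ).aemeasurable
  rw [klDiv_compProd_right_eq_lintegral,
    lintegral_map (measurable_klDiv_kernel _ _) (hX.prodMk hZ)]
  rfl

/-- If `Y` is drawn through a channel that sees only `f X`, the information depends on `X` only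
through `f X`. This later replaces the source history by its last state. -/
lemma condMutualInfo_eq_lintegral {γ' : Type*} [MeasurableSpace γ'] {κ : Kernel γ' β}
    [IsMarkovKernel κ] {f : α → γ'} (hf : Measurable f) (hX : Measurable X) (hY : Measurable Y)
    (hZ : Measurable Z)
    (h : (μ.map fun ω => ((X ω, Z ω), Y ω)) =
      (μ.map fun ω => (X ω, Z ω)) ⊗ₘ κ.comap (fun p => f p.1) (hf.comp measurable_fst)) :
    condMutualInfo μ X Y Z = ∫⁻ ω, klDiv (κ (f (X ω))) (condDistrib Y Z μ (Z ω)) ∂μ := by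
  rw [condMutualInfo_eq_klDiv_compProd hX hY hZ, h,
    klDiv_map_compProd_comap_eq_lintegral hf hX hZ]

lemma condMutualInfo_le_lintegral {γ' : Type*} [MeasurableSpace γ'] {κ : Kernel γ' β}
    [IsMarkovKernel κ] {f : α → γ'} (hf : Measurable f) (hX : Measurable X) (hY : Measurable Y)
    (hZ : Measurable Z)
    (h : (μ.map fun ω => ((X ω, Z ω), Y ω)) =
      (μ.map fun ω => (X ω, Z ω)) ⊗ₘ κ.comap (fun p => f p.1) (hf.comp measurable_fst))
    (η : Kernel γ β) [IsMarkovKernel η] :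
    condMutualInfo μ X Y Z ≤ ∫⁻ ω, klDiv (κ (f (X ω))) (η (Z ω)) ∂μ := by
  refine (condMutualInfo_le_klDiv hX hY hZ η).trans_eq ?_
  rw [h, klDiv_map_compProd_comap_eq_lintegral hf hX hZ]

end CondMutualInfo

/-! ### The joint law of source and outputs -/

section Glue

variable {X : ℕ → Type*} [∀ i, MeasurableSpace (X i)] {s s' : Finset ℕ} {a : ℕ}

/-- Extends a family indexed by `s` by one more value. -/
def glue (h : ∀ i ∈ s', i ∈ s ∨ i = a) (p : (Π i : s, X i) × X a) : Π i : s', X i :=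
  fun i => if hi : i.1 ∈ s then p.1 ⟨i.1, hi⟩ else
    cast (congrArg X ((h i.1 i.2).resolve_left hi).symm) p.2

/-- Restricts a family indexed by `s'` to `s` and to the index `a`. -/
def unglue (hs : s ⊆ s') (ha : a ∈ s') (q : Π i : s', X i) : (Π i : s, X i) × X a :=
  (fun i => q ⟨i.1, hs i.2⟩, q ⟨a, ha⟩)

lemma measurable_glue (h : ∀ i ∈ s', i ∈ s ∨ i = a) : Measurable (glue (X := X) h) := by
  refine measurable_pi_lambda _ fun i => ?_
  obtain ⟨i, his⟩ := i
  unfold glue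
  by_cases hi : i ∈ s
  · simp only [hi, dite_true]
    fun_prop
  · simp only [hi, dite_false]
    obtain rfl := (h i his).resolve_left hi
    exact measurable_snd

lemma measurable_unglue (hs : s ⊆ s') (ha : a ∈ s') : Measurable (unglue (X := X) hs ha) := by
  unfold unglue
  fun_prop

omit [∀ i, MeasurableSpace (X i)] in
lemma glue_unglue (h : ∀ i ∈ s', i ∈ s ∨ i = a) (hs : s ⊆ s') (ha : a ∈ s') :
    Function.LeftInverse (glue (X := X) h) (unglue hs ha) := by
  intro q
  funext i
  obtain ⟨i, his⟩ := i
  unfold glue unglue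
  by_cases hi : i ∈ s
  · simp only [hi, dite_true]
  · simp only [hi, dite_false]
    obtain rfl := (h i his).resolve_left hi
    rfl

end Glue

/-! ### The Markov structure of the trajectory law. -/

section JointLaw

instance (k : ℕ) : StandardBorelSpace (Vec k) := inferInstance

lemma map_compProd_compProd {α β γ : Type*} [MeasurableSpace α] [MeasurableSpace β]
    [MeasurableSpace γ] (μ : Measure α) [SFinite μ] (κ : Kernel α β) (η : Kernel (α × β) γ)
    [IsMarkovKernel κ] [IsMarkovKernel η] :
    (μ ⊗ₘ (κ ⊗ₖ η)).map (fun p => ((p.1, p.2.1), p.2.2)) = (μ ⊗ₘ κ) ⊗ₘ η := by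
  refine Measure.ext_of_lintegral _ fun f hf => ?_
  rw [lintegral_map hf (by fun_prop), Measure.lintegral_compProd (by fun_prop),
    Measure.lintegral_compProd hf, Measure.lintegral_compProd hf.lintegral_kernel_prod_right']
  refine lintegral_congr fun x => ?_
  rw [Kernel.lintegral_compProd _ _ _ (by fun_prop)]

lemma fst_compProd_measure {α β : Type*} [MeasurableSpace α] [MeasurableSpace β] (μ : Measure α)
    [SFinite μ] (κ : Kernel α β) [IsMarkovKernel κ] : (μ ⊗ₘ κ).map Prod.fst = μ :=
  Measure.fst_compProd μ κ

variable (S : Source) {m : ℕ → ℕ} (γ : Policy S.n m) (t : ℕ)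

/-- The trajectory up to time `t`. -/
abbrev hist (n m : ℕ → ℕ) (t : ℕ) : SrcTraj n m → Π i : Finset.Iic t, Stage n m i :=
  Preorder.frestrictLe t

variable {n : ℕ → ℕ}

@[fun_prop]
lemma measurable_hist : Measurable (hist n m t) := Preorder.measurable_frestrictLe t

@[fun_prop]
lemma measurable_xAt : Measurable (xAt n m t) := by unfold xAt; fun_prop

@[fun_prop]
lemma measurable_outAt : Measurable (outAt n m t) := by unfold outAt; fun_prop

@[fun_prop]
lemma measurable_xHist : Measurable (xHist n m t) := by unfold xHist; fun_prop

@[fun_prop]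
lemma measurable_outHist : Measurable (outHist n m t) := by unfold outHist; fun_prop

/-- The last state in a source history. -/
def lastX (n : ℕ → ℕ) (t : ℕ) (h : Π i : Finset.Iic t, Vec (n i)) : Vec (n t) :=
  h ⟨t, Finset.mem_Iic.2 le_rfl⟩

@[fun_prop]
lemma measurable_lastX : Measurable (lastX n t) := by unfold lastX; fun_prop

/-- The recursion defining the trajectory measure, with the step split into the source transition
and the output kernel. The conditional laws used below are images of it. -/
lemma map_hist_stage : (jointLaw S γ).map (fun ω => ((hist S.n m t ω, xAt S.n m (t + 1) ω),
      outAt S.n m (t + 1) ω)) =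
    ((jointLaw S γ).map (hist S.n m t) ⊗ₘ
      (gaussChannel (S.A t) (S.W t)).comap (lastState S.n m t) (measurable_lastState S.n m t)) ⊗ₘ
      (γ.kernel t).comap (policyInput S.n m t) (measurable_policyInput S.n m t) := by
  have := Measure.isProbabilityMeasure_map (μ := jointLaw S γ)
    (measurable_hist (n := S.n) (m := m) t).aemeasurable
  rw [← map_compProd_compProd]
  have h := Kernel.map_frestrictLe_trajMeasure_compProd_eq_map_trajMeasure (X := Stage S.n m)
    (μ₀ := (multivariateGaussian (0 : Vec (S.n 0)) S.P0).prod (Measure.dirac (0 : Vec (m 0))))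
    (κ := stepKernel S γ) (a := t)
  change (jointLaw S γ).map (hist S.n m t) ⊗ₘ stepKernel S γ t =
    (jointLaw S γ).map (fun x => (hist S.n m t x, x (t + 1))) at h
  rw [stepKernel] at h
  rw [h, Measure.map_map (by fun_prop) (by fun_prop)]
  rfl

lemma map_hist_xAt : (jointLaw S γ).map (fun ω => (hist S.n m t ω, xAt S.n m (t + 1) ω)) =
    (jointLaw S γ).map (hist S.n m t) ⊗ₘ
      (gaussChannel (S.A t) (S.W t)).comap (lastState S.n m t) (measurable_lastState S.n m t) := by
  have := Measure.isProbabilityMeasure_map (μ := jointLaw S γ)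
    (measurable_hist (n := S.n) (m := m) t).aemeasurable
  have h := congrArg (Measure.map Prod.fst) (map_hist_stage S γ t)
  rw [fst_compProd_measure, Measure.map_map (by fun_prop) (by fun_prop)] at h
  exact h

variable {δ : Type*} [MeasurableSpace δ]

/-- The law of the next state given a statistic of the history that determines the state. -/
lemma map_next_state {g : (Π i : Finset.Iic t, Stage S.n m i) → δ} (hg : Measurable g)
    {f : δ → Vec (S.n t)} (hf : Measurable f) (hfg : ∀ h, f (g h) = lastState S.n m t h) :
    (jointLaw S γ).map (fun ω => (g (hist S.n m t ω), xAt S.n m (t + 1) ω)) =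
      (jointLaw S γ).map (fun ω => g (hist S.n m t ω)) ⊗ₘ
        (gaussChannel (S.A t) (S.W t)).comap f hf := by
  have := Measure.isProbabilityMeasure_map (μ := jointLaw S γ)
    (measurable_hist (n := S.n) (m := m) t).aemeasurable
  have e : (fun ω => g (hist S.n m t ω)) = g ∘ hist S.n m t := rfl
  rw [e, ← Measure.map_map hg (by fun_prop), ← map_compProd_comap _ hg]
  have e2 : ((gaussChannel (S.A t) (S.W t)).comap f hf).comap g hg =
      (gaussChannel (S.A t) (S.W t)).comap (lastState S.n m t) (measurable_lastState S.n m t) := by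
    ext1 h
    simp only [Kernel.comap_apply, hfg]
  rw [e2, ← map_hist_xAt, Measure.map_map (by fun_prop) (by fun_prop)]
  rfl

lemma map_policyInput_outAt :
    (jointLaw S γ).map (fun ω => ((xHist S.n m t ω, xAt S.n m (t + 1) ω, outHist S.n m t ω),
        outAt S.n m (t + 1) ω)) =
      (jointLaw S γ).map (fun ω => (xHist S.n m t ω, xAt S.n m (t + 1) ω, outHist S.n m t ω)) ⊗ₘ
        γ.kernel t := by
  have h := map_hist_stage S γ t
  rw [← map_hist_xAt] at h
  have := Measure.isProbabilityMeasure_map (μ := jointLaw S γ)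
    ((measurable_hist (n := S.n) (m := m) t).prodMk (measurable_xAt (t + 1))).aemeasurable
  have h2 := congrArg (Measure.map (fun p => (policyInput S.n m t p.1, p.2))) h
  have hm : Measurable fun p : ((Π i : Finset.Iic t, Stage S.n m i) × Vec (S.n (t + 1))) ×
      Vec (m (t + 1)) => (policyInput S.n m t p.1, p.2) :=
    ((measurable_policyInput S.n m t).comp measurable_fst).prodMk measurable_snd
  have hm' : Measurable fun ω : SrcTraj S.n m =>
      ((hist S.n m t ω, xAt S.n m (t + 1) ω), outAt S.n m (t + 1) ω) := by fun_prop
  have e1 := Measure.map_map (μ := jointLaw S γ) hm hm'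
  have e2 := Measure.map_map (μ := jointLaw S γ) (measurable_policyInput S.n m t)
    ((measurable_hist (n := S.n) (m := m) t).prodMk (measurable_xAt (t + 1)))
  rw [map_compProd_comap _ (measurable_policyInput S.n m t), e2] at h2
  exact e1.symm.trans h2

/-- The law of the next output given a statistic that determines the input of the policy. -/
lemma map_next_out {ε : Type*} [MeasurableSpace ε] {κ : Kernel ε (Vec (m (t + 1)))}
    [IsMarkovKernel κ]
    {g : (Π i : Finset.Iic t, Vec (S.n i)) × Vec (S.n (t + 1)) × (Π i : Finset.Icc 1 t, Vec (m i))
      → δ} (hg : Measurable g) {f : δ → ε} (hf : Measurable f)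
    (hfg : ∀ p, γ.kernel t p = κ (f (g p))) :
    (jointLaw S γ).map (fun ω => (g (xHist S.n m t ω, xAt S.n m (t + 1) ω, outHist S.n m t ω),
        outAt S.n m (t + 1) ω)) =
      (jointLaw S γ).map (fun ω => g (xHist S.n m t ω, xAt S.n m (t + 1) ω, outHist S.n m t ω)) ⊗ₘ
        κ.comap f hf := by
  have hmeas : Measurable fun ω : SrcTraj S.n m =>
      (xHist S.n m t ω, xAt S.n m (t + 1) ω, outHist S.n m t ω) := by fun_prop
  have := Measure.isProbabilityMeasure_map (μ := jointLaw S γ) hmeas.aemeasurable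
  have e : (fun ω => g (xHist S.n m t ω, xAt S.n m (t + 1) ω, outHist S.n m t ω)) =
    g ∘ fun ω => (xHist S.n m t ω, xAt S.n m (t + 1) ω, outHist S.n m t ω) := rfl
  rw [e, ← Measure.map_map hg hmeas, ← map_compProd_comap _ hg]
  have e2 : (κ.comap f hf).comap g hg = γ.kernel t := by
    ext1 h
    simp only [Kernel.comap_apply, hfg]
  rw [e2, ← map_policyInput_outAt, Measure.map_map (by fun_prop) (by fun_prop)]
  rfl

/-! ### Directed information as mutual information -/

/-- The mutual information of the source history and the output history. -/
def histInfo (S : Source) {m : ℕ → ℕ} (γ : Policy S.n m) (t : ℕ) : ℝ≥0∞ :=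
  klDiv ((jointLaw S γ).map fun ω => (xHist S.n m t ω, outHist S.n m t ω))
    (((jointLaw S γ).map (xHist S.n m t)).prod ((jointLaw S γ).map (outHist S.n m t)))

lemma iic_succ (i : ℕ) (hi : i ∈ Finset.Iic (t + 1)) : i ∈ Finset.Iic t ∨ i = t + 1 := by
  simp only [Finset.mem_Iic] at *; omega

lemma icc_succ (i : ℕ) (hi : i ∈ Finset.Icc 1 (t + 1)) : i ∈ Finset.Icc 1 t ∨ i = t + 1 := by
  simp only [Finset.mem_Icc] at *; omega

lemma iic_subset : Finset.Iic t ⊆ Finset.Iic (t + 1) := Finset.Iic_subset_Iic.2 (Nat.le_succ t)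

lemma icc_subset : Finset.Icc 1 t ⊆ Finset.Icc 1 (t + 1) :=
  Finset.Icc_subset_Icc_right (Nat.le_succ t)

/-- Appends a state to a source history. -/
def snocX (n : ℕ → ℕ) (t : ℕ) (p : (Π i : Finset.Iic t, Vec (n i)) × Vec (n (t + 1))) :
    Π i : Finset.Iic (t + 1), Vec (n i) :=
  glue (X := fun i => Vec (n i)) (iic_succ t) p

/-- Appends an output to an output history. -/
def snocY (m : ℕ → ℕ) (t : ℕ) (p : (Π i : Finset.Icc 1 t, Vec (m i)) × Vec (m (t + 1))) :
    Π i : Finset.Icc 1 (t + 1), Vec (m i) :=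
  glue (X := fun i => Vec (m i)) (icc_succ t) p

@[fun_prop]
lemma measurable_snocX : Measurable (snocX n t) :=
  measurable_glue (X := fun i => Vec (n i)) (iic_succ t)

@[fun_prop]
lemma measurable_snocY : Measurable (snocY m t) :=
  measurable_glue (X := fun i => Vec (m i)) (icc_succ t)

lemma snocX_xHist (ω : SrcTraj n m) :
    snocX n t (xHist n m t ω, xAt n m (t + 1) ω) = xHist n m (t + 1) ω :=
  glue_unglue (X := fun i => Vec (n i)) (iic_succ t) (iic_subset t)
    (Finset.mem_Iic.2 le_rfl) (xHist n m (t + 1) ω)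

lemma snocY_outHist (ω : SrcTraj n m) :
    snocY m t (outHist n m t ω, outAt n m (t + 1) ω) = outHist n m (t + 1) ω :=
  glue_unglue (X := fun i => Vec (m i)) (icc_succ t) (icc_subset t)
    (Finset.mem_Icc.2 ⟨by omega, le_rfl⟩) (outHist n m (t + 1) ω)

lemma lastX_snocX (p : (Π i : Finset.Iic t, Vec (n i)) × Vec (n (t + 1))) :
    lastX n (t + 1) (snocX n t p) = p.2 := by
  simp [lastX, snocX, glue]

/-- This is the absence of feedback. Given source and outputs up to `t`, the next state is drawn
from a kernel seeing only `x_t`; the same kernel `G` extends both the joint law and the product of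
the marginals, and appending a common kernel leaves the divergence unchanged. -/
lemma klDiv_xHist_succ :
    klDiv ((jointLaw S γ).map fun ω => (xHist S.n m (t + 1) ω, outHist S.n m t ω))
      (((jointLaw S γ).map (xHist S.n m (t + 1))).prod ((jointLaw S γ).map (outHist S.n m t))) =
    histInfo S γ t := by
  have hx := Measure.isProbabilityMeasure_map (μ := jointLaw S γ)
    (measurable_xHist (n := S.n) (m := m) t).aemeasurable
  have hx' := Measure.isProbabilityMeasure_map (μ := jointLaw S γ)
    (measurable_xHist (n := S.n) (m := m) (t + 1)).aemeasurable
  have hy := Measure.isProbabilityMeasure_map (μ := jointLaw S γ)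
    (measurable_outHist (n := S.n) (m := m) t).aemeasurable
  have hxy := Measure.isProbabilityMeasure_map (μ := jointLaw S γ)
    ((measurable_xHist (n := S.n) (m := m) t).prodMk (measurable_outHist t)).aemeasurable
  have hxy' := Measure.isProbabilityMeasure_map (μ := jointLaw S γ)
    ((measurable_xHist (n := S.n) (m := m) (t + 1)).prodMk (measurable_outHist t)).aemeasurable
  let G : Kernel ((Π i : Finset.Iic t, Vec (S.n i)) × (Π i : Finset.Icc 1 t, Vec (m i)))
      (Vec (S.n (t + 1))) := (gaussChannel (S.A t) (S.W t)).comap (fun p => lastX S.n t p.1)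
        (by fun_prop)
  let un := unglue (X := fun i => Vec (S.n i)) (a := t + 1) (iic_subset t)
    (Finset.mem_Iic.2 le_rfl)
  have hun : Measurable un := measurable_unglue _ _
  have h1 : (jointLaw S γ).map (fun ω => ((xHist S.n m t ω, outHist S.n m t ω),
      xAt S.n m (t + 1) ω)) =
      (jointLaw S γ).map (fun ω => (xHist S.n m t ω, outHist S.n m t ω)) ⊗ₘ G :=
    map_next_state S γ t (g := fun h => ((fun i => (h i).1 : Π i : Finset.Iic t, Vec (S.n i)),
      (fun i => (h ⟨i.1, Finset.mem_Iic.2 (Finset.mem_Icc.1 i.2).2⟩).2 :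
        Π i : Finset.Icc 1 t, Vec (m i)))) (by fun_prop) (by fun_prop) (fun _ => rfl)
  have h2 : (jointLaw S γ).map (fun ω => (xHist S.n m t ω, xAt S.n m (t + 1) ω)) =
      (jointLaw S γ).map (xHist S.n m t) ⊗ₘ
        (gaussChannel (S.A t) (S.W t)).comap (lastX S.n t) (by fun_prop) :=
    map_next_state S γ t (g := fun h => (fun i => (h i).1 : Π i : Finset.Iic t, Vec (S.n i)))
      (by fun_prop) (by fun_prop) (fun _ => rfl)
  have h3 : ((jointLaw S γ).map (xHist S.n m (t + 1))).map un =
      (jointLaw S γ).map (fun ω => (xHist S.n m t ω, xAt S.n m (t + 1) ω)) := by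
    rw [Measure.map_map hun (by fun_prop)]
    rfl
  rw [histInfo, ← klDiv_compProd_left _ _ G, ← h1, ← klDiv_map_eq_of_leftInverse _ _
    (g := fun p => (((un p.1).1, p.2), (un p.1).2))
    (h := fun p => (glue (X := fun i => Vec (S.n i)) (iic_succ t) (p.1.1, p.2), p.1.2))
    (by fun_prop) (((measurable_glue (X := fun i => Vec (S.n i)) (iic_succ t)).comp
      (by fun_prop : Measurable fun p : ((Π i : Finset.Iic t, Vec (S.n i)) ×
        (Π i : Finset.Icc 1 t, Vec (m i))) × Vec (S.n (t + 1)) => (p.1.1, p.2))).prodMk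
        (by fun_prop))
    (fun p => Prod.ext (glue_unglue (X := fun i => Vec (S.n i)) (iic_succ t) (iic_subset t)
      (Finset.mem_Iic.2 le_rfl) p.1) rfl)]
  congr 1
  · rw [Measure.map_map (by fun_prop) (by fun_prop)]
    rfl
  · have e : (fun p : (Π i : Finset.Iic (t + 1), Vec (S.n i)) × (Π i : Finset.Icc 1 t, Vec (m i)) =>
        (((un p.1).1, p.2), (un p.1).2)) =
        (fun q => ((q.1.1, q.2), q.1.2)) ∘ (Prod.map un id) := rfl
    rw [e, ← Measure.map_map (by fun_prop) (hun.prodMap measurable_id),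
      ← Measure.map_prod_map _ _ hun measurable_id, h3, h2, Measure.map_id]
    refine Measure.ext_of_lintegral _ fun f hf => ?_
    rw [lintegral_map hf (by fun_prop), Measure.lintegral_compProd hf, lintegral_prod_symm _
      (by fun_prop), lintegral_prod_symm _ hf.lintegral_kernel_prod_right'.aemeasurable]
    refine lintegral_congr fun y => ?_
    rw [Measure.lintegral_compProd (by fun_prop)]
    rfl

/-- The source history is first extended at no cost, then the chain rule adds the new output. -/
lemma histInfo_succ : histInfo S γ (t + 1) = histInfo S γ t +
    condMutualInfo (jointLaw S γ) (xHist S.n m (t + 1)) (outAt S.n m (t + 1))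
      (outHist S.n m t) := by
  have hx' := Measure.isProbabilityMeasure_map (μ := jointLaw S γ)
    (measurable_xHist (n := S.n) (m := m) (t + 1)).aemeasurable
  have hy := Measure.isProbabilityMeasure_map (μ := jointLaw S γ)
    (measurable_outHist (n := S.n) (m := m) (t + 1)).aemeasurable
  have hxy' := Measure.isProbabilityMeasure_map (μ := jointLaw S γ)
    ((measurable_xHist (n := S.n) (m := m) (t + 1)).prodMk
      (measurable_outHist (t + 1))).aemeasurable
  let un := unglue (X := fun i => Vec (m i)) (a := t + 1) (icc_subset t)
    (Finset.mem_Icc.2 ⟨by omega, le_rfl⟩)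
  have hun : Measurable un := measurable_unglue _ _
  rw [← klDiv_xHist_succ S γ t, ← klDiv_prod_eq_add_condMutualInfo (by fun_prop) (by fun_prop)
    (by fun_prop), histInfo, ← klDiv_map_eq_of_leftInverse _ _ (g := Prod.map id un)
    (h := Prod.map id (glue (X := fun i => Vec (m i)) (icc_succ t)))
    (measurable_id.prodMap hun) (measurable_id.prodMap (measurable_glue _))
    (fun p => Prod.ext rfl (glue_unglue (X := fun i => Vec (m i)) (icc_succ t) (icc_subset t)
      (Finset.mem_Icc.2 ⟨by omega, le_rfl⟩) p.2)), ← Measure.map_prod_map _ _ measurable_id hun,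
    Measure.map_id, Measure.map_map hun (by fun_prop), Measure.map_map
    (measurable_id.prodMap hun) (by fun_prop)]
  rfl

lemma histInfo_zero : histInfo S γ 0 = 0 := by
  have hx := Measure.isProbabilityMeasure_map (μ := jointLaw S γ)
    (measurable_xHist (n := S.n) (m := m) 0).aemeasurable
  have : IsEmpty (Finset.Icc 1 0) := ⟨fun i => by simpa using i.2⟩
  have h1 : (jointLaw S γ).map (outHist S.n m 0) = Measure.dirac (fun i => isEmptyElim i) := by
    have : outHist S.n m 0 = fun _ => (fun i => isEmptyElim i) := by
      funext ω i
      exact isEmptyElim i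
    rw [this, Measure.map_const, measure_univ, one_smul]
  have h2 : ((jointLaw S γ).map fun ω => (xHist S.n m 0 ω, outHist S.n m 0 ω)) =
      ((jointLaw S γ).map (xHist S.n m 0)).prod ((jointLaw S γ).map (outHist S.n m 0)) := by
    rw [h1, Measure.prod_dirac, Measure.map_map (by fun_prop) (by fun_prop)]
    congr 1
    funext ω
    refine Prod.ext rfl (funext fun i => isEmptyElim i)
  rw [histInfo, h2]
  exact klDiv_self _

lemma sum_condMutualInfo_eq_histInfo (T : ℕ) : ∑ t ∈ Finset.Icc 1 T,
    condMutualInfo (jointLaw S γ) (xHist S.n m t) (outAt S.n m t) (outHist S.n m (t - 1)) =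
      histInfo S γ T := by
  induction T with
  | zero => simp [histInfo_zero]
  | succ T ih =>
    rw [Finset.sum_Icc_succ_top (by omega), ih, histInfo_succ, Nat.add_sub_cancel]

lemma srdCost_eq_histInfo (T : ℕ) (γ : Policy S.n S.n) : srdCost S T γ = histInfo S γ T :=
  sum_condMutualInfo_eq_histInfo S γ T

variable (s : Sensor S.n)

lemma Sensor.map_outAt {g : (Π i : Finset.Iic t, Vec (S.n i)) × Vec (S.n (t + 1)) ×
      (Π i : Finset.Icc 1 t, Vec (s.r i)) → δ} (hg : Measurable g)
    {f : δ → Vec (S.n (t + 1))} (hf : Measurable f) (hfg : ∀ p, f (g p) = p.2.1) :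
    (sensorLaw S s).map (fun ω => (g (xHist S.n s.r t ω, xAt S.n s.r (t + 1) ω,
        outHist S.n s.r t ω), outAt S.n s.r (t + 1) ω)) =
      (sensorLaw S s).map (fun ω => g (xHist S.n s.r t ω, xAt S.n s.r (t + 1) ω,
        outHist S.n s.r t ω)) ⊗ₘ (gaussChannel (s.C (t + 1)) (s.V (t + 1))).comap f hf :=
  map_next_out S s.policy t hg hf fun p => by rw [hfg]; rfl

lemma Sensor.map_xAt_outAt :
    (sensorLaw S s).map (fun ω => ((xAt S.n s.r (t + 1) ω, outHist S.n s.r t ω),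
        outAt S.n s.r (t + 1) ω)) =
      (sensorLaw S s).map (fun ω => (xAt S.n s.r (t + 1) ω, outHist S.n s.r t ω)) ⊗ₘ
        (gaussChannel (s.C (t + 1)) (s.V (t + 1))).comap (fun p => id p.1)
          (measurable_id.comp measurable_fst) :=
  s.map_outAt S t (g := fun p => p.2) (by fun_prop) (by fun_prop) (fun _ => rfl)

/-- The sensors are memoryless: whether the new output is compared with the full source history or
with the current state alone, the information is the same integral of divergences from the sensor
channel. -/
lemma lgsCost_eq_histInfo (T : ℕ) : lgsCost S T s = histInfo S s.policy T := by
  rw [← sum_condMutualInfo_eq_histInfo]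
  refine Finset.sum_congr rfl fun t ht => ?_
  obtain ⟨t, rfl⟩ : ∃ u, t = u + 1 := ⟨t - 1, by have := (Finset.mem_Icc.1 ht).1; omega⟩
  rw [Nat.add_sub_cancel]
  have h1 : (sensorLaw S s).map (fun ω => ((xHist S.n s.r (t + 1) ω, outHist S.n s.r t ω),
        outAt S.n s.r (t + 1) ω)) =
      (sensorLaw S s).map (fun ω => (xHist S.n s.r (t + 1) ω, outHist S.n s.r t ω)) ⊗ₘ
        (gaussChannel (s.C (t + 1)) (s.V (t + 1))).comap (fun p => lastX S.n (t + 1) p.1)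
          ((measurable_lastX (t + 1)).comp measurable_fst) := by
    have := s.map_outAt S t (g := fun p => (snocX S.n t (p.1, p.2.1), p.2.2)) (by fun_prop)
      (f := fun p => lastX S.n (t + 1) p.1) (by fun_prop) (fun p => lastX_snocX t _)
    simpa only [snocX_xHist] using this
  rw [condMutualInfo_eq_lintegral (f := id) measurable_id (by fun_prop) (by fun_prop)
    (by fun_prop) (s.map_xAt_outAt S t), condMutualInfo_eq_lintegral (measurable_lastX (t + 1))
    (by fun_prop) (by fun_prop) (by fun_prop) h1]
  rfl

end JointLaw

/-! ### Moments of linear images and additive Gaussian noise -/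

section Noise

variable {Ω α : Type*} [MeasurableSpace Ω] [MeasurableSpace α] {μ : Measure Ω} {a b k l : ℕ}

/-- The matrix of mixed second moments of two random vectors. -/
def crossMoment (μ : Measure Ω) (e : Ω → Vec k) (f : Ω → Vec l) : Matrix (Fin k) (Fin l) ℝ :=
  Matrix.of fun i j => ∫ ω, e ω i * f ω j ∂μ

lemma crossMoment_transpose (e : Ω → Vec k) (f : Ω → Vec l) :
    (crossMoment μ e f)ᵀ = crossMoment μ f e := by
  ext i j
  simp [crossMoment, mul_comm]

lemma crossMoment_add_left {e e' : Ω → Vec k} {f : Ω → Vec l} (he : MemLp e 2 μ)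
    (he' : MemLp e' 2 μ) (hf : MemLp f 2 μ) :
    crossMoment μ (fun ω => e ω + e' ω) f = crossMoment μ e f + crossMoment μ e' f := by
  ext i j
  simp only [crossMoment, of_apply, Matrix.add_apply, PiLp.add_apply, add_mul]
  exact integral_add (integrable_coord_mul he hf i j) (integrable_coord_mul he' hf i j)

lemma crossMoment_mulVecE_left {e : Ω → Vec k} {f : Ω → Vec l} (he : MemLp e 2 μ)
    (hf : MemLp f 2 μ) (B : Matrix (Fin a) (Fin k) ℝ) :
    crossMoment μ (fun ω => mulVecE B (e ω)) f = B * crossMoment μ e f := by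
  ext i j
  simp only [crossMoment, of_apply, mul_apply, mulVecE_apply,
    Finset.sum_mul, mul_assoc]
  refine (integral_finsetSum _ fun r _ => (integrable_coord_mul he hf r j).const_mul _).trans ?_
  exact Finset.sum_congr rfl fun r _ => integral_const_mul _ _

lemma MemLp.mulVecE {e : Ω → Vec k} (he : MemLp e 2 μ) (B : Matrix (Fin a) (Fin k) ℝ) :
    MemLp (fun ω => mulVecE B (e ω)) 2 μ :=
  (mulVecL B).comp_memLp' he

lemma secondMoment_add_of_crossMoment_eq_zero {e : Ω → Vec k} {f : Ω → Vec l} (he : MemLp e 2 μ)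
    (hf : MemLp f 2 μ) (h : crossMoment μ e f = 0) (B : Matrix (Fin a) (Fin k) ℝ)
    (N : Matrix (Fin a) (Fin l) ℝ) :
    secondMoment μ (fun ω => mulVecE B (e ω) + mulVecE N (f ω)) =
      B * secondMoment μ e * Bᵀ + N * secondMoment μ f * Nᵀ := by
  have hB := MemLp.mulVecE he B
  have hN := MemLp.mulVecE hf N
  have h' : crossMoment μ f e = 0 := by rw [← crossMoment_transpose, h, transpose_zero]
  have hBN : MemLp (fun ω => mulVecE B (e ω) + mulVecE N (f ω)) 2 μ := hB.add hN
  have e1 : ∀ {c : ℕ} {u : Ω → Vec c}, MemLp u 2 μ →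
      crossMoment μ u (fun ω => mulVecE B (e ω) + mulVecE N (f ω)) =
        crossMoment μ u e * Bᵀ + crossMoment μ u f * Nᵀ := by
    intro c u hu
    rw [← crossMoment_transpose, crossMoment_add_left hB hN hu, crossMoment_mulVecE_left he hu,
      crossMoment_mulVecE_left hf hu, transpose_add, transpose_mul, transpose_mul,
      crossMoment_transpose, crossMoment_transpose]
  change crossMoment μ _ _ = B * crossMoment μ e e * Bᵀ + N * crossMoment μ f f * Nᵀ
  rw [crossMoment_add_left hB hN hBN, crossMoment_mulVecE_left he hBN,
    crossMoment_mulVecE_left hf hBN]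
  have e2 := e1 he
  have e3 := e1 hf
  rw [h, Matrix.zero_mul, add_zero] at e2
  rw [h', Matrix.zero_mul, zero_add] at e3
  change B * crossMoment μ e (fun ω => mulVecE B (e ω) + mulVecE N (f ω)) +
    N * crossMoment μ f (fun ω => mulVecE B (e ω) + mulVecE N (f ω)) = _
  rw [e2, e3, Matrix.mul_assoc, Matrix.mul_assoc]

lemma secondMoment_mulVecE {e : Ω → Vec k} (he : MemLp e 2 μ) (B : Matrix (Fin a) (Fin k) ℝ) :
    secondMoment μ (fun ω => mulVecE B (e ω)) = B * secondMoment μ e * Bᵀ := by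
  change crossMoment μ _ _ = B * crossMoment μ e e * Bᵀ
  rw [crossMoment_mulVecE_left he (MemLp.mulVecE he B), ← crossMoment_transpose,
    crossMoment_mulVecE_left he he, transpose_mul, crossMoment_transpose, Matrix.mul_assoc]

variable [IsProbabilityMeasure μ] {H : Ω → α} {Y : Ω → Vec l} {f : α → Vec k}
  {M : Matrix (Fin l) (Fin k) ℝ} {V : Matrix (Fin l) (Fin l) ℝ}

/-- The noise of a Gaussian channel is independent of the past. -/
lemma map_noise (hH : Measurable H) (hY : Measurable Y) (hf : Measurable f)
    (h : μ.map (fun ω => (H ω, Y ω)) = μ.map H ⊗ₘ (gaussChannel M V).comap f hf) :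
    μ.map (fun ω => (H ω, Y ω - mulVecE M (f (H ω)))) =
      (μ.map H).prod (multivariateGaussian 0 V) := by
  have := Measure.isProbabilityMeasure_map (μ := μ) hH.aemeasurable
  have hg : Measurable fun p : α × Vec l => (p.1, p.2 - mulVecE M (f p.1)) := by fun_prop
  have e : (fun ω => (H ω, Y ω - mulVecE M (f (H ω)))) =
    (fun p : α × Vec l => (p.1, p.2 - mulVecE M (f p.1))) ∘ fun ω => (H ω, Y ω) := rfl
  rw [e, ← Measure.map_map hg (by fun_prop), h]
  refine Measure.ext_of_lintegral _ fun F hF => ?_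
  rw [lintegral_map hF hg, Measure.lintegral_compProd (by fun_prop),
    lintegral_prod _ hF.aemeasurable]
  refine lintegral_congr fun x => ?_
  have e2 := map_const_add_multivariateGaussian (mulVecE M (f x)) 0 V
  rw [add_zero] at e2
  rw [Kernel.comap_apply, gaussChannel_apply, ← e2, lintegral_map (by fun_prop) (by fun_prop)]
  simp only [add_sub_cancel_left]

lemma memLp_noise (hH : Measurable H) (hY : Measurable Y) (hf : Measurable f)
    (h : μ.map (fun ω => (H ω, Y ω)) = μ.map H ⊗ₘ (gaussChannel M V).comap f hf) :
    MemLp (fun ω => Y ω - mulVecE M (f (H ω))) 2 μ := by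
  have := Measure.isProbabilityMeasure_map (μ := μ) hH.aemeasurable
  have h1 := congrArg (Measure.map Prod.snd) (map_noise hH hY hf h)
  rw [Measure.map_map (by fun_prop) (by fun_prop), Measure.map_snd_prod, measure_univ,
    one_smul] at h1
  have h2 := memLp_id_multivariateGaussian (0 : Vec l) V
  rw [← h1, memLp_map_measure_iff (by fun_prop) (by fun_prop)] at h2
  exact h2

lemma secondMoment_add_noise (hH : Measurable H) (hY : Measurable Y) (hf : Measurable f)
    (h : μ.map (fun ω => (H ω, Y ω)) = μ.map H ⊗ₘ (gaussChannel M V).comap f hf)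
    (hV : V.PosSemidef) {g : α → Vec b} (hg : Measurable g) (he : MemLp (fun ω => g (H ω)) 2 μ)
    (B : Matrix (Fin a) (Fin b) ℝ) (N : Matrix (Fin a) (Fin l) ℝ) :
    secondMoment μ (fun ω => mulVecE B (g (H ω)) + mulVecE N (Y ω - mulVecE M (f (H ω)))) =
      B * secondMoment μ (fun ω => g (H ω)) * Bᵀ + N * V * Nᵀ := by
  have := Measure.isProbabilityMeasure_map (μ := μ) hH.aemeasurable
  have h0 := map_noise hH hY hf h
  have hs : secondMoment μ (fun ω => Y ω - mulVecE M (f (H ω))) = V := by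
    have h1 := congrArg (Measure.map Prod.snd) h0
    rw [Measure.map_map (by fun_prop) (by fun_prop), Measure.map_snd_prod, measure_univ,
      one_smul] at h1
    have h2 := secondMoment_multivariateGaussian (0 : Vec l) 0 hV
    simp only [sub_zero] at h2
    simp only [WithLp.ofLp_zero, vecMulVec_zero, add_zero] at h2
    rw [← h2, ← h1]
    ext i j
    simp only [secondMoment, of_apply]
    rw [integral_map (by fun_prop) (by fun_prop)]
    rfl
  -- The noise is independent of `H` and centred, so the mixed moments factor and vanish.
  have hc : crossMoment μ (fun ω => g (H ω)) (fun ω => Y ω - mulVecE M (f (H ω))) = 0 := by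
    ext i j
    have e1 : ∫ ω, g (H ω) i * (Y ω - mulVecE M (f (H ω))) j ∂μ =
        ∫ p, g p.1 i * p.2 j ∂(μ.map (fun ω => (H ω, Y ω - mulVecE M (f (H ω))))) := by
      rw [integral_map (by fun_prop) (by fun_prop)]
    rw [crossMoment, of_apply, e1, h0, integral_prod_mul (fun x => g x i) (fun v : Vec l => v j),
      integral_coord_multivariateGaussian]
    simp
  rw [secondMoment_add_of_crossMoment_eq_zero he (memLp_noise hH hY hf h) hc, hs]

end Noise

/-! ### Estimation errors -/

section Errors

lemma map_trajMeasure_zero {X : ℕ → Type*} [∀ n, MeasurableSpace (X n)] (μ₀ : Measure (X 0))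
    [IsProbabilityMeasure μ₀] (κ : (n : ℕ) → Kernel (Π i : Finset.Iic n, X i) (X (n + 1)))
    [∀ n, IsMarkovKernel (κ n)] : (Kernel.trajMeasure μ₀ κ).map (fun x => x 0) = μ₀ := by
  let p : (Π i : Finset.Iic 0, X i) → X 0 := fun h => h ⟨0, Finset.mem_Iic.2 le_rfl⟩
  have hp : Measurable p := measurable_pi_apply _
  have e : (fun x : (n : ℕ) → X n => x 0) = p ∘ Preorder.frestrictLe 0 := rfl
  rw [e, ← Measure.map_map hp (by fun_prop), Kernel.trajMeasure,
    Measure.map_comp _ _ (by fun_prop), Kernel.traj_map_frestrictLe, Kernel.partialTraj_self,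
    Measure.id_comp]
  exact (Measure.map_map hp (MeasurableEquiv.measurable _)).trans Measure.map_id

variable (S : Source) {m : ℕ → ℕ} (γ : Policy S.n m) (t : ℕ)

lemma map_xAt_zero : (jointLaw S γ).map (xAt S.n m 0) = multivariateGaussian 0 S.P0 := by
  have h : (jointLaw S γ).map (fun ω => ω 0) =
    (multivariateGaussian (0 : Vec (S.n 0)) S.P0).prod (Measure.dirac (0 : Vec (m 0))) :=
    map_trajMeasure_zero _ _
  have h2 := congrArg (Measure.map Prod.fst) h
  rw [Measure.map_map (by fun_prop) (by fun_prop), Measure.map_fst_prod, measure_univ,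
    one_smul] at h2
  exact h2

lemma secondMoment_xAt_zero (hP0 : S.P0.PosSemidef) :
    secondMoment (jointLaw S γ) (fun ω => xAt S.n m 0 ω) = S.P0 := by
  have h := secondMoment_multivariateGaussian (0 : Vec (S.n 0)) 0 hP0
  simp only [sub_zero, WithLp.ofLp_zero, vecMulVec_zero, add_zero] at h
  rw [← h, ← map_xAt_zero S γ]
  ext i j
  simp only [secondMoment, of_apply]
  rw [integral_map (by fun_prop) (by fun_prop)]

lemma memLp_xAt : MemLp (xAt S.n m t) 2 (jointLaw S γ) := by
  induction t with
  | zero =>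
    have h := memLp_id_multivariateGaussian (0 : Vec (S.n 0)) S.P0
    rw [← map_xAt_zero S γ, memLp_map_measure_iff (by fun_prop) (by fun_prop)] at h
    exact h
  | succ t ih =>
    have h := memLp_noise (by fun_prop) (by fun_prop) (measurable_lastState _ _ _)
      (map_hist_xAt S γ t)
    have h2 := (MemLp.mulVecE ih (S.A t)).add h
    refine h2.ae_eq (ae_of_all _ fun ω => ?_)
    exact add_sub_cancel (mulVecE (S.A t) (xAt S.n m t ω)) (xAt S.n m (t + 1) ω)

variable {t}

lemma memLp_prediction_error {g : (Π i : Finset.Icc 1 t, Vec (m i)) → Vec (S.n t)}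
    (he : MemLp (fun ω => xAt S.n m t ω - g (outHist S.n m t ω)) 2 (jointLaw S γ)) :
    MemLp (fun ω => xAt S.n m (t + 1) ω - mulVecE (S.A t) (g (outHist S.n m t ω))) 2
      (jointLaw S γ) := by
  have h := memLp_noise (by fun_prop) (by fun_prop) (measurable_lastState _ _ _)
      (map_hist_xAt S γ t)
  refine ((MemLp.mulVecE he (S.A t)).add h).ae_eq (ae_of_all _ fun ω => ?_)
  change mulVecE (S.A t) (xAt S.n m t ω - g (outHist S.n m t ω)) +
    (xAt S.n m (t + 1) ω - mulVecE (S.A t) (xAt S.n m t ω)) = _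
  rw [mulVecE_sub]
  exact sub_add_sub_cancel' _ _ _

/-- The prediction error is `A_t` times the current error plus the source noise, which is
independent of the history. No optimality of `g` is needed. -/
lemma secondMoment_prediction_error (hW : (S.W t).PosSemidef)
    {g : (Π i : Finset.Icc 1 t, Vec (m i)) → Vec (S.n t)} (hg : Measurable g)
    (he : MemLp (fun ω => xAt S.n m t ω - g (outHist S.n m t ω)) 2 (jointLaw S γ)) :
    secondMoment (jointLaw S γ)
        (fun ω => xAt S.n m (t + 1) ω - mulVecE (S.A t) (g (outHist S.n m t ω))) =
      predCov (S.A t) (S.W t) (secondMoment (jointLaw S γ)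
        fun ω => xAt S.n m t ω - g (outHist S.n m t ω)) := by
  have h := secondMoment_add_noise (by fun_prop) (by fun_prop) (measurable_lastState _ _ _)
    (map_hist_xAt S γ t) hW (g := fun h => lastState S.n m t h - g (fun i =>
      (h ⟨i.1, Finset.mem_Iic.2 (Finset.mem_Icc.1 i.2).2⟩).2)) (by
        have := measurable_lastState S.n m t
        fun_prop) he (S.A t) 1
  rw [one_mul, transpose_one, mul_one] at h
  refine Eq.trans ?_ h
  congr 1
  funext ω
  change _ = mulVecE (S.A t) (xAt S.n m t ω - g (outHist S.n m t ω)) +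
    mulVecE 1 (xAt S.n m (t + 1) ω - mulVecE (S.A t) (xAt S.n m t ω))
  rw [mulVecE_sub, one_mulVecE]
  exact (sub_add_sub_cancel' _ _ _).symm

end Errors

/-! ### The lower bound for estimators with nonsingular error -/

section LowerBound

variable (S : Source) {m : ℕ → ℕ} (γ : Policy S.n m) (T : ℕ)
  (E : (t : ℕ) → Matrix (Fin (S.n t)) (Fin (S.n t)) ℝ)

/-- The log-likelihood ratio of the states at the times `1, …, t` between the Gaussian laws with
means `c t` and covariances `E t` and the one-step predictions made from them. -/
def cumLLR (c x : (t : ℕ) → Vec (S.n t)) (t : ℕ) : ℝ :=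
  ∑ s ∈ Finset.range t, gaussLLR (c (s + 1)) (E (s + 1)) (mulVecE (S.A s) (c s)) (predAt S E s)
    (x (s + 1))

variable {S E T}

lemma cumLLR_congr {c c' x x' : (t : ℕ) → Vec (S.n t)} {t : ℕ} (hc : ∀ s ≤ t, c s = c' s)
    (hx : ∀ s ≤ t, x s = x' s) :
    cumLLR S E c x t = cumLLR S E c' x' t := by
  refine Finset.sum_congr rfl fun s hs => ?_
  have := Finset.mem_range.1 hs
  rw [hx (s + 1) (by omega), hc (s + 1) (by omega), hc s (by omega)]

lemma measurable_cumLLR {α : Type*} [MeasurableSpace α] {c x : α → (t : ℕ) → Vec (S.n t)}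
    (hc : ∀ t, Measurable fun a => c a t) (hx : ∀ t, Measurable fun a => x a t) (t : ℕ) :
    Measurable fun a => cumLLR S E (c a) (x a) t := by
  unfold cumLLR gaussLLR
  refine Finset.measurable_sum _ fun s _ => ?_
  have h1 := hc (s + 1)
  have h2 := hc s
  have h3 := hx (s + 1)
  fun_prop

/-- For fixed centres `c`, the weight `exp (cumLLR)` tilts the source so that `x_t` has law `N(c_t,
E_t)`. The test function `f` carries the induction: the Gaussian at time `t` is pushed through the
source channel, and the new likelihood ratio turns the prediction into the Gaussian at time `t + 1`.
The choices `c 0 = 0` and `E 0 = P0` match the initial law. -/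
lemma lintegral_exp_cumLLR (h0 : E 0 = S.P0)
    (hW : ∀ t, t < T → (S.W t).PosDef) (hE : ∀ t, t ≤ T → (E t).PosDef)
    {c : (t : ℕ) → Vec (S.n t)} (hc : c 0 = 0) (t : ℕ) (ht : t ≤ T) {f : Vec (S.n t) → ℝ≥0∞}
    (hf : Measurable f) :
    ∫⁻ ω, ENNReal.ofReal (Real.exp (cumLLR S E c (fun s => xAt S.n m s ω) t)) * f (xAt S.n m t ω)
      ∂(jointLaw S γ) = ∫⁻ x, f x ∂(multivariateGaussian (c t) (E t)) := by
  induction t with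
  | zero =>
    simp only [cumLLR, Finset.range_zero, Finset.sum_empty, Real.exp_zero, ENNReal.ofReal_one,
      one_mul]
    rw [hc, h0, ← map_xAt_zero S γ, lintegral_map hf (by fun_prop)]
  | succ t ih =>
    -- The states as functions of the history alone; the default `0` after time `t` is never read by
    -- `cumLLR` up to `t`.
    let x' : (Π i : Finset.Iic t, Stage S.n m i) → (s : ℕ) → Vec (S.n s) :=
      fun h s => if hs : s ≤ t then (h ⟨s, Finset.mem_Iic.2 hs⟩).1 else 0
    have hx' : ∀ s, Measurable fun h => x' h s := by
      intro s
      by_cases hs : s ≤ t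
      · simp only [x', hs, dite_true]; fun_prop
      · simp only [x', hs, dite_false]; fun_prop
    have hxx : ∀ ω, ∀ s ≤ t, xAt S.n m s ω = x' (hist S.n m t ω) s := by
      intro ω s hs
      simp only [x', hs, dite_true]
      rfl
    let F : Vec (S.n (t + 1)) → ℝ≥0∞ := fun x => ENNReal.ofReal (Real.exp (gaussLLR (c (t + 1))
      (E (t + 1)) (mulVecE (S.A t) (c t)) (predAt S E t) x)) * f x
    have hF : Measurable F := by fun_prop
    let G : (Π i : Finset.Iic t, Stage S.n m i) → ℝ≥0∞ := fun h =>
      ENNReal.ofReal (Real.exp (cumLLR S E c (x' h) t))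
    have hG : Measurable G := (Real.measurable_exp.comp
      (measurable_cumLLR (fun _ => measurable_const) hx' t)).ennreal_ofReal
    have hcum : ∀ ω, ENNReal.ofReal (Real.exp (cumLLR S E c (fun s => xAt S.n m s ω) t)) =
        G (hist S.n m t ω) := fun ω => by
      simp only [G]
      rw [cumLLR_congr (fun _ _ => rfl) (hxx ω)]
    have e1 : ∀ ω, ENNReal.ofReal (Real.exp (cumLLR S E c (fun s => xAt S.n m s ω) (t + 1))) *
        f (xAt S.n m (t + 1) ω) = G (hist S.n m t ω) * F (xAt S.n m (t + 1) ω) := by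
      intro ω
      rw [← hcum, cumLLR, Finset.sum_range_succ, Real.exp_add,
        ENNReal.ofReal_mul (Real.exp_nonneg _), mul_assoc]
      rfl
    have hps : (S.W t).PosDef := hW t (by omega)
    simp only [e1]
    have := Measure.isProbabilityMeasure_map (μ := jointLaw S γ)
      (measurable_hist (n := S.n) (m := m) t).aemeasurable
    have hGF : Measurable fun p : (Π i : Finset.Iic t, Stage S.n m i) × Vec (S.n (t + 1)) =>
      G p.1 * F p.2 := by fun_prop
    have e2 := lintegral_map (μ := jointLaw S γ) hGF
      ((measurable_hist (n := S.n) (m := m) t).prodMk (measurable_xAt (t + 1)))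
    rw [← e2, map_hist_xAt, Measure.lintegral_compProd hGF]
    have e3 : ∀ h : Π i : Finset.Iic t, Stage S.n m i,
        ∫⁻ x, G h * F x ∂((gaussChannel (S.A t) (S.W t)).comap (lastState S.n m t)
          (measurable_lastState S.n m t) h) =
        G h * ∫⁻ x, F x ∂(gaussChannel (S.A t) (S.W t) (lastState S.n m t h)) := fun h =>
      lintegral_const_mul _ hF
    have hl := measurable_lastState S.n m t
    have hK : Measurable fun x => ∫⁻ y, F y ∂(gaussChannel (S.A t) (S.W t) x) :=
      hF.lintegral_kernel
    simp only [e3]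
    have hGK : Measurable fun h => G h *
        ∫⁻ y, F y ∂(gaussChannel (S.A t) (S.W t) (lastState S.n m t h)) := hG.mul (hK.comp hl)
    rw [lintegral_map hGK (by fun_prop)]
    simp only [← hcum]
    refine (ih (by omega) hK).trans ?_
    rw [gaussChannel_comp_multivariateGaussian _ _ (hE t (by omega)).posSemidef hps.posSemidef hF,
      ← multivariateGaussian_withDensity (c (t + 1)) (hE (t + 1) ht) (mulVecE (S.A t) (c t))
        (predCov_posDef (hE t (by omega)).posSemidef hps : (predAt S E t).PosDef),
      lintegral_withDensity_eq_lintegral_mul _ (by fun_prop) hf]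
    rfl

/-- Donsker-Varadhan with `cumLLR` centred at the estimates as test function. Each quadratic form is
weighted by the inverse of its own second moment, so its mean is the dimension; the two cancel at
every time and only the log-determinants of `rateOf` remain. -/
lemma ofReal_rateOf_le_histInfo_of_posDef (h0 : E 0 = S.P0)
    (hW : ∀ t, t < T → (S.W t).PosDef) (hE : ∀ t, t ≤ T → (E t).PosDef)
    {G : (t : ℕ) → (Π i : Finset.Icc 1 T, Vec (m i)) → Vec (S.n t)} (hG : ∀ t, Measurable (G t))
    (hG0 : ∀ y, G 0 y = 0)
    (hL : ∀ t < T, MemLp (fun ω => xAt S.n m (t + 1) ω - G (t + 1) (outHist S.n m T ω)) 2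
      (jointLaw S γ))
    (hEL : ∀ t < T, secondMoment (jointLaw S γ)
      (fun ω => xAt S.n m (t + 1) ω - G (t + 1) (outHist S.n m T ω)) = E (t + 1))
    (hM : ∀ t < T, MemLp (fun ω => xAt S.n m (t + 1) ω -
      mulVecE (S.A t) (G t (outHist S.n m T ω))) 2 (jointLaw S γ))
    (hEM : ∀ t < T, secondMoment (jointLaw S γ) (fun ω => xAt S.n m (t + 1) ω -
      mulVecE (S.A t) (G t (outHist S.n m T ω))) = predAt S E t) :
    ENNReal.ofReal (rateOf S T E) ≤ histInfo S γ T := by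
  have hx := Measure.isProbabilityMeasure_map (μ := jointLaw S γ)
    (measurable_xHist (n := S.n) (m := m) T).aemeasurable
  have hy := Measure.isProbabilityMeasure_map (μ := jointLaw S γ)
    (measurable_outHist (n := S.n) (m := m) T).aemeasurable
  have hxy := Measure.isProbabilityMeasure_map (μ := jointLaw S γ)
    ((measurable_xHist (n := S.n) (m := m) T).prodMk (measurable_outHist T)).aemeasurable
  let x' : (Π i : Finset.Iic T, Vec (S.n i)) → (s : ℕ) → Vec (S.n s) :=
    fun h s => if hs : s ≤ T then h ⟨s, Finset.mem_Iic.2 hs⟩ else 0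
  have hx' : ∀ s, Measurable fun h => x' h s := by
    intro s
    by_cases hs : s ≤ T
    · simp only [x', hs, dite_true]; fun_prop
    · simp only [x', hs, dite_false]; fun_prop
  have hxx : ∀ ω, ∀ s ≤ T, xAt S.n m s ω = x' (xHist S.n m T ω) s := by
    intro ω s hs
    simp only [x', hs, dite_true]
    rfl
  let g : (Π i : Finset.Iic T, Vec (S.n i)) × (Π i : Finset.Icc 1 T, Vec (m i)) → ℝ :=
    fun p => cumLLR S E (fun t => G t p.2) (x' p.1) T
  have hg : Measurable g := measurable_cumLLR (fun t => (hG t).comp measurable_snd)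
    (fun t => (hx' t).comp measurable_fst) T
  have hgω : ∀ ω, g (xHist S.n m T ω, outHist S.n m T ω) =
      cumLLR S E (fun t => G t (outHist S.n m T ω)) (fun t => xAt S.n m t ω) T := fun ω =>
    (cumLLR_congr (fun _ _ => rfl) (hxx ω)).symm
  have hpd : ∀ t < T, (predAt S E t).PosDef := fun t ht =>
    predCov_posDef (hE t ht.le).posSemidef (hW t ht)
  have hi : ∀ t < T, Integrable (fun ω => gaussLLR (G (t + 1) (outHist S.n m T ω)) (E (t + 1))
      (mulVecE (S.A t) (G t (outHist S.n m T ω))) (predAt S E t) (xAt S.n m (t + 1) ω))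
      (jointLaw S γ) := fun t ht =>
    (((integrable_const _).add (integrable_wnormSq (hM t ht) _)).sub
      (integrable_wnormSq (hL t ht) _)).const_mul _
  have hval : ∀ t < T, ∫ ω, gaussLLR (G (t + 1) (outHist S.n m T ω)) (E (t + 1))
      (mulVecE (S.A t) (G t (outHist S.n m T ω))) (predAt S E t) (xAt S.n m (t + 1) ω)
      ∂(jointLaw S γ) = 1 / 2 * (Real.log (predAt S E t).det - Real.log (E (t + 1)).det) := by
    intro t ht
    simp only [gaussLLR]
    have hc : Integrable (fun ω => Real.log (predAt S E t).det - Real.log (E (t + 1)).det +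
        wnormSq (predAt S E t)⁻¹ (xAt S.n m (t + 1) ω -
          mulVecE (S.A t) (G t (outHist S.n m T ω)))) (jointLaw S γ) :=
      (integrable_const _).add (integrable_wnormSq (hM t ht) _)
    rw [integral_const_mul, integral_sub hc
      (integrable_wnormSq (hL t ht) _), integral_add (integrable_const _)
      (integrable_wnormSq (hM t ht) _), integral_wnormSq (hM t ht), integral_wnormSq (hL t ht),
      hEM t ht, hEL t ht, nonsing_inv_mul _ (isUnit_det_of_posDef (hpd t ht)),
      nonsing_inv_mul _ (isUnit_det_of_posDef (hE (t + 1) ht))]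
    simp
  have hsum : (fun ω => g (xHist S.n m T ω, outHist S.n m T ω)) = fun ω =>
      ∑ t ∈ Finset.range T, gaussLLR (G (t + 1) (outHist S.n m T ω)) (E (t + 1))
      (mulVecE (S.A t) (G t (outHist S.n m T ω))) (predAt S E t) (xAt S.n m (t + 1) ω) := by
    funext ω
    rw [hgω, cumLLR]
  have hxym : Measurable fun ω => (xHist S.n m T ω, outHist S.n m T ω) := by fun_prop
  have hgi : Integrable g ((jointLaw S γ).map fun ω => (xHist S.n m T ω, outHist S.n m T ω)) := by
    rw [integrable_map_measure hg.aestronglyMeasurable hxym.aemeasurable]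
    change Integrable (fun ω => g (xHist S.n m T ω, outHist S.n m T ω)) _
    rw [hsum]
    exact integrable_finsetSum _ fun t ht => hi t (Finset.mem_range.1 ht)
  have hint : ∫ p, g p ∂((jointLaw S γ).map fun ω => (xHist S.n m T ω, outHist S.n m T ω)) =
      rateOf S T E := by
    rw [integral_map hxym.aemeasurable hg.aestronglyMeasurable, hsum, integral_finsetSum _
      fun t ht => hi t (Finset.mem_range.1 ht)]
    exact Finset.sum_congr rfl fun t ht => hval t (Finset.mem_range.1 ht)
  rw [← hint]
  refine ofReal_integral_le_klDiv hg hgi ?_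
  rw [lintegral_prod_symm _ (by fun_prop)]
  -- Under the product measure the source is independent of the outputs, so the centres may be
  -- frozen at each `y`, where the tilted law has total mass one.
  have h1 : ∀ y, ∫⁻ x, ENNReal.ofReal (Real.exp (g (x, y))) ∂((jointLaw S γ).map (xHist S.n m T)) =
      1 := by
    intro y
    rw [lintegral_map (by fun_prop) (by fun_prop)]
    have h := lintegral_exp_cumLLR γ h0 hW hE (c := fun t => G t y) (hG0 y) T le_rfl
      (f := fun _ => 1) measurable_const
    rw [lintegral_one, measure_univ] at h
    rw [← h]
    refine lintegral_congr fun ω => ?_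
    rw [mul_one]
    simp only [g]
    rw [cumLLR_congr (fun _ _ => rfl) (hxx ω)]
  simp only [h1]
  simp

end LowerBound

/-! ### Mean square optimality of the conditional expectation -/

section MMSE

variable {Ω : Type*} {m' mΩ : MeasurableSpace Ω} {μ : Measure Ω} [IsProbabilityMeasure μ] {k : ℕ}

/-- Pythagoras: the residual of the conditional expectation is orthogonal to the square integrable
`m'`-measurable functions. -/
lemma integral_sub_condExp_sq_le (hm : m' ≤ mΩ) {X Y : Ω → ℝ} (hX : MemLp X 2 μ)
    (hY : MemLp Y 2 μ) (hYm : StronglyMeasurable[m'] Y) :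
    ∫ ω, (X ω - (μ[X|m']) ω) ^ 2 ∂μ ≤ ∫ ω, (X ω - Y ω) ^ 2 ∂μ := by
  have hZ : MemLp (μ[X|m']) 2 μ := hX.condExp one_le_two
  have hXZ : MemLp (X - μ[X|m']) 2 μ := hX.sub hZ
  have hZY : MemLp (μ[X|m'] - Y) 2 μ := hZ.sub hY
  have hi : Integrable ((X - μ[X|m']) * (μ[X|m'] - Y)) μ := hXZ.integrable_mul hZY
  have hX1 : Integrable X μ := hX.integrable one_le_two
  have hc : ∫ ω, ((X - μ[X|m']) * (μ[X|m'] - Y)) ω ∂μ = 0 := by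
    rw [← integral_condExp hm]
    have h1 := condExp_mul_of_stronglyMeasurable_right (m := m')
      (stronglyMeasurable_condExp.sub hYm) hi (hXZ.integrable one_le_two)
    have h2 : μ[X - μ[X|m']|m'] =ᵐ[μ] 0 := by
      refine (condExp_sub hX1 integrable_condExp m').trans ?_
      rw [condExp_of_stronglyMeasurable hm stronglyMeasurable_condExp integrable_condExp, sub_self]
    rw [integral_congr_ae h1]
    refine (integral_congr_ae (h2.mono fun ω hω => ?_)).trans (integral_zero _ _)
    simp [hω]
  have e : ∀ ω, (X ω - Y ω) ^ 2 = (X ω - (μ[X|m']) ω) ^ 2 +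
      2 * ((X - μ[X|m']) * (μ[X|m'] - Y)) ω + ((μ[X|m'] - Y) ω) ^ 2 := by
    intro ω
    simp only [Pi.mul_apply, Pi.sub_apply]
    ring
  have h1 : Integrable (fun ω => (X ω - (μ[X|m']) ω) ^ 2) μ := hXZ.integrable_sq
  have h12 : Integrable (fun ω => (X ω - (μ[X|m']) ω) ^ 2 +
      2 * ((X - μ[X|m']) * (μ[X|m'] - Y)) ω) μ := h1.add (hi.const_mul 2)
  simp only [e]
  rw [integral_add h12 hZY.integrable_sq, integral_add h1 (hi.const_mul 2), integral_const_mul, hc]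
  have : 0 ≤ ∫ ω, ((μ[X|m'] - Y) ω) ^ 2 ∂μ := integral_nonneg fun ω => sq_nonneg _
  linarith

lemma wnormSq_transpose_mul_self (B : Matrix (Fin k) (Fin k) ℝ) (v : Vec k) :
    wnormSq (Bᵀ * B) v = ∑ i, (mulVecE B v i) ^ 2 := by
  rw [wnormSq, ← mulVec_mulVec, dotProduct_mulVec, vecMul_transpose]
  simp [dotProduct, mulVecE, sq]

/-- For singular `Θ`, finite distortion does not make `Y` square integrable. With `Θ = Bᵀ B`,
however, each coordinate of `B (X - Y)` is, and the scalar inequality is applied to these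
coordinates one at a time. -/
lemma trace_mul_secondMoment_sub_condExp_le (hm : m' ≤ mΩ) {X Y : Ω → Vec k} (hX : MemLp X 2 μ)
    (hYm : StronglyMeasurable[m'] Y) {Θ : Matrix (Fin k) (Fin k) ℝ} (hΘ : Θ.PosSemidef)
    (hXY : Integrable (fun ω => wnormSq Θ (X ω - Y ω)) μ) :
    (Θ * secondMoment μ (fun ω => X ω - (μ[X|m']) ω)).trace ≤
      ∫ ω, wnormSq Θ (X ω - Y ω) ∂μ := by
  obtain ⟨B, rfl⟩ := PosSemidef.exists_eq_transpose_mul_self hΘ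
  have hZ : MemLp (μ[X|m']) 2 μ := hX.condExp one_le_two
  have hX1 : Integrable X μ := hX.integrable one_le_two
  have hXZ : MemLp (fun ω => X ω - (μ[X|m']) ω) 2 μ := hX.sub hZ
  rw [← integral_wnormSq hXZ]
  simp only [wnormSq_transpose_mul_self] at hXY ⊢
  have hYμ : AEStronglyMeasurable Y μ := (hYm.mono hm).aestronglyMeasurable
  have hsq : ∀ i, Integrable (fun ω => (mulVecE B (X ω - Y ω) i) ^ 2) μ := by
    intro i
    refine hXY.mono ?_ (ae_of_all _ fun ω => ?_)
    · have h1 := ((EuclideanSpace.proj (𝕜 := ℝ) i : Vec k →L[ℝ] ℝ) ∘L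
        mulVecL B).continuous.comp_aestronglyMeasurable (hX.1.sub hYμ)
      exact h1.pow 2
    · rw [Real.norm_of_nonneg (sq_nonneg _), Real.norm_of_nonneg
        (Finset.sum_nonneg fun _ _ => sq_nonneg _)]
      exact Finset.single_le_sum (f := fun i => (mulVecE B (X ω - Y ω) i) ^ 2)
        (fun _ _ => sq_nonneg _) (Finset.mem_univ i)
  have hsqZ : ∀ i, Integrable (fun ω => (mulVecE B (X ω - (μ[X|m']) ω) i) ^ 2) μ := fun i =>
    (memLp_coord (MemLp.mulVecE hXZ B) i).integrable_sq
  rw [integral_finsetSum _ fun i _ => hsq i]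
  refine (integral_finsetSum _ fun i _ => hsqZ i).trans_le (Finset.sum_le_sum fun i _ => ?_)
  let L : Vec k →L[ℝ] ℝ := (EuclideanSpace.proj (𝕜 := ℝ) i : Vec k →L[ℝ] ℝ) ∘L mulVecL B
  have hLX : MemLp (fun ω => L (X ω)) 2 μ := L.comp_memLp' hX
  have hLXY : MemLp (fun ω => L (X ω) - L (Y ω)) 2 μ := by
    refine (memLp_two_iff_integrable_sq
      (hLX.1.sub (L.continuous.comp_aestronglyMeasurable hYμ))).2 ?_
    refine (hsq i).congr (ae_of_all _ fun ω => ?_)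
    change (L (X ω - Y ω)) ^ 2 = (L (X ω) - L (Y ω)) ^ 2
    rw [map_sub]
  have hLY : MemLp (fun ω => L (Y ω)) 2 μ :=
    (hLX.sub hLXY).ae_eq (ae_of_all _ fun ω => sub_sub_cancel _ _)
  have hmain := integral_sub_condExp_sq_le hm hLX hLY (L.continuous.comp_stronglyMeasurable hYm)
  have hcomm := L.comp_condExp_comm (m := m') hX1
  refine le_of_eq_of_le (integral_congr_ae (hcomm.mono fun ω hω => ?_)) (hmain.trans_eq
    (integral_congr_ae (ae_of_all _ fun ω => ?_)))
  · change (L (X ω - (μ[X|m']) ω)) ^ 2 = (L (X ω) - (μ[L ∘ X|m']) ω) ^ 2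
    rw [map_sub, ← hω]
    rfl
  · change (L (X ω) - L (Y ω)) ^ 2 = (L (X ω - Y ω)) ^ 2
    rw [map_sub]

end MMSE

/-! ### Singular estimation errors -/

section Singular

/-- The Gaussian has a Lebesgue density, and proper affine subspaces are Lebesgue null. -/
lemma multivariateGaussian_hyperplane {k : ℕ} (a : Vec k) {V : Matrix (Fin k) (Fin k) ℝ}
    (hV : V.PosDef) {u : Fin k → ℝ} (hu : u ≠ 0) (c : ℝ) :
    multivariateGaussian a V {x : Vec k | u ⬝ᵥ x.ofLp = c} = 0 := by
  rw [multivariateGaussian_eq_withDensity a hV]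
  refine withDensity_absolutelyContinuous _ _ ?_
  let A : AffineSubspace ℝ (Vec k) :=
    { carrier := {x : Vec k | u ⬝ᵥ x.ofLp = c}
      smul_vsub_vadd_mem' := by
        intro r x y z hx hy hz
        simp only [Set.mem_ofPred_eq] at *
        simp [dotProduct_add, dotProduct_sub, hx, hy, hz] }
  refine Measure.addHaar_affineSubspace volume A fun h => hu ?_
  have h1 : ∀ x : Vec k, u ⬝ᵥ x.ofLp = c := fun x => by
    have : x ∈ A := h ▸ AffineSubspace.mem_top ℝ _ x
    exact this
  have h2 := h1 0
  have h3 := h1 (WithLp.toLp 2 u)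
  simp only [WithLp.ofLp_zero, dotProduct_zero] at h2
  rw [← h2] at h3
  exact dotProduct_self_eq_zero.1 h3

variable (S : Source) {m : ℕ → ℕ} (γ : Policy S.n m) {t T : ℕ}

lemma measure_xAt_hyperplane (hW : (S.W t).PosDef) {u : Fin (S.n (t + 1)) → ℝ} (hu : u ≠ 0)
    (c : ℝ) : jointLaw S γ {ω | u ⬝ᵥ (xAt S.n m (t + 1) ω).ofLp = c} = 0 := by
  have := Measure.isProbabilityMeasure_map (μ := jointLaw S γ)
    (measurable_hist (n := S.n) (m := m) t).aemeasurable
  have hs : MeasurableSet {x : Vec (S.n (t + 1)) | u ⬝ᵥ x.ofLp = c} := by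
    have : Measurable fun x : Vec (S.n (t + 1)) => u ⬝ᵥ x.ofLp := by
      unfold dotProduct; fun_prop
    exact this (measurableSet_singleton c)
  have h := congrArg (fun ν => ν (Prod.snd ⁻¹' {x : Vec (S.n (t + 1)) | u ⬝ᵥ x.ofLp = c}))
    (map_hist_xAt S γ t)
  simp only at h
  rw [Measure.map_apply (by fun_prop) (measurable_snd hs),
    Measure.compProd_apply (measurable_snd hs)] at h
  refine h.trans ?_
  rw [lintegral_eq_zero_of_ae_eq_zero]
  refine ae_of_all _ fun x => ?_
  change gaussChannel (S.A t) (S.W t) (lastState S.n m t x) _ = 0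
  rw [gaussChannel_apply]
  exact multivariateGaussian_hyperplane _ hW hu c

/-- The set `A` on which the outputs predict `u · x_{t+1}` exactly has full measure under the joint
law. Under the product of the marginals it is null, since each section at fixed outputs is a
hyperplane condition on `x_{t+1}`. Absolute continuity therefore fails. -/
lemma histInfo_eq_top_of_ae_eq (hW : (S.W t).PosDef) (ht : t < T) {u : Fin (S.n (t + 1)) → ℝ}
    (hu : u ≠ 0) {g : (Π i : Finset.Icc 1 T, Vec (m i)) → Vec (S.n (t + 1))} (hg : Measurable g)
    (h : ∀ᵐ ω ∂(jointLaw S γ),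
      u ⬝ᵥ (xAt S.n m (t + 1) ω - g (outHist S.n m T ω)).ofLp = 0) : histInfo S γ T = ⊤ := by
  have hx := Measure.isProbabilityMeasure_map (μ := jointLaw S γ)
    (measurable_xHist (n := S.n) (m := m) T).aemeasurable
  have hy := Measure.isProbabilityMeasure_map (μ := jointLaw S γ)
    (measurable_outHist (n := S.n) (m := m) T).aemeasurable
  refine klDiv_of_not_ac fun hac => ?_
  let i : Finset.Iic T := ⟨t + 1, Finset.mem_Iic.2 ht⟩
  let A : Set ((Π i : Finset.Iic T, Vec (S.n i)) × (Π i : Finset.Icc 1 T, Vec (m i))) :=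
    {p | u ⬝ᵥ (p.1 i).ofLp = u ⬝ᵥ (g p.2).ofLp}
  have hA : MeasurableSet A := by
    refine measurableSet_eq_fun ?_ ?_
    · unfold dotProduct; fun_prop
    · unfold dotProduct; fun_prop
  have h0 : (((jointLaw S γ).map (xHist S.n m T)).prod ((jointLaw S γ).map (outHist S.n m T))) A =
      0 := by
    rw [Measure.prod_apply_symm hA]
    refine lintegral_eq_zero_of_ae_eq_zero (ae_of_all _ fun y => ?_)
    change (jointLaw S γ).map (xHist S.n m T) _ = 0
    rw [Measure.map_apply (by fun_prop) (measurable_prodMk_right hA)]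
    exact measure_xAt_hyperplane S γ hW hu (u ⬝ᵥ (g y).ofLp)
  have h1 := hac h0
  rw [Measure.map_apply (by fun_prop) hA] at h1
  have hF : ∀ᵐ ω ∂(jointLaw S γ), False := by
    filter_upwards [h, measure_eq_zero_iff_ae_notMem.1 h1] with ω hω hω'
    refine hω' ?_
    rw [WithLp.ofLp_sub, dotProduct_sub, sub_eq_zero] at hω
    exact hω
  exact hF.exists.choose_spec

end Singular

/-! ### The lower bound -/

section MMSELowerBound

variable (S : Source) {m : ℕ → ℕ} (γ : Policy S.n m)

/-- The least mean square error estimate of the state from the outputs. -/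
def outEstimate (t : ℕ) : SrcTraj S.n m → Vec (S.n t) :=
  condExp (MeasurableSpace.comap (outHist S.n m t) inferInstance) (jointLaw S γ) (xAt S.n m t)

lemma comap_outHist_le (n m : ℕ → ℕ) (t : ℕ) :
    MeasurableSpace.comap (outHist n m t) inferInstance ≤
      (inferInstance : MeasurableSpace (SrcTraj n m)) :=
  (measurable_outHist t).comap_le

lemma exists_outEstimate_eq (t : ℕ) : ∃ g : (Π i : Finset.Icc 1 t, Vec (m i)) → Vec (S.n t),
    Measurable g ∧ outEstimate S γ t = g ∘ outHist S.n m t := by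
  have h : StronglyMeasurable[MeasurableSpace.comap (outHist S.n m t) inferInstance]
    (outEstimate S γ t) := stronglyMeasurable_condExp
  obtain ⟨g, hg, hge⟩ := h.exists_eq_measurable_comp
  exact ⟨g, hg.measurable, hge⟩

lemma memLp_sub_outEstimate (t : ℕ) :
    MemLp (fun ω => xAt S.n m t ω - outEstimate S γ t ω) 2 (jointLaw S γ) :=
  (memLp_xAt S γ t).sub ((memLp_xAt S γ t).condExp one_le_two)

lemma trace_mul_secondMoment_sub_outEstimate_le {t : ℕ} {Y : SrcTraj S.n m → Vec (S.n t)}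
    (hY : Measurable[MeasurableSpace.comap (outHist S.n m t) inferInstance] Y)
    {Θ : Matrix (Fin (S.n t)) (Fin (S.n t)) ℝ} (hΘ : Θ.PosSemidef)
    (hXY : Integrable (fun ω => wnormSq Θ (xAt S.n m t ω - Y ω)) (jointLaw S γ)) :
    (Θ * secondMoment (jointLaw S γ) (fun ω => xAt S.n m t ω - outEstimate S γ t ω)).trace ≤
      ∫ ω, wnormSq Θ (xAt S.n m t ω - Y ω) ∂(jointLaw S γ) :=
  trace_mul_secondMoment_sub_condExp_le (comap_outHist_le S.n m t) (memLp_xAt S γ t)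
    hY.stronglyMeasurable hΘ hXY

lemma wnormSq_vecMulVec_self {k : ℕ} (u : Fin k → ℝ) (v : Vec k) :
    wnormSq (vecMulVec u u) v = (u ⬝ᵥ v.ofLp) ^ 2 := by
  rw [wnormSq, vecMulVec_mulVec, dotProduct_smul, dotProduct_comm v.ofLp u]
  simp [sq]

lemma dotProduct_mulVec_eq_trace {k : ℕ} (M : Matrix (Fin k) (Fin k) ℝ) (u : Fin k → ℝ) :
    u ⬝ᵥ (M *ᵥ u) = (vecMulVec u u * M).trace := by
  rw [vecMulVec_mul, trace_vecMulVec, dotProduct_mulVec, dotProduct_comm]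

/-- The prediction `A_t g` is one of the estimators of `x_{t+1}` from the outputs up to `t + 1`, so
the conditional mean beats it for every weight. The rank-one weights `u uᵀ` yield the matrix order.
-/
lemma posSemidef_predAt_sub {t : ℕ} (hW : (S.W t).PosSemidef)
    {g : (Π i : Finset.Icc 1 t, Vec (m i)) → Vec (S.n t)} (hg : Measurable g)
    (he : MemLp (fun ω => xAt S.n m t ω - g (outHist S.n m t ω)) 2 (jointLaw S γ)) :
    (predCov (S.A t) (S.W t) (secondMoment (jointLaw S γ)
        fun ω => xAt S.n m t ω - g (outHist S.n m t ω)) -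
      secondMoment (jointLaw S γ)
        (fun ω => xAt S.n m (t + 1) ω - outEstimate S γ (t + 1) ω)).PosSemidef := by
  have hM := memLp_prediction_error S γ he
  have hE := memLp_sub_outEstimate S γ (t + 1)
  rw [← secondMoment_prediction_error S γ hW hg he]
  refine PosSemidef.of_dotProduct_mulVec_nonneg ?_ fun u => ?_
  · exact (secondMoment_posSemidef hM).1.sub (secondMoment_posSemidef hE).1
  rw [star_trivial, sub_mulVec, dotProduct_sub, sub_nonneg, dotProduct_mulVec_eq_trace,
    dotProduct_mulVec_eq_trace, ← integral_wnormSq hM]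
  have hu : (vecMulVec u u).PosSemidef := by
    simpa using posSemidef_vecMulVec_self_star u
  refine trace_mul_secondMoment_sub_outEstimate_le S γ ?_ hu (integrable_wnormSq hM _)
  have hr : Measurable fun y : Π i : Finset.Icc 1 (t + 1), Vec (m i) =>
      mulVecE (S.A t) (g fun i => y ⟨i.1, icc_subset t i.2⟩) := by fun_prop
  exact hr.comp (comap_measurable (outHist S.n m (t + 1)))

variable {S} {T : ℕ} {Θ : (t : ℕ) → Matrix (Fin (S.n t)) (Fin (S.n t)) ℝ} {D : ℕ → ℝ}
  {P Q : (t : ℕ) → Matrix (Fin (S.n t)) (Fin (S.n t)) ℝ}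

/-- The common converse. The estimators `Y` are arbitrary functions of the outputs, so that it
covers both the reproductions of (P-SRD), which are the outputs themselves, and the sensor estimates
of (P-LGS). -/
lemma ofReal_maxDetObj_le_histInfo (hT : 1 ≤ T) (hP0 : S.P0.PosDef)
    (hW : ∀ t, t < T → (S.W t).PosDef) (hΘ : ∀ t, 1 ≤ t → t ≤ T → (Θ t).PosSemidef)
    (hopt : MaxDetOptimal S T Θ D P Q)
    {Y : (t : ℕ) → SrcTraj S.n m → Vec (S.n t)}
    (hY : ∀ t, 1 ≤ t → t ≤ T →
      Measurable[MeasurableSpace.comap (outHist S.n m t) inferInstance] (Y t))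
    (hD : ∀ t, 1 ≤ t → t ≤ T →
      Integrable (fun ω => wnormSq (Θ t) (xAt S.n m t ω - Y t ω)) (jointLaw S γ) ∧
      ∫ ω, wnormSq (Θ t) (xAt S.n m t ω - Y t ω) ∂(jointLaw S γ) ≤ D t) :
    ENNReal.ofReal (maxDetObj S T Q) ≤ histInfo S γ T := by
  -- At time `0` the estimator is set to zero: the tilting argument needs the initial centre to be
  -- exactly the mean of `x_0` for every output sequence, not just almost surely.
  have hex : ∀ t, ∃ g : (Π i : Finset.Icc 1 t, Vec (m i)) → Vec (S.n t), Measurable g ∧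
      (t = 0 → ∀ y, g y = 0) ∧ (1 ≤ t → outEstimate S γ t = g ∘ outHist S.n m t) := by
    intro t
    rcases Nat.eq_zero_or_pos t with rfl | ht
    · exact ⟨fun _ => 0, measurable_const, fun _ _ => rfl, fun h => by omega⟩
    · obtain ⟨g, hg, hge⟩ := exists_outEstimate_eq S γ t
      exact ⟨g, hg, fun h => by omega, fun _ => hge⟩
  choose g hg hg0 hge using hex
  let G : (t : ℕ) → (Π i : Finset.Icc 1 T, Vec (m i)) → Vec (S.n t) := fun t y =>
    if h : t ≤ T then g t fun i => y ⟨i.1, Finset.Icc_subset_Icc_right h i.2⟩ else 0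
  have hG : ∀ t, Measurable (G t) := by
    intro t
    by_cases h : t ≤ T
    · simp only [G, h, dite_true]
      have := hg t
      fun_prop
    · simp only [G, h, dite_false]
      fun_prop
  have hGg : ∀ t ≤ T, ∀ ω, G t (outHist S.n m T ω) = g t (outHist S.n m t ω) := by
    intro t ht ω
    simp only [G, ht, dite_true]
    rfl
  have hGe : ∀ t, 1 ≤ t → ∀ ω, g t (outHist S.n m t ω) = outEstimate S γ t ω := by
    intro t ht ω
    rw [hge t ht]
    rfl
  let E : (t : ℕ) → Matrix (Fin (S.n t)) (Fin (S.n t)) ℝ := fun t =>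
    secondMoment (jointLaw S γ) fun ω => xAt S.n m t ω - g t (outHist S.n m t ω)
  have hEe : ∀ t, 1 ≤ t → E t = secondMoment (jointLaw S γ)
      (fun ω => xAt S.n m t ω - outEstimate S γ t ω) := by
    intro t ht
    simp only [E, hGe t ht]
  have hL : ∀ t, MemLp (fun ω => xAt S.n m t ω - g t (outHist S.n m t ω)) 2 (jointLaw S γ) := by
    intro t
    rcases Nat.eq_zero_or_pos t with rfl | ht
    · simpa only [hg0 0 rfl, sub_zero] using memLp_xAt S γ 0
    · simpa only [hGe t ht] using memLp_sub_outEstimate S γ t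
  have hE0 : E 0 = S.P0 := by
    simp only [E, hg0 0 rfl, sub_zero]
    exact secondMoment_xAt_zero S γ hP0.posSemidef
  have hpsd : ∀ t, (E t).PosSemidef := fun t => secondMoment_posSemidef (hL t)
  by_cases hpd : ∀ t < T, (E (t + 1)).PosDef
  · have hE : ∀ t, t ≤ T → (E t).PosDef := by
      rintro (_ | t) ht
      · rwa [hE0]
      · exact hpd t ht
    refine le_trans (ENNReal.ofReal_le_ofReal (hopt.le_rateOf hT hW hE0 hE ?_ ?_))
      (ofReal_rateOf_le_histInfo_of_posDef γ hE0 hW hE hG ?_ ?_ ?_ ?_ ?_)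
    · intro t ht
      rw [hEe (t + 1) (by omega)]
      exact posSemidef_predAt_sub S γ (hW t ht).posSemidef (hg t) (hL t)
    · intro t ht1 htT
      rw [hEe t ht1]
      exact (trace_mul_secondMoment_sub_outEstimate_le S γ (hY t ht1 htT) (hΘ t ht1 htT)
        (hD t ht1 htT).1).trans (hD t ht1 htT).2
    · intro y
      simp only [G, Nat.zero_le, dite_true]
      exact hg0 0 rfl _
    · intro t ht
      simpa only [hGg (t + 1) ht] using hL (t + 1)
    · intro t ht
      simp only [hGg (t + 1) ht, E]
    · intro t ht
      simpa only [hGg t ht.le] using memLp_prediction_error S γ (hL t)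
    · intro t ht
      simp only [hGg t ht.le]
      exact secondMoment_prediction_error S γ (hW t ht).posSemidef (hg t) (hL t)
  -- A singular error covariance has a null direction `u`; along it the error has zero second
  -- moment, hence vanishes almost surely.
  · push Not at hpd
    obtain ⟨t, ht, hnpd⟩ := hpd
    have hex : ∃ u : Fin (S.n (t + 1)) → ℝ, u ≠ 0 ∧ u ⬝ᵥ (E (t + 1) *ᵥ u) = 0 := by
      by_contra! h
      refine hnpd (PosDef.of_dotProduct_mulVec_pos (hpsd _).1 fun u hu => ?_)
      refine lt_of_le_of_ne ?_ (Ne.symm (h u hu))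
      exact (hpsd _).dotProduct_mulVec_nonneg u
    obtain ⟨u, hu, hu0⟩ := hex
    rw [dotProduct_secondMoment (hL (t + 1))] at hu0
    have hint : Integrable (fun ω => (u ⬝ᵥ (xAt S.n m (t + 1) ω -
        g (t + 1) (outHist S.n m (t + 1) ω)).ofLp) ^ 2) (jointLaw S γ) := by
      refine (integrable_wnormSq (hL (t + 1)) (vecMulVec u u)).congr (ae_of_all _ fun ω => ?_)
      exact wnormSq_vecMulVec_self u _
    rw [integral_eq_zero_iff_of_nonneg (fun ω => sq_nonneg _) hint] at hu0
    rw [histInfo_eq_top_of_ae_eq S γ (hW t ht) ht hu (hG (t + 1))]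
    · exact le_top
    · filter_upwards [hu0] with ω hω
      rw [hGg (t + 1) ht]
      exact pow_eq_zero_iff two_ne_zero |>.1 hω

end MMSELowerBound

/-! ### Sensors with a prescribed signal-to-noise ratio -/

section Gain

variable {k r : ℕ} {C : Matrix (Fin r) (Fin k) ℝ} {V : Matrix (Fin r) (Fin r) ℝ}
  {P Q : Matrix (Fin k) (Fin k) ℝ}

lemma one_sub_gain_mul (hP : P.PosDef) (h : Cᵀ * V⁻¹ * C = P⁻¹ - Q⁻¹) :
    1 - P * Cᵀ * V⁻¹ * C = P * Q⁻¹ := by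
  have e : P * Cᵀ * V⁻¹ * C = P * (Cᵀ * V⁻¹ * C) := by simp only [Matrix.mul_assoc]
  rw [e, h, Matrix.mul_sub, mul_nonsing_inv _ (isUnit_det_of_posDef hP), sub_sub_cancel]

lemma transpose_of_posDef {M : Matrix (Fin k) (Fin k) ℝ} (hM : M.PosDef) : Mᵀ = M := by
  simpa [IsHermitian] using hM.1

/-- The filter update in information form. With `K = P Cᵀ V⁻¹` one has `1 - K C = P Q⁻¹`, so the
first term is `P Q⁻¹ P`, and the noise term `K V Kᵀ = K C P` is `P - P Q⁻¹ P`. -/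
lemma gain_covariance (hP : P.PosDef) (hQ : Q.PosDef) (hV : V.PosDef)
    (h : Cᵀ * V⁻¹ * C = P⁻¹ - Q⁻¹) :
    (1 - P * Cᵀ * V⁻¹ * C) * Q * (1 - P * Cᵀ * V⁻¹ * C)ᵀ +
      (-(P * Cᵀ * V⁻¹)) * V * (-(P * Cᵀ * V⁻¹))ᵀ = P := by
  have h1 := one_sub_gain_mul hP h
  have h2 : P * Cᵀ * V⁻¹ * C = 1 - P * Q⁻¹ := by rw [← h1, sub_sub_cancel]
  have e1 : (P * Q⁻¹) * Q * (P * Q⁻¹)ᵀ = P * Q⁻¹ * P := by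
    rw [nonsing_inv_mul_cancel_right _ _ (isUnit_det_of_posDef hQ), transpose_mul,
      transpose_of_posDef hP, transpose_of_posDef hQ.inv, Matrix.mul_assoc]
  have e2 : (-(P * Cᵀ * V⁻¹)) * V * (-(P * Cᵀ * V⁻¹))ᵀ = (P * Cᵀ * V⁻¹ * C) * P := by
    rw [transpose_neg, Matrix.neg_mul, Matrix.neg_mul, Matrix.mul_neg, neg_neg,
      nonsing_inv_mul_cancel_right _ _ (isUnit_det_of_posDef hV), transpose_mul, transpose_mul,
      transpose_transpose, transpose_of_posDef hP, transpose_of_posDef hV.inv]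
    simp only [Matrix.mul_assoc]
  rw [h1, e1, e2, h2, Matrix.sub_mul, Matrix.one_mul, add_sub_cancel]

/-- The information measured in output space equals the reduction of the log-determinant of the
error covariance in state space; the two are exchanged by `det (1 + XY) = det (1 + YX)`. -/
lemma log_det_output_covariance (hP : P.PosDef) (hQ : Q.PosDef) (hV : V.PosDef)
    (h : Cᵀ * V⁻¹ * C = P⁻¹ - Q⁻¹) :
    Real.log (predCov C V Q).det - Real.log V.det = Real.log Q.det - Real.log P.det := by
  have e1 : predCov C V Q = V * (1 + (V⁻¹ * C) * (Q * Cᵀ)) := by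
    rw [Matrix.mul_add, Matrix.mul_one, predCov, add_comm, Matrix.mul_assoc V⁻¹,
      mul_nonsing_inv_cancel_left _ _ (isUnit_det_of_posDef hV), Matrix.mul_assoc]
  have e2 : 1 + (Q * Cᵀ) * (V⁻¹ * C) = Q * P⁻¹ := by
    have : (Q * Cᵀ) * (V⁻¹ * C) = Q * (Cᵀ * V⁻¹ * C) := by simp only [Matrix.mul_assoc]
    rw [this, h, Matrix.mul_sub, mul_nonsing_inv _ (isUnit_det_of_posDef hQ), add_sub_cancel]
  rw [e1, det_mul, det_one_add_mul_comm, e2, det_mul, det_nonsing_inv, Ring.inverse_eq_inv',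
    Real.log_mul hV.det_pos.ne' (mul_pos hQ.det_pos (inv_pos.2 hP.det_pos)).ne',
    Real.log_mul hQ.det_pos.ne' (inv_pos.2 hP.det_pos).ne', Real.log_inv]
  ring

end Gain

/-! ### The linear filter -/

section Filter

variable (S : Source) (s : Sensor S.n) (P : (t : ℕ) → Matrix (Fin (S.n t)) (Fin (S.n t)) ℝ)

/-- The linear filter with gains `P_t C_tᵀ V_t⁻¹`. -/
def linFilter : (t : ℕ) → (Π i : Finset.Icc 1 t, Vec (s.r i)) → Vec (S.n t)
  | 0, _ => 0
  | t + 1, y =>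
    let z := mulVecE (S.A t) (linFilter t fun i => y ⟨i.1, icc_subset t i.2⟩)
    z + mulVecE (P (t + 1) * (s.C (t + 1))ᵀ * (s.V (t + 1))⁻¹)
      (y ⟨t + 1, Finset.mem_Icc.2 ⟨by omega, le_rfl⟩⟩ - mulVecE (s.C (t + 1)) z)

@[fun_prop]
lemma measurable_linFilter (t : ℕ) : Measurable (linFilter S s P t) := by
  induction t with
  | zero => exact measurable_const
  | succ t ih =>
    change Measurable fun y => linFilter S s P (t + 1) y
    simp only [linFilter]
    fun_prop

variable {S s P} {T : ℕ}

/-- The updated error is `1 - K C` applied to the prediction error, minus `K` applied to the sensor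
noise. The noise is independent of the prediction error, so the covariances add and
`gain_covariance` returns `P_{t+1}` exactly. -/
lemma linFilter_error (hP0 : P 0 = S.P0) (hW : ∀ t, t < T → (S.W t).PosDef)
    (hP : ∀ t, t ≤ T → (P t).PosDef) (hs : s.Admissible T)
    (hsnr : ∀ t, t < T → s.snr (t + 1) = snrOf S P t) (t : ℕ) (ht : t ≤ T) :
    MemLp (fun ω => xAt S.n s.r t ω - linFilter S s P t (outHist S.n s.r t ω)) 2
      (sensorLaw S s) ∧
    secondMoment (sensorLaw S s)
      (fun ω => xAt S.n s.r t ω - linFilter S s P t (outHist S.n s.r t ω)) = P t := by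
  induction t with
  | zero =>
    simp only [linFilter, sub_zero]
    refine ⟨memLp_xAt S s.policy 0, ?_⟩
    rw [secondMoment_xAt_zero S s.policy (hP0 ▸ (hP 0 (Nat.zero_le _)).posSemidef), hP0]
  | succ t ih =>
    obtain ⟨hL, hE⟩ := ih (by omega)
    have hpL := memLp_prediction_error S s.policy hL
    have hpE := secondMoment_prediction_error S s.policy (hW t ht).posSemidef
      (measurable_linFilter S s P t) hL
    have hV := hs (t + 1) (by omega) ht
    set K := P (t + 1) * (s.C (t + 1))ᵀ * (s.V (t + 1))⁻¹ with hK
    have hc := s.map_xAt_outAt S t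
    have hH : Measurable fun ω => (xAt S.n s.r (t + 1) ω, outHist S.n s.r t ω) := by fun_prop
    have hY := measurable_outAt (n := S.n) (m := s.r) (t + 1)
    have hf : Measurable fun p : Vec (S.n (t + 1)) × (Π i : Finset.Icc 1 t, Vec (s.r i)) =>
      id p.1 := by fun_prop
    have hnL := memLp_noise hH hY hf hc
    have hg : Measurable fun p : Vec (S.n (t + 1)) × (Π i : Finset.Icc 1 t, Vec (s.r i)) =>
      p.1 - mulVecE (S.A t) (linFilter S s P t p.2) := by fun_prop
    have hnE := secondMoment_add_noise hH hY hf hc hV.posSemidef hg hpL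
      (1 - K * s.C (t + 1)) (-K)
    have e : ∀ ω, xAt S.n s.r (t + 1) ω - linFilter S s P (t + 1) (outHist S.n s.r (t + 1) ω) =
        mulVecE (1 - K * s.C (t + 1)) (xAt S.n s.r (t + 1) ω -
          mulVecE (S.A t) (linFilter S s P t (outHist S.n s.r t ω))) +
        mulVecE (-K) (outAt S.n s.r (t + 1) ω - mulVecE (s.C (t + 1)) (xAt S.n s.r (t + 1) ω)) := by
      intro ω
      change _ - (mulVecE (S.A t) (linFilter S s P t (outHist S.n s.r t ω)) +
        mulVecE K (outAt S.n s.r (t + 1) ω - mulVecE (s.C (t + 1))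
          (mulVecE (S.A t) (linFilter S s P t (outHist S.n s.r t ω))))) = _
      rw [sub_mulVecE, one_mulVecE, neg_mulVecE]
      simp only [mulVecE_sub, ← mulVecE_mulVecE K (s.C (t + 1))]
      abel
    simp only [e]
    refine ⟨(MemLp.mulVecE hpL _).add (MemLp.mulVecE hnL _), hnE.trans ?_⟩
    change _ * secondMoment (sensorLaw S s) (fun ω => xAt S.n s.r (t + 1) ω -
      mulVecE (S.A t) (linFilter S s P t (outHist S.n s.r t ω))) * _ + _ = _
    rw [hpE, hE, hK]
    exact gain_covariance (hP _ ht) (predCov_posDef (hP t (by omega)).posSemidef (hW t ht)) hV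
      (hsnr t ht)

/-- The linear filter meets the distortion bounds and the conditional mean is at least as good. -/
lemma lgsFeasible_of_snr {Θ : (t : ℕ) → Matrix (Fin (S.n t)) (Fin (S.n t)) ℝ} {D : ℕ → ℝ}
    (hP0 : P 0 = S.P0) (hW : ∀ t, t < T → (S.W t).PosDef)
    (hP : ∀ t, t ≤ T → (P t).PosDef) (hΘ : ∀ t, 1 ≤ t → t ≤ T → (Θ t).PosSemidef)
    (hD : ∀ t, 1 ≤ t → t ≤ T → (Θ t * P t).trace ≤ D t) (hs : s.Admissible T)
    (hsnr : ∀ t, t < T → s.snr (t + 1) = snrOf S P t) : LGSFeasible S T Θ D s := by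
  refine ⟨hs, fun t ht1 htT => ?_⟩
  obtain ⟨hL, hE⟩ := linFilter_error hP0 hW hP hs hsnr t htT
  have hZ := memLp_sub_outEstimate S s.policy t
  refine ⟨integrable_wnormSq hZ _, (integral_wnormSq hZ _).trans_le ?_⟩
  have h := trace_mul_secondMoment_sub_outEstimate_le S s.policy
    (Y := fun ω => linFilter S s P t (outHist S.n s.r t ω))
    ((measurable_linFilter S s P t).comp (comap_measurable (outHist S.n s.r t)))
    (hΘ t ht1 htT) (integrable_wnormSq hL _)
  rw [integral_wnormSq hL, hE] at h
  exact h.trans (hD t ht1 htT)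

/-- Any kernel of the past outputs gives an upper bound. The kernel chosen is the Gaussian law of
the next output predicted by the filter, with covariance `R = C Σ Cᵀ + V`. In the mean of the
Gaussian divergence, the trace term and the quadratic term add up to the output dimension and cancel
it, leaving `½ (log det R - log det V)`. -/
lemma condMutualInfo_le_of_snr (hP0 : P 0 = S.P0) (hW : ∀ t, t < T → (S.W t).PosDef)
    (hP : ∀ t, t ≤ T → (P t).PosDef) (hs : s.Admissible T)
    (hsnr : ∀ t, t < T → s.snr (t + 1) = snrOf S P t) (t : ℕ) (ht : t < T) :
    condMutualInfo (sensorLaw S s) (xAt S.n s.r (t + 1)) (outAt S.n s.r (t + 1))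
      (outHist S.n s.r t) ≤ ENNReal.ofReal
        (1 / 2 * (Real.log (predAt S P t).det - Real.log (P (t + 1)).det)) := by
  obtain ⟨hL, hE⟩ := linFilter_error hP0 hW hP hs hsnr t ht.le
  have hpL := memLp_prediction_error S s.policy hL
  have hpE := secondMoment_prediction_error S s.policy (hW t ht).posSemidef
    (measurable_linFilter S s P t) hL
  rw [hE] at hpE
  change _ = predAt S P t at hpE
  have hV := hs (t + 1) (by omega) ht
  have hQ : (predAt S P t).PosDef := predCov_posDef (hP t ht.le).posSemidef (hW t ht)
  set R := predCov (s.C (t + 1)) (s.V (t + 1)) (predAt S P t) with hR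
  have hRp : R.PosDef := predCov_posDef hQ.posSemidef hV
  refine (condMutualInfo_le_lintegral (f := id) measurable_id (by fun_prop) (by fun_prop)
    (by fun_prop) (s.map_xAt_outAt S t) ((gaussChannel (s.C (t + 1)) R).comap
      (fun y => mulVecE (S.A t) (linFilter S s P t y)) (by fun_prop))).trans_eq ?_
  have hCL := MemLp.mulVecE hpL (s.C (t + 1))
  let F : SrcTraj S.n s.r → ℝ := fun ω => 1 / 2 * (Real.log R.det - Real.log (s.V (t + 1)).det +
    (R⁻¹ * s.V (t + 1)).trace - s.r (t + 1) + wnormSq R⁻¹ (mulVecE (s.C (t + 1))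
      (xAt S.n s.r (t + 1) ω - mulVecE (S.A t) (linFilter S s P t (outHist S.n s.r t ω)))))
  have hkl : ∀ ω, klDiv (gaussChannel (s.C (t + 1)) (s.V (t + 1)) (id (xAt S.n s.r (t + 1) ω)))
      ((gaussChannel (s.C (t + 1)) R).comap (fun y => mulVecE (S.A t) (linFilter S s P t y))
        (by fun_prop) (outHist S.n s.r t ω)) = ENNReal.ofReal (F ω) ∧ 0 ≤ F ω := by
    intro ω
    rw [Kernel.comap_apply, gaussChannel_apply, gaussChannel_apply]
    simp only [F, mulVecE_sub]
    exact klDiv_multivariateGaussian _ _ hV hRp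
  have hFi : Integrable F (sensorLaw S s) :=
    ((integrable_const _).add (integrable_wnormSq hCL _)).const_mul _
  rw [lintegral_congr fun ω => (hkl ω).1, ← ofReal_integral_eq_lintegral_ofReal hFi
    (ae_of_all _ fun ω => (hkl ω).2)]
  congr 1
  simp only [F]
  have hsm : secondMoment (sensorLaw S s) (fun ω => mulVecE (s.C (t + 1))
      (xAt S.n s.r (t + 1) ω - mulVecE (S.A t) (linFilter S s P t (outHist S.n s.r t ω)))) =
      R - s.V (t + 1) := by
    rw [secondMoment_mulVecE hpL, hpE, hR, predCov, add_sub_cancel_right]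
  rw [integral_const_mul, integral_add (integrable_const _) (integrable_wnormSq hCL _),
    integral_wnormSq hCL, hsm, Matrix.mul_sub, trace_sub,
    nonsing_inv_mul _ (isUnit_det_of_posDef hRp), trace_one,
    ← log_det_output_covariance (hP _ ht) hQ hV (hsnr t ht)]
  simp
  ring

lemma sum_Icc_one_eq_sum_range {M : Type*} [AddCommMonoid M] (f : ℕ → M) (T : ℕ) :
    ∑ t ∈ Finset.Icc 1 T, f t = ∑ t ∈ Finset.range T, f (t + 1) := by
  induction T with
  | zero => simp
  | succ T ih => rw [Finset.sum_Icc_succ_top (by omega), ih, Finset.sum_range_succ]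

lemma lgsCost_le_of_snr (hP0 : P 0 = S.P0) (hW : ∀ t, t < T → (S.W t).PosDef)
    (hP : ∀ t, t ≤ T → (P t).PosDef)
    (hstep : ∀ t, t < T → (predAt S P t - P (t + 1)).PosSemidef) (hs : s.Admissible T)
    (hsnr : ∀ t, t < T → s.snr (t + 1) = snrOf S P t) :
    lgsCost S T s ≤ ENNReal.ofReal (rateOf S T P) := by
  rw [lgsCost, sum_Icc_one_eq_sum_range, rateOf, ENNReal.ofReal_sum_of_nonneg]
  · exact Finset.sum_le_sum fun t ht =>
      condMutualInfo_le_of_snr hP0 hW hP hs hsnr t (Finset.mem_range.1 ht)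
  -- Each summand is nonnegative because `P_{t+1} ⪯ Σ_{t+1}`, as required to move `ENNReal.ofReal`
  -- inside the sum.
  · intro t ht
    have ht := Finset.mem_range.1 ht
    have := Real.log_le_log (hP _ ht).det_pos (det_le_det_of_sub_posSemidef (hP _ ht) (hstep t ht))
    linarith

end Filter

/-! ### Composition of sensors and estimator -/

section Composition

variable {S : Source} {s : Sensor S.n} {T : ℕ} {Θ : (t : ℕ) → Matrix (Fin (S.n t)) (Fin (S.n t)) ℝ}
  {D : ℕ → ℝ} {P Q : (t : ℕ) → Matrix (Fin (S.n t)) (Fin (S.n t)) ℝ}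

/-- The history of the estimates. -/
def estHist (S : Source) (s : Sensor S.n) (t : ℕ) (ω : SrcTraj S.n s.r) :
    Π i : Finset.Icc 1 t, Vec (S.n i) :=
  fun i => estimate S s i ω

/-- Since the estimates are functions of the outputs, they also do not influence the source, and
data processing applies to them. -/
lemma exists_estHist_eq (S : Source) (s : Sensor S.n) (t : ℕ) :
    ∃ G : (Π i : Finset.Icc 1 t, Vec (s.r i)) → (Π i : Finset.Icc 1 t, Vec (S.n i)),
      Measurable G ∧ ∀ ω, estHist S s t ω = G (outHist S.n s.r t ω) := by
  choose g hg hge using exists_outEstimate_eq S s.policy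
  refine ⟨fun y i => g i.1 fun j => y ⟨j.1, Finset.Icc_subset_Icc_right
    (Finset.mem_Icc.1 i.2).2 j.2⟩, ?_, fun ω => ?_⟩
  · refine measurable_pi_lambda _ fun i => ?_
    have := hg i.1
    fun_prop
  · funext i
    exact congrFun (hge i.1) ω

@[fun_prop]
lemma measurable_estimate (S : Source) (s : Sensor S.n) (t : ℕ) : Measurable (estimate S s t) :=
  (stronglyMeasurable_condExp.mono (comap_outHist_le S.n s.r t)).measurable

@[fun_prop]
lemma measurable_estHist (S : Source) (s : Sensor S.n) (t : ℕ) : Measurable (estHist S s t) := by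
  unfold estHist
  fun_prop

/-- The reproduction policy that draws the next estimate from its conditional law given the
source history and the past estimates. -/
def compositionPolicy (S : Source) (s : Sensor S.n) : Policy S.n S.n where
  kernel t := condDistrib (estimate S s (t + 1))
    (fun ω => (xHist S.n s.r t ω, xAt S.n s.r (t + 1) ω, estHist S s t ω)) (sensorLaw S s)
  markov _ := inferInstance

lemma xHist_zero_eq {n m : ℕ → ℕ} (ω : SrcTraj n m) : xHist n m 0 ω =
    (MeasurableEquiv.piUnique fun i : Finset.Iic 0 => Vec (n i)).symm (xAt n m 0 ω) :=
  ((MeasurableEquiv.piUnique fun i : Finset.Iic 0 => Vec (n i)).symm_apply_apply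
    (xHist n m 0 ω)).symm

/-- Induction on time. In both models the next state comes from the source channel applied to `x_t`:
in the sensor model because past estimates are functions of past outputs. The next reproduction then
has the right conditional law by the choice of the policy. -/
lemma map_compositionPolicy (S : Source) (s : Sensor S.n) (t : ℕ) :
    (jointLaw S (compositionPolicy S s)).map (fun ω => (xHist S.n S.n t ω, outHist S.n S.n t ω)) =
      (sensorLaw S s).map (fun ω => (xHist S.n s.r t ω, estHist S s t ω)) := by
  induction t with
  | zero =>
    have : IsEmpty (Finset.Icc 1 0) := ⟨fun i => by simpa using i.2⟩
    let F : Vec (S.n 0) → (Π i : Finset.Iic 0, Vec (S.n i)) × (Π i : Finset.Icc 1 0, Vec (S.n i)) :=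
      fun x => ((MeasurableEquiv.piUnique fun i : Finset.Iic 0 => Vec (S.n i)).symm x,
        fun i => isEmptyElim i)
    have hF : Measurable F := (MeasurableEquiv.measurable _).prodMk measurable_const
    have e1 : (fun ω => (xHist S.n S.n 0 ω, outHist S.n S.n 0 ω)) = F ∘ xAt S.n S.n 0 := by
      funext ω
      exact Prod.ext (xHist_zero_eq ω) (funext fun i => isEmptyElim i)
    have e2 : (fun ω => (xHist S.n s.r 0 ω, estHist S s 0 ω)) = F ∘ xAt S.n s.r 0 := by
      funext ω
      exact Prod.ext (xHist_zero_eq ω) (funext fun i => isEmptyElim i)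
    rw [e1, e2, ← Measure.map_map hF (by fun_prop), ← Measure.map_map hF (by fun_prop),
      map_xAt_zero, map_xAt_zero]
  | succ t ih =>
    obtain ⟨G, hG, hGe⟩ := exists_estHist_eq S s t
    let γ := compositionPolicy S s
    have h1 : (jointLaw S γ).map (fun ω => ((xHist S.n S.n t ω, outHist S.n S.n t ω),
        xAt S.n S.n (t + 1) ω)) =
        (jointLaw S γ).map (fun ω => (xHist S.n S.n t ω, outHist S.n S.n t ω)) ⊗ₘ
          (gaussChannel (S.A t) (S.W t)).comap (fun p => lastX S.n t p.1) (by fun_prop) :=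
      map_next_state S γ t (g := fun h => ((fun i => (h i).1 : Π i : Finset.Iic t, Vec (S.n i)),
        (fun i => (h ⟨i.1, Finset.mem_Iic.2 (Finset.mem_Icc.1 i.2).2⟩).2 :
          Π i : Finset.Icc 1 t, Vec (S.n i)))) (by fun_prop) (by fun_prop) (fun _ => rfl)
    have h2 : (sensorLaw S s).map (fun ω => ((xHist S.n s.r t ω, estHist S s t ω),
        xAt S.n s.r (t + 1) ω)) =
        (sensorLaw S s).map (fun ω => (xHist S.n s.r t ω, estHist S s t ω)) ⊗ₘ
          (gaussChannel (S.A t) (S.W t)).comap (fun p => lastX S.n t p.1) (by fun_prop) := by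
      simp only [hGe]
      exact map_next_state S s.policy t
        (g := fun h => ((fun i => (h i).1 : Π i : Finset.Iic t, Vec (S.n i)),
        G (fun i => (h ⟨i.1, Finset.mem_Iic.2 (Finset.mem_Icc.1 i.2).2⟩).2))) (by fun_prop)
        (by fun_prop) (fun _ => rfl)
    have h3 : (jointLaw S γ).map (fun ω => (xHist S.n S.n t ω, xAt S.n S.n (t + 1) ω,
        outHist S.n S.n t ω)) = (sensorLaw S s).map (fun ω => (xHist S.n s.r t ω,
          xAt S.n s.r (t + 1) ω, estHist S s t ω)) := by
      have h12 := h1.trans ((congrArg (fun ν => ν ⊗ₘ (gaussChannel (S.A t) (S.W t)).comap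
        (fun p : (Π i : Finset.Iic t, Vec (S.n i)) × (Π i : Finset.Icc 1 t, Vec (S.n i)) =>
          lastX S.n t p.1) (by fun_prop)) ih).trans h2.symm)
      have h := congrArg (Measure.map fun q => (q.1.1, q.2, q.1.2)) h12
      rw [Measure.map_map (by fun_prop) (by fun_prop), Measure.map_map (by fun_prop)
        (by fun_prop)] at h
      exact h
    have h4 := map_policyInput_outAt S γ t
    have h5 := compProd_map_condDistrib (μ := sensorLaw S s) (mβ := inferInstance)
      (X := fun ω => (xHist S.n s.r t ω, xAt S.n s.r (t + 1) ω, estHist S s t ω))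
      (Y := estimate S s (t + 1)) (measurable_estimate S s (t + 1)).aemeasurable
    have h6 := h4.trans ((congrArg (fun ν => ν ⊗ₘ γ.kernel t) h3).trans h5)
    have hsn : Measurable fun q : ((Π i : Finset.Iic t, Vec (S.n i)) × Vec (S.n (t + 1)) ×
        (Π i : Finset.Icc 1 t, Vec (S.n i))) × Vec (S.n (t + 1)) =>
        (snocX S.n t (q.1.1, q.1.2.1), snocY S.n t (q.1.2.2, q.2)) := by fun_prop
    have h7 := congrArg (Measure.map fun q => (snocX S.n t (q.1.1, q.1.2.1),
      snocY S.n t (q.1.2.2, q.2))) h6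
    rw [Measure.map_map hsn (by fun_prop), Measure.map_map hsn (by fun_prop)] at h7
    have e1 : (fun ω => (xHist S.n S.n (t + 1) ω, outHist S.n S.n (t + 1) ω)) =
      (fun q : ((Π i : Finset.Iic t, Vec (S.n i)) × Vec (S.n (t + 1)) ×
        (Π i : Finset.Icc 1 t, Vec (S.n i))) × Vec (S.n (t + 1)) =>
        (snocX S.n t (q.1.1, q.1.2.1), snocY S.n t (q.1.2.2, q.2))) ∘
      fun ω => ((xHist S.n S.n t ω, xAt S.n S.n (t + 1) ω, outHist S.n S.n t ω),
        outAt S.n S.n (t + 1) ω) := by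
      funext ω
      exact Prod.ext (snocX_xHist t ω).symm (snocY_outHist t ω).symm
    have e2 : (fun ω => (xHist S.n s.r (t + 1) ω, estHist S s (t + 1) ω)) =
      (fun q : ((Π i : Finset.Iic t, Vec (S.n i)) × Vec (S.n (t + 1)) ×
        (Π i : Finset.Icc 1 t, Vec (S.n i))) × Vec (S.n (t + 1)) =>
        (snocX S.n t (q.1.1, q.1.2.1), snocY S.n t (q.1.2.2, q.2))) ∘
      fun ω => ((xHist S.n s.r t ω, xAt S.n s.r (t + 1) ω, estHist S s t ω),
        estimate S s (t + 1) ω) := by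
      funext ω
      exact Prod.ext (snocX_xHist t ω).symm (glue_unglue (X := fun i => Vec (S.n i)) (icc_succ t)
        (icc_subset t) (Finset.mem_Icc.2 ⟨by omega, le_rfl⟩) (estHist S s (t + 1) ω)).symm
    rw [e1, e2]
    exact h7

lemma isComposition_compositionPolicy (S : Source) (T : ℕ) (s : Sensor S.n) :
    IsComposition S T s (compositionPolicy S s) :=
  map_compositionPolicy S s T

variable {γ : Policy S.n S.n}

/-- Estimation does not increase the directed information. -/
lemma IsComposition.histInfo_le (h : IsComposition S T s γ) :
    histInfo S γ T ≤ histInfo S s.policy T := by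
  obtain ⟨G, hG, hGe⟩ := exists_estHist_eq S s T
  change (jointLaw S γ).map (fun ω => (xHist S.n S.n T ω, outHist S.n S.n T ω)) =
    (sensorLaw S s).map (fun ω => (xHist S.n s.r T ω, estHist S s T ω)) at h
  have hx := Measure.isProbabilityMeasure_map (μ := sensorLaw S s)
    (measurable_xHist (n := S.n) (m := s.r) T).aemeasurable
  have hy := Measure.isProbabilityMeasure_map (μ := sensorLaw S s)
    (measurable_outHist (n := S.n) (m := s.r) T).aemeasurable
  have hxy := Measure.isProbabilityMeasure_map (μ := sensorLaw S s)
    ((measurable_xHist (n := S.n) (m := s.r) T).prodMk (measurable_outHist T)).aemeasurable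
  have h1 := congrArg (Measure.map Prod.fst) h
  have h2 := congrArg (Measure.map Prod.snd) h
  rw [Measure.map_map (by fun_prop) (by fun_prop), Measure.map_map (by fun_prop) (by fun_prop)]
    at h1 h2
  have h1' : (jointLaw S γ).map (xHist S.n S.n T) = (sensorLaw S s).map (xHist S.n s.r T) := h1
  have h2' : (jointLaw S γ).map (outHist S.n S.n T) =
      ((sensorLaw S s).map (outHist S.n s.r T)).map G := by
    rw [Measure.map_map hG (by fun_prop)]
    refine h2.trans ?_
    congr 1
    funext ω
    exact hGe ω
  have h3 : (sensorLaw S s).map (fun ω => (xHist S.n s.r T ω, estHist S s T ω)) =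
      ((sensorLaw S s).map (fun ω => (xHist S.n s.r T ω, outHist S.n s.r T ω))).map
        (Prod.map id G) := by
    rw [Measure.map_map (measurable_id.prodMap hG) (by fun_prop)]
    congr 1
    funext ω
    exact Prod.ext rfl (hGe ω)
  have h4 := Measure.map_prod_map ((sensorLaw S s).map (xHist S.n s.r T))
    ((sensorLaw S s).map (outHist S.n s.r T)) measurable_id hG
  rw [Measure.map_id] at h4
  rw [histInfo, histInfo, h, h1', h2', h3, h4]
  exact klDiv_map_le _ _ (measurable_id.prodMap hG)

lemma IsComposition.srdFeasible (h : IsComposition S T s γ) (hs : LGSFeasible S T Θ D s) :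
    SRDFeasible S T Θ D γ := by
  intro t ht1 htT
  change (jointLaw S γ).map (fun ω => (xHist S.n S.n T ω, outHist S.n S.n T ω)) =
    (sensorLaw S s).map (fun ω => (xHist S.n s.r T ω, estHist S s T ω)) at h
  let F : (Π i : Finset.Iic T, Vec (S.n i)) × (Π i : Finset.Icc 1 T, Vec (S.n i)) → ℝ :=
    fun p => wnormSq (Θ t) (p.1 ⟨t, Finset.mem_Iic.2 htT⟩ - p.2 ⟨t, Finset.mem_Icc.2 ⟨ht1, htT⟩⟩)
  have hF : Measurable F := by fun_prop
  have hm1 : Measurable fun ω => (xHist S.n S.n T ω, outHist S.n S.n T ω) := by fun_prop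
  have hm2 : Measurable fun ω => (xHist S.n s.r T ω, estHist S s T ω) := by fun_prop
  obtain ⟨hi, hle⟩ := hs.2 t ht1 htT
  have hi' : Integrable F ((sensorLaw S s).map fun ω => (xHist S.n s.r T ω, estHist S s T ω)) :=
    (integrable_map_measure hF.aestronglyMeasurable hm2.aemeasurable).2 hi
  have he := integral_map (μ := sensorLaw S s) hm2.aemeasurable hF.aestronglyMeasurable
  rw [← h] at hi' he
  rw [integral_map hm1.aemeasurable hF.aestronglyMeasurable] at he
  exact ⟨(integrable_map_measure hF.aestronglyMeasurable hm1.aemeasurable).1 hi', he.trans_le hle⟩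

end Composition

/-! ### Optimality -/

section Optimality

variable {S : Source} {T : ℕ} {Θ : (t : ℕ) → Matrix (Fin (S.n t)) (Fin (S.n t)) ℝ}
  {D : ℕ → ℝ} {P Q : (t : ℕ) → Matrix (Fin (S.n t)) (Fin (S.n t)) ℝ}

lemma ofReal_maxDetObj_le_srdCost (hT : 1 ≤ T) (hP0 : S.P0.PosDef)
    (hW : ∀ t, t < T → (S.W t).PosDef) (hΘ : ∀ t, 1 ≤ t → t ≤ T → (Θ t).PosSemidef)
    (hopt : MaxDetOptimal S T Θ D P Q) {γ : Policy S.n S.n} (hγ : SRDFeasible S T Θ D γ) :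
    ENNReal.ofReal (maxDetObj S T Q) ≤ srdCost S T γ := by
  rw [srdCost_eq_histInfo]
  refine ofReal_maxDetObj_le_histInfo γ hT hP0 hW hΘ hopt (Y := fun t => outAt S.n S.n t) ?_ hγ
  intro t ht1 _
  have hr : Measurable fun y : Π i : Finset.Icc 1 t, Vec (S.n i) =>
      y ⟨t, Finset.mem_Icc.2 ⟨ht1, le_rfl⟩⟩ := by fun_prop
  exact hr.comp (comap_measurable (outHist S.n S.n t))

lemma ofReal_maxDetObj_le_lgsCost (hT : 1 ≤ T) (hP0 : S.P0.PosDef)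
    (hW : ∀ t, t < T → (S.W t).PosDef) (hΘ : ∀ t, 1 ≤ t → t ≤ T → (Θ t).PosSemidef)
    (hopt : MaxDetOptimal S T Θ D P Q) {s : Sensor S.n} (hs : LGSFeasible S T Θ D s) :
    ENNReal.ofReal (maxDetObj S T Q) ≤ lgsCost S T s := by
  rw [lgsCost_eq_histInfo]
  exact ofReal_maxDetObj_le_histInfo s.policy hT hP0 hW hΘ hopt (Y := fun t => estimate S s t)
    (fun t _ _ => stronglyMeasurable_condExp.measurable) hs.2

end Optimality

end
end GaussSRD

/-! ### The main theorem. -/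

theorem theorem1 (S : Source) (T : ℕ) (hT : 1 ≤ T)
    (hP0 : S.P0.PosDef) (hW : ∀ t, t < T → (S.W t).PosDef)
    (Θ : (t : ℕ) → Matrix (Fin (S.n t)) (Fin (S.n t)) ℝ)
    (hΘ : ∀ t, 1 ≤ t → t ≤ T → (Θ t).PosSemidef)
    (D : ℕ → ℝ) :
    ((∀ t, 1 ≤ t → t ≤ T → 0 < D t) → ∃ P Q, MaxDetOptimal S T Θ D P Q) ∧
    ∀ P Q, MaxDetOptimal S T Θ D P Q →
      (∀ t, t < T → (P (t + 1)).PosDef ∧ (snrOf S P t).PosSemidef) ∧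
      (∃ (r : ℕ → ℕ) (U : (t : ℕ) → Matrix (Fin (S.n t)) (Fin (r t)) ℝ)
        (σ : (t : ℕ) → Fin (r t) → ℝ),
        ∀ t, t < T → IsReducedSVD (snrOf S P t) (U (t + 1)) (σ (t + 1))) ∧
      (∀ (r : ℕ → ℕ) (U : (t : ℕ) → Matrix (Fin (S.n t)) (Fin (r t)) ℝ)
        (σ : (t : ℕ) → Fin (r t) → ℝ),
        (∀ t, t < T → IsReducedSVD (snrOf S P t) (U (t + 1)) (σ (t + 1))) →
        (sensorOfSVD r U σ).Admissible T ∧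
        ∀ t, t < T → (sensorOfSVD r U σ).snr (t + 1) = snrOf S P t) ∧
      (∀ s : Sensor S.n, s.Admissible T → (∀ t, t < T → s.snr (t + 1) = snrOf S P t) →
        LGSOptimal S T Θ D s ∧
        lgsCost S T s = ENNReal.ofReal (maxDetObj S T Q) ∧
        (∃ γ : Policy S.n S.n, IsComposition S T s γ) ∧
        ∀ γ : Policy S.n S.n, IsComposition S T s γ →
          SRDOptimal S T Θ D γ ∧
          srdCost S T γ = ENNReal.ofReal (maxDetObj S T Q)) := by
  refine ⟨exists_maxDetOptimal hT hP0 hW, fun P Q hopt => ?_⟩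
  have hf := hopt.1
  have hP := hf.posDef hP0
  have hsnr := hf.snr_posSemidef hP0 hW
  refine ⟨fun t ht => ⟨hP (t + 1) ht, hsnr t ht⟩, ?_, fun r U σ h => ⟨?_, ?_⟩, fun s hs hsn => ?_⟩
  · have hex : ∀ t, ∃ (r : ℕ) (U : Matrix (Fin (S.n (t + 1))) (Fin r) ℝ) (σ : Fin r → ℝ),
        t < T → IsReducedSVD (snrOf S P t) U σ := by
      intro t
      by_cases ht : t < T
      · obtain ⟨r, U, σ, h⟩ := exists_isReducedSVD (hsnr t ht)
        exact ⟨r, U, σ, fun _ => h⟩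
      · exact ⟨0, 0, 0, fun h => absurd h ht⟩
    choose r U σ h using hex
    -- The decomposition for `snrOf S P t` is stored at time `t + 1`; time `0`, where nothing is
    -- required, gets the empty one.
    refine ⟨fun t => Nat.casesOn t 0 r,
      fun t => Nat.rec (motive := fun t => Matrix (Fin (S.n t))
        (Fin (Nat.casesOn (motive := fun _ => ℕ) t 0 r)) ℝ) 0 (fun t _ => U t) t,
      fun t => Nat.rec (motive := fun t => Fin (Nat.casesOn (motive := fun _ => ℕ) t 0 r) → ℝ) 0
        (fun t _ => σ t) t, h⟩
  · rintro (_ | t) ht1 htT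
    · omega
    · exact PosDef.diagonal fun i => inv_pos.2 ((h t htT).pos i)
  · exact fun t ht => (h t ht).snr_eq
  -- The sandwich: the sensor cost is at most the rate of `P`, which is at most the objective, which
  -- by the converse is at most the cost of any feasible sensor or policy.
  · have hle := (lgsCost_le_of_snr hf.init hW hP hf.step hs hsn).trans
      (ENNReal.ofReal_le_ofReal (hf.rateOf_le hT hP0 hW))
    have hfeas := lgsFeasible_of_snr hf.init hW hP hΘ hf.trace_le hs hsn
    refine ⟨⟨hfeas, fun s' hs' =>
      hle.trans (ofReal_maxDetObj_le_lgsCost hT hP0 hW hΘ hopt hs')⟩,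
      le_antisymm hle (ofReal_maxDetObj_le_lgsCost hT hP0 hW hΘ hopt hfeas),
      ⟨_, isComposition_compositionPolicy S T s⟩, fun γ hγ => ?_⟩
    have hγf := hγ.srdFeasible hfeas
    -- Both costs are mutual informations of whole histories, so data processing from outputs to
    -- estimates carries over the upper bound.
    have hγle : srdCost S T γ ≤ ENNReal.ofReal (maxDetObj S T Q) := by
      rw [srdCost_eq_histInfo]
      rw [lgsCost_eq_histInfo] at hle
      exact hγ.histInfo_le.trans hle
    exact ⟨⟨hγf, fun γ' hγ' => hγle.trans (ofReal_maxDetObj_le_srdCost hT hP0 hW hΘ hopt hγ')⟩,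
      le_antisymm hγle (ofReal_maxDetObj_le_srdCost hT hP0 hW hΘ hopt hγf)⟩
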